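/- Let $\mathrm{Tower}(0,m)=m$ and $\mathrm{Tower}(k+1,m)=2^{\mathrm{Tower}(k,m)}$. For each $i<\omega$ there is a constant $c_i$ such that the first-order theory of $(\omega^{\omega^i},+)$ is decidable in time $O(\mathrm{Tower}(n,c_i))$, where $n$ is the length of the formula; in particular the height $n$ of the tower does not depend on $i$. Here $(\omega^{\omega^i},+)$ is the set of all ordinals below $\omega^{\omega^i}$ with addition as a ternary relation $x+y=z$. Formulas are built from the atomic formulas $x+y=z$ in variables $x_0,x_1,x_2,\dots$ by $\neg,\wedge,\vee,\rightarrow,\leftrightarrow$ and $\exists x$ ($\forall$ abbreviates $\neg\exists\neg$), and they are written as words over a finite alphabet in prefix notation, with the indices of the variables in binary; the length of a formula is the length of this word. Decidability in time $O(T(n))$ means that a multi-tape (multi-stack) Turing machine, given any sentence (formula without free variables) of length $n$, decides in $O(T(n))$ steps whether it is true in the structure. -/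

import Mathlib

namespace OrdinalAddition

/-- The tower of exponentials: `tower 0 n = n` and `tower (k + 1) n = 2 ^ tower k n`, so that
`tower k n` has height `k` and `n` on top. -/
def tower : ℕ → ℕ → ℕ
  | 0, n => n
  | k + 1, n => 2 ^ tower k n

/-- First-order formulas over one ternary relation, addition. The individual variables are
`x_0, x_1, x_2, …`, given by their indices. -/
inductive Formula : Type
  /-- the atomic formula `x + y = z` -/
  | plus (x y z : ℕ) : Formula
  | neg (φ : Formula) : Formula
  | conj (φ ψ : Formula) : Formula
  | disj (φ ψ : Formula) : Formula
  | imp (φ ψ : Formula) : Formula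
  | iff (φ ψ : Formula) : Formula
  /-- the formula `∃ x, φ` -/
  | ex (x : ℕ) (φ : Formula) : Formula

namespace Formula

/-- The variables that occur free in a formula. -/
def freeVars : Formula → Finset ℕ
  | plus x y z => {x, y, z}
  | neg φ => φ.freeVars
  | conj φ ψ => φ.freeVars ∪ ψ.freeVars
  | disj φ ψ => φ.freeVars ∪ ψ.freeVars
  | imp φ ψ => φ.freeVars ∪ ψ.freeVars
  | iff φ ψ => φ.freeVars ∪ ψ.freeVars
  | ex x φ => φ.freeVars.erase x

/-- `φ.Holds α v`: the formula `φ` is satisfied in `(α, +)` by the valuation `v`. The universe of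
this structure is the set of all ordinals below `α`, and its relation is `x + y = z`. -/
def Holds (α : Ordinal.{0}) : Formula → (ℕ → Set.Iio α) → Prop
  | plus x y z, v => (v x : Ordinal.{0}) + (v y : Ordinal.{0}) = (v z : Ordinal.{0})
  | neg φ, v => ¬ φ.Holds α v
  | conj φ ψ, v => φ.Holds α v ∧ ψ.Holds α v
  | disj φ ψ, v => φ.Holds α v ∨ ψ.Holds α v
  | imp φ ψ, v => φ.Holds α v → ψ.Holds α v
  | iff φ ψ, v => (φ.Holds α v ↔ ψ.Holds α v)
  | ex x φ, v => ∃ a : Set.Iio α, φ.Holds α (Function.update v x a)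

end Formula

/-- The finite alphabet in which formulas are written. -/
inductive Letter : Type
  | plus | neg | conj | disj | imp | iff | ex
  /-- the letter `x`, which begins every variable -/
  | var
  /-- a binary digit of the index of a variable -/
  | digit (b : Bool)

/-- The variable `x_j` is written as the letter `x` followed by the binary digits of `j`, least
significant digit first (no digits for `j = 0`). -/
def writeVar (j : ℕ) : List Letter :=
  Letter.var :: (Nat.bits j).map Letter.digit

/-- Formulas are written as words in prefix (Polish) notation, which needs no parentheses. The
length of a formula is the length of this word. -/
def Formula.write : Formula → List Letter
  | plus x y z => Letter.plus :: (writeVar x ++ writeVar y ++ writeVar z)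
  | neg φ => Letter.neg :: φ.write
  | conj φ ψ => Letter.conj :: (φ.write ++ ψ.write)
  | disj φ ψ => Letter.disj :: (φ.write ++ ψ.write)
  | imp φ ψ => Letter.imp :: (φ.write ++ ψ.write)
  | iff φ ψ => Letter.iff :: (φ.write ++ ψ.write)
  | ex x φ => Letter.ex :: (writeVar x ++ φ.write)

/-- A sentence is a formula without free variables. -/
abbrev Sentence : Type := {φ : Formula // φ.freeVars = ∅}

/-- The first-order theory of `(α, +)`: the set of all sentences that are true in it. (The
valuation is irrelevant for a sentence.) -/
def theory (α : Ordinal.{0}) : Set Sentence :=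
  {φ | ∀ v : ℕ → Set.Iio α, φ.1.Holds α v}

open Classical in
/-- `DecidableInTimeO S T`: the set `S` of sentences is decidable in time `O(T(n))`. There is a
multi-stack Turing machine with finite alphabets which, started on the word of any sentence `φ`,
halts with the answer whether `φ ∈ S` after at most `t n` steps, where `n` is the length of that
word, and `t` is in `O(T)`. -/
def DecidableInTimeO (S : Set Sentence) (T : ℕ → ℕ) : Prop :=
  ∃ M : Turing.TM2ComputableInTime (fun φ : Sentence => φ.1.write) Computability.encodeBool
      (fun φ : Sentence => decide (φ ∈ S)),
    (∀ k, Finite (M.tm.Γ k)) ∧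
    (fun n => (M.time n : ℝ)) =O[Filter.atTop] (fun n => (T n : ℝ))

end OrdinalAddition

/-! Since `base (k + 1) = base k ^ ω`, an ordinal below `base (k + 1)` is a finite sequence of
digits below `base k`. Thus an ordinal below `base (i + 1) = ω ^ ω ^ i` is a nested finite sequence
of bits of depth `i + 1`. Addition respects this nesting: seven yes/no facts about a triple
(`flags`) are determined by the facts about its quotients and those about its remainders
(`flags_congr`). At the bottom this is binary addition with carry; higher up, `base k` is additively
principal, so a low digit of the left summand is either kept or absorbed. Invariants with this
property are closed under products and, by the subset construction, under projections. Hence every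
formula has a finite compositional invariant that determines its truth (`exists_invariant`). The
number of its values is bounded by `Formula.states`, a tower whose height is about the number `q` of
quantifiers, the same for all levels `k`.

A pumping argument on each level then yields small witnesses. If all sequences in the parameters
have length at most `s`, and the invariant has at most `N` values, a witness can be chosen with
sequences of length at most `s + N` (`Compositional.exists_mem_box`). Nested sequences are flattened
to words over two bits and `i` separators, of length polynomial in `s` with degree `i + 1`
(`exists_word`). So a quantifier may range over the words of length `S ^ (2 * (i + 1))`, where `S`
is the length of the latest word, provided that `S` is at least the number of states
(`Formula.eval_iff`). Atomic formulas are decided by a finite automaton (`transition_vec`,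
`does_merge`).

The algorithm starts with a word of length `tower (q + 1) (7 * n)` and searches exhaustively. The
search adds only a bounded number of exponentials (`cost_le`). A quantifier takes at least two
letters, so `q` is less than `n / 2`, and the remaining half of the tower absorbs the argument `7 *
n`, these exponentials and every dependence on `i` (`timeBound_le`). Therefore `c = 1` suffices for
all `i`.

The algorithm is written in a small language of stack programs, whose translation into Turing
machines preserves the number of steps up to one (`machine_evals`). -/

/-! ## A structured language of stack programs and its compilation into Turing machines -/

namespace StackProgram

/-- Programs that work on stacks with alphabets `Γ k` and exit with a value of a type `α`. -/
inductive Prog {K : Type} (Γ : K → Type) : Type → Type 1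
  | pure {α : Type} (a : α) : Prog Γ α
  | push (k : K) (a : Γ k) : Prog Γ Unit
  | pop (k : K) : Prog Γ (Option (Γ k))
  | bind {α β : Type} (hα : Finite α) (p : Prog Γ α) (f : α → Prog Γ β) : Prog Γ β
  | loop {α β : Type} (hα : Finite α) (f : α → Prog Γ (α ⊕ β)) (a : α) : Prog Γ β

/-- `LoopRuns r a s b s' t`: iterating the relation `r` from `a` and `s` until it exits on the
right leads to `b` and `s'`, with total cost `t`. -/
inductive LoopRuns {α β S : Type} (r : α → S → α ⊕ β → S → ℕ → Prop) :
    α → S → β → S → ℕ → Prop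
  | quit {a s b s' t} : r a s (Sum.inr b) s' t → LoopRuns r a s b s' t
  | next {a s a' s₁ t₁ b s' t₂} : r a s (Sum.inl a') s₁ t₁ → LoopRuns r a' s₁ b s' t₂ →
      LoopRuns r a s b s' (t₁ + t₂)

namespace Prog

variable {K : Type} {Γ : K → Type}

/-- The positions in a program. -/
def Lab : {α : Type} → Prog Γ α → Type
  | _, pure _ => Unit
  | _, push _ _ => Unit
  | _, pop _ => Unit
  | _, bind _ p f => Lab p ⊕ Σ a, Lab (f a)
  | _, loop _ f _ => Σ a, Lab (f a)

theorem finite_lab {α : Type} (p : Prog Γ α) : Finite (Lab p) := by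
  induction p with
  | pure a => exact inferInstanceAs (Finite Unit)
  | push k a => exact inferInstanceAs (Finite Unit)
  | pop k => exact inferInstanceAs (Finite Unit)
  | bind hα p f ihp ihf => exact inferInstanceAs (Finite (Lab p ⊕ Σ a, Lab (f a)))
  | loop hα f a ih => exact inferInstanceAs (Finite (Σ a, Lab (f a)))

/-- The initial position of a program. -/
def entry : {α : Type} → (p : Prog Γ α) → Lab p
  | _, pure _ => ()
  | _, push _ _ => ()
  | _, pop _ => ()
  | _, bind _ p _ => Sum.inl (entry p)
  | _, loop _ f a => ⟨a, entry (f a)⟩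

variable [DecidableEq K]

/-- The statements of the compiled program, when the positions of the program are embedded by
`emb` into a set of labels and the exits lead to the labels `exit a`. -/
def stmt {L : Type} : {α : Type} → (p : Prog Γ α) → (emb : Lab p → L) → (exit : α → L) → Lab p →
    Turing.TM2.Stmt Γ L (∀ k, Option (Γ k))
  | _, pure a, _, exit, _ => .goto fun _ => exit a
  | _, push k a, _, exit, _ => .push k (fun _ => a) (.goto fun _ => exit ())
  | _, pop k, _, exit, _ => .pop k (fun v o => Function.update v k o) (.goto fun v => exit (v k))
  | _, bind _ p f, emb, exit, l => match (l : Lab p ⊕ Σ a, Lab (f a)) with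
    | Sum.inl l => stmt p (fun l => emb (Sum.inl l)) (fun a => emb (Sum.inr ⟨a, entry (f a)⟩)) l
    | Sum.inr ⟨a, l⟩ => stmt (f a) (fun l => emb (Sum.inr ⟨a, l⟩)) exit l
  | _, loop _ f _, emb, exit, l => match (l : Σ a, Lab (f a)) with
    | ⟨a, l⟩ =>
      stmt (f a) (fun l => emb ⟨a, l⟩) (Sum.elim (fun a' => emb ⟨a', entry (f a')⟩) exit) l

/-- `Runs p S a S' t`: started with the stacks `S`, the program `p` exits with the value `a` and
the stacks `S'` after `t` steps. -/
def Runs : {α : Type} → Prog Γ α → (∀ k, List (Γ k)) → α → (∀ k, List (Γ k)) → ℕ → Prop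
  | _, pure a, S, b, S', t => b = a ∧ S' = S ∧ t = 1
  | _, push k a, S, _, S', t => S' = Function.update S k (a :: S k) ∧ t = 1
  | _, pop k, S, o, S', t => o = (S k).head? ∧ S' = Function.update S k (S k).tail ∧ t = 1
  | _, bind _ p f, S, b, S', t =>
      ∃ a S₁ t₁ t₂, Runs p S a S₁ t₁ ∧ Runs (f a) S₁ b S' t₂ ∧ t = t₁ + t₂
  | _, loop _ f a, S, b, S', t => LoopRuns (fun a => Runs (f a)) a S b S' t

/-- Each `pure`, `push` or `pop` becomes one statement that ends in a jump, while `bind` and `loop`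
only redirect exits, so the machine takes exactly `t` steps. Exit values are remembered in the
labels. The internal state `v` may be arbitrary, because only the jump of a `pop` reads it, at the
entry that this `pop` has just overwritten. -/
theorem Runs.simulate {L : Type} (M : L → Turing.TM2.Stmt Γ L (∀ k, Option (Γ k))) {α : Type}
    (p : Prog Γ α) (emb : Lab p → L) (exit : α → L) (hM : ∀ l, M (emb l) = stmt p emb exit l)
    {S : ∀ k, List (Γ k)} {a : α} {S' : ∀ k, List (Γ k)} {t : ℕ} (h : Runs p S a S' t)
    (v : ∀ k, Option (Γ k)) :
    ∃ v', (flip Option.bind (Turing.TM2.step M))^[t] (some ⟨some (emb (entry p)), v, S⟩) =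
      some ⟨some (exit a), v', S'⟩ := by
  induction p generalizing S S' t v with
  | pure b =>
    obtain ⟨rfl, rfl, rfl⟩ := h
    refine ⟨v, ?_⟩
    simp [flip, Turing.TM2.step, hM, stmt]
  | push k b =>
    obtain ⟨rfl, rfl⟩ := h
    refine ⟨v, ?_⟩
    simp [flip, Turing.TM2.step, hM, stmt]
  | pop k =>
    obtain ⟨rfl, rfl, rfl⟩ := h
    refine ⟨Function.update v k (S k).head?, ?_⟩
    simp [flip, Turing.TM2.step, hM, stmt]
  | bind hα p f ihp ihf =>
    obtain ⟨b, S₁, t₁, t₂, h₁, h₂, rfl⟩ := h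
    obtain ⟨v₁, e₁⟩ := ihp (fun l => emb (Sum.inl l)) (fun a => emb (Sum.inr ⟨a, entry (f a)⟩))
      (fun l => hM (Sum.inl l)) h₁ v
    obtain ⟨v₂, e₂⟩ :=
      ihf b (fun l => emb (Sum.inr ⟨b, l⟩)) exit (fun l => hM (Sum.inr ⟨b, l⟩)) h₂ v₁
    refine ⟨v₂, ?_⟩
    rw [add_comm, Function.iterate_add_apply]
    erw [e₁]
    exact e₂
  | loop hα f b ih =>
    change LoopRuns (fun a => Runs (f a)) b S a S' t at h
    change ∃ v', (flip Option.bind (Turing.TM2.step M))^[t]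
      (some ⟨some (emb ⟨b, entry (f b)⟩), v, S⟩) = some ⟨some (exit a), v', S'⟩
    have hM' : ∀ c l, M (emb ⟨c, l⟩) = stmt (f c) (fun l => emb ⟨c, l⟩)
      (Sum.elim (fun a' => emb ⟨a', entry (f a')⟩) exit) l := fun c l => hM ⟨c, l⟩
    clear hM
    induction h generalizing v with
    | quit h => exact ih _ _ _ (hM' _) h v
    | next h₁ _ ih' =>
      obtain ⟨v₁, e₁⟩ := ih _ _ _ (hM' _) h₁ v
      obtain ⟨v₂, e₂⟩ := ih' emb v₁ hM'
      refine ⟨v₂, ?_⟩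
      rw [add_comm, Function.iterate_add_apply, e₁]
      exact e₂

/-- The machine that runs the program `p`, which takes its input from the stack `k₀` and leaves
its output on the stack `k₁`. -/
noncomputable def machine [Finite K] [∀ k, Finite (Γ k)] (k₀ k₁ : K) {α : Type} [Finite α]
    (p : Prog Γ α) : Turing.FinTM2 :=
  letI := Fintype.ofFinite K
  letI := Fintype.ofFinite (Γ k₀)
  letI := Fintype.ofFinite (∀ k, Option (Γ k))
  haveI := finite_lab p
  letI := Fintype.ofFinite (Option (Lab p))
  { K := K
    k₀ := k₀
    k₁ := k₁
    Γ := Γ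
    Λ := Option (Lab p)
    main := some (entry p)
    σ := ∀ k, Option (Γ k)
    initialState := fun _ => none
    -- The extra label `none` restores the initial internal state, as `Turing.haltList` demands. It
    -- costs the one additional step in `machine_evals`.
    m := fun l => l.elim (.load (fun _ _ => none) .halt) (stmt p some fun _ => none) }

theorem machine_evals [Finite K] [∀ k, Finite (Γ k)] (k₀ k₁ : K) {α : Type} [Finite α]
    (p : Prog Γ α) {i : List (Γ k₀)} {o : List (Γ k₁)} {a : α} {t : ℕ}
    (h : Runs p (Function.update (fun _ => []) k₀ i) a (Function.update (fun _ => []) k₁ o) t) :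
    (flip Option.bind (machine k₀ k₁ p).step)^[t + 1] (some (Turing.initList (machine k₀ k₁ p) i)) =
      some (Turing.haltList (machine k₀ k₁ p) o) := by
  obtain ⟨v, hv⟩ := h.simulate (machine k₀ k₁ p).m p some (fun _ => none) (fun _ => rfl)
    fun _ => none
  have key : ∀ (k₂ : K) (l : List (Γ k₂)),
      (fun k => @dite (List (Γ k)) (k = k₂) (inferInstance) (fun h => by rw [h]; exact l)
        fun _ => []) = Function.update (fun _ => []) k₂ l := by
    intro k₂ l
    funext k
    by_cases hk : k = k₂
    · subst hk
      simp
    · simp [hk]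
  have e₁ : Turing.initList (machine k₀ k₁ p) i =
      ⟨some (some (entry p)), fun _ => none, Function.update (fun _ => []) k₀ i⟩ := by
    unfold Turing.initList
    congr 1
    exact key k₀ i
  have e₂ : Turing.haltList (machine k₀ k₁ p) o =
      ⟨none, fun _ => none, Function.update (fun _ => []) k₁ o⟩ := by
    unfold Turing.haltList
    congr 1
    exact key k₁ o
  rw [Function.iterate_succ_apply', e₁, e₂]
  have : (flip Option.bind (machine k₀ k₁ p).step)^[t] _ = _ := hv
  erw [this]
  rfl

/-! ### Upper bounds for running times. -/

/-- `RunsIn p S a S' t`: like `Runs`, but in at most `t` steps. -/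
def RunsIn {α : Type} (p : Prog Γ α) (S : ∀ k, List (Γ k)) (a : α) (S' : ∀ k, List (Γ k))
    (t : ℕ) : Prop :=
  ∃ t' ≤ t, Runs p S a S' t'

namespace RunsIn

variable {α β : Type} {S S₁ S' : ∀ k, List (Γ k)} {t t₁ t₂ : ℕ}

theorem mono {p : Prog Γ α} {a : α} (h : RunsIn p S a S' t₁) (ht : t₁ ≤ t) :
    RunsIn p S a S' t := by
  obtain ⟨t', h', h⟩ := h
  exact ⟨t', h'.trans ht, h⟩

theorem pure (a : α) : RunsIn (Prog.pure (Γ := Γ) a) S a S 1 :=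
  ⟨1, le_rfl, rfl, rfl, rfl⟩

theorem push (k : K) (a : Γ k) :
    RunsIn (Prog.push k a) S () (Function.update S k (a :: S k)) 1 :=
  ⟨1, le_rfl, rfl, rfl⟩

theorem pop (k : K) :
    RunsIn (Prog.pop k) S (S k).head? (Function.update S k (S k).tail) 1 :=
  ⟨1, le_rfl, rfl, rfl, rfl⟩

theorem bind {hα : Finite α} {p : Prog Γ α} {f : α → Prog Γ β} {a : α} {b : β}
    (h₁ : RunsIn p S a S₁ t₁) (h₂ : RunsIn (f a) S₁ b S' t₂) :
    RunsIn (Prog.bind hα p f) S b S' (t₁ + t₂) := by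
  obtain ⟨u₁, hu₁, h₁⟩ := h₁
  obtain ⟨u₂, hu₂, h₂⟩ := h₂
  exact ⟨u₁ + u₂, add_le_add hu₁ hu₂, a, S₁, u₁, u₂, h₁, h₂, rfl⟩

theorem loop_stop {hα : Finite α} {f : α → Prog Γ (α ⊕ β)} {a : α} {b : β}
    (h : RunsIn (f a) S (Sum.inr b) S' t) : RunsIn (Prog.loop hα f a) S b S' t := by
  obtain ⟨u, hu, h⟩ := h
  exact ⟨u, hu, LoopRuns.quit h⟩

theorem loop_next {hα : Finite α} {f : α → Prog Γ (α ⊕ β)} {a a' : α} {b : β}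
    (h₁ : RunsIn (f a) S (Sum.inl a') S₁ t₁) (h₂ : RunsIn (Prog.loop hα f a') S₁ b S' t₂) :
    RunsIn (Prog.loop hα f a) S b S' (t₁ + t₂) := by
  obtain ⟨u₁, hu₁, h₁⟩ := h₁
  obtain ⟨u₂, hu₂, h₂⟩ := h₂
  exact ⟨u₁ + u₂, add_le_add hu₁ hu₂, LoopRuns.next h₁ h₂⟩

end RunsIn

/-- `p.next f`: run `p` and then the program `f a`, where `a` is the exit value of `p`. -/
def next {α β : Type} [hα : Finite α] (p : Prog Γ α) (f : α → Prog Γ β) : Prog Γ β :=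
  bind hα p f

/-- `p.andThen q`: run `p` and then `q`. -/
def andThen {β : Type} (p : Prog Γ Unit) (q : Prog Γ β) : Prog Γ β := p.next fun _ => q

/-- `iter f a`: run `f a`, and start again with `f a'` as long as the exit value is `inl a'`. -/
def iter {α β : Type} [hα : Finite α] (f : α → Prog Γ (α ⊕ β)) (a : α) : Prog Γ β := loop hα f a

/-- `scan k ends h`: pop symbols `a` from the stack `k` and run `h a`, until the stack is empty or
`ends a` holds. -/
def scan (k : K) [Finite (Γ k)] (ends : Γ k → Bool) (h : Γ k → Prog Γ Unit) : Prog Γ Unit :=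
  iter (fun _ : Unit => (pop k).next fun o => match o with
    | none => pure (Sum.inr ())
    | some a => (h a).next fun _ => pure (if ends a then Sum.inr () else Sum.inl ())) ()

/-- `drain k h`: pop all symbols `a` from the stack `k` and run `h a` for each of them. -/
def drain (k : K) [Finite (Γ k)] (h : Γ k → Prog Γ Unit) : Prog Γ Unit :=
  scan k (fun _ => false) h

end Prog

end StackProgram

/-! ## The ordinals `ω ^ ω ^ i` as iterated spaces of finite sequences -/

namespace OrdinalAddition

open Ordinal

/-- `base 0 = 2` and `base (k + 1) = base k ^ ω`, so that `base (i + 1) = ω ^ ω ^ i`. -/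
noncomputable def base : ℕ → Ordinal.{0}
  | 0 => 2
  | k + 1 => base k ^ ω

/-- Starting with the base 2 makes the natural numbers finite sequences of bits, so that they fit
into the same scheme as the higher levels. -/
theorem base_one : base 1 = ω := by
  have := natCast_opow_omega0 (n := 2) (by norm_num)
  exact_mod_cast this

theorem base_succ (i : ℕ) : base (i + 1) = ω ^ (ω ^ (i : Ordinal.{0})) := by
  induction i with
  | zero => simp [base_one]
  | succ i ih =>
    rw [base, ih, ← opow_mul, Nat.cast_succ, ← Order.succ_eq_add_one, opow_succ]

theorem one_lt_base (k : ℕ) : 1 < base k := by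
  cases k with
  | zero => exact one_lt_two
  | succ k =>
    rw [base_succ]
    exact one_lt_omega0.trans_le (left_le_opow _ (opow_pos _ omega0_pos))

theorem base_pos (k : ℕ) : 0 < base k := zero_lt_one.trans (one_lt_base k)

theorem base_ne_zero (k : ℕ) : base k ≠ 0 := (base_pos k).ne'

/-- As `ω` is a limit, `base k ^ ω` is the supremum of the finite powers. This is why expansions in
base `base k` are finite. -/
theorem exists_lt_pow {k : ℕ} {a : Ordinal.{0}} (ha : a < base (k + 1)) :
    ∃ n : ℕ, a < base k ^ n := by
  obtain ⟨c, hc, h⟩ := (lt_opow_of_isSuccLimit (base_ne_zero k) isSuccLimit_omega0).1 ha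
  obtain ⟨n, rfl⟩ := lt_omega0.1 hc
  exact ⟨n, by simpa using h⟩

theorem mul_add_lt_mul {b q r c : Ordinal.{0}} (hq : q < c) (hr : r < b) : b * q + r < b * c :=
  calc b * q + r < b * q + b := by gcongr
    _ = b * (q + 1) := by rw [mul_add, mul_one]
    _ ≤ b * c := by gcongr; exact Order.add_one_le_of_lt hq

theorem mul_add_lt_base {k : ℕ} {q r : Ordinal.{0}} (hq : q < base (k + 1)) (hr : r < base k) :
    base k * q + r < base (k + 1) := by
  obtain ⟨n, hn⟩ := exists_lt_pow hq
  calc base k * q + r < base k * base k ^ n := mul_add_lt_mul hn hr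
    _ = base k ^ ((n + 1 : ℕ) : Ordinal.{0}) := by rw [opow_natCast, pow_succ']
    _ < base (k + 1) := (opow_lt_opow_iff_right (one_lt_base k)).2 (natCast_lt_omega0 _)

theorem div_base_lt {k : ℕ} {a : Ordinal.{0}} (ha : a < base (k + 1)) :
    a / base k < base (k + 1) :=
  (div_le_of_le_mul (le_mul_of_one_le_left' (one_lt_base k).le)).trans_lt ha

theorem mod_base_lt (k : ℕ) (a : Ordinal.{0}) : a % base k < base k := mod_lt _ (base_ne_zero k)

theorem mul_add_div_base {k : ℕ} {r : Ordinal.{0}} (hr : r < base k) (q : Ordinal.{0}) :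
    (base k * q + r) / base k = q := by
  rw [mul_add_div _ (base_ne_zero k), div_eq_zero_of_lt hr, add_zero]

theorem mul_add_mod_base {k : ℕ} {r : Ordinal.{0}} (hr : r < base k) (q : Ordinal.{0}) :
    (base k * q + r) % base k = r := by
  rw [mul_add_mod_self, mod_eq_of_lt hr]

theorem mul_add_inj {k : ℕ} {q r q' r' : Ordinal.{0}} (hr : r < base k) (hr' : r' < base k) :
    base k * q + r = base k * q' + r' ↔ q = q' ∧ r = r' := by
  refine ⟨fun h => ⟨?_, ?_⟩, by rintro ⟨rfl, rfl⟩; rfl⟩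
  · rw [← mul_add_div_base hr q, h, mul_add_div_base hr']
  · rw [← mul_add_mod_base hr q, h, mul_add_mod_base hr']

theorem mul_add_eq_zero {k : ℕ} {q r : Ordinal.{0}} (hr : r < base k) :
    base k * q + r = 0 ↔ q = 0 ∧ r = 0 := by
  have := mul_add_inj (q := q) (q' := 0) hr (base_pos k)
  simpa using this

theorem add_lt_base {k : ℕ} {a b : Ordinal.{0}} (ha : a < base (k + 1)) (hb : b < base (k + 1)) :
    a + b < base (k + 1) := by
  rw [base_succ] at *
  exact isPrincipal_add_omega0_opow _ ha hb

/-- Addition in terms of the quotients and remainders by `base (k + 1)`. -/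
theorem mul_add_add_eq_iff {k : ℕ} {x x' y y' z z' : Ordinal.{0}} (hx : x' < base (k + 1))
    (hy : y' < base (k + 1)) (hz : z' < base (k + 1)) :
    base (k + 1) * x + x' + (base (k + 1) * y + y') = base (k + 1) * z + z' ↔
      (y = 0 ∧ x = z ∧ x' + y' = z') ∨ (y ≠ 0 ∧ x + y = z ∧ y' = z') := by
  by_cases h : y = 0
  · subst h
    rw [mul_zero, zero_add, add_assoc, mul_add_inj (add_lt_base hx hy) hz]
    simp
  -- The remainder `x'` lies below the additively principal `base (k + 1)` and is absorbed by any
  -- nonzero multiple of it.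
  · have : x' + base (k + 1) * y = base (k + 1) * y := by
      have hle : base (k + 1) ≤ base (k + 1) * y :=
        le_mul_of_one_le_right' (Order.one_le_iff_pos.2 (pos_iff_ne_zero.2 h))
      rw [base_succ] at *
      exact add_of_omega0_opow_le hx hle
    rw [add_assoc, ← add_assoc x', this, ← add_assoc, ← mul_add, mul_add_inj hy hz]
    simp [h]

/-! ### Finite-valued invariants of tuples -/

/-- The facts about a triple on level `k` that are traced through the levels. -/
def flags (k : ℕ) (x y z : Ordinal.{0}) : Prop × Prop × Prop × Prop × Prop × Prop × Prop :=
  (x = 0, y = 0, z = 0, x = z, y = z, x + y = z, k ≤ 1 ∧ x + y + 1 = z)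

/-- The seven facts are chosen so as to be closed under appending a digit. For `k > 0` the rule
`mul_add_add_eq_iff` asks only for zero tests, `x = z`, `y = z` and `x + y = z`. For `k = 0` the
last fact supplies the carry. -/
theorem flags_congr {k : ℕ} {x y z x' y' z' u v w u' v' w' : Ordinal.{0}}
    (hx : x < base (k + 1)) (hy : y < base (k + 1)) (hz : z < base (k + 1))
    (hx' : x' < base k) (hy' : y' < base k) (hz' : z' < base k)
    (hu : u < base (k + 1)) (hv : v < base (k + 1)) (hw : w < base (k + 1))
    (hu' : u' < base k) (hv' : v' < base k) (hw' : w' < base k)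
    (h : flags (k + 1) x y z = flags (k + 1) u v w) (h' : flags k x' y' z' = flags k u' v' w') :
    flags (k + 1) (base k * x + x') (base k * y + y') (base k * z + z') =
      flags (k + 1) (base k * u + u') (base k * v + v') (base k * w + w') := by
  cases k with
  | zero =>
    -- On the bottom level everything is a natural number and the zero tests determine the bits, so
    -- the claim is linear arithmetic: binary addition with carry.
    have e : base 0 = ((2 : ℕ) : Ordinal.{0}) := by simp [base]
    rw [base_one] at hx hy hz hu hv hw
    rw [e] at *
    have hnat : ∀ {a : Ordinal.{0}}, a < ((2 : ℕ) : Ordinal.{0}) → ∃ n : ℕ, a = n ∧ n < 2 := by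
      intro a ha
      obtain ⟨n, rfl⟩ := lt_omega0.1 (ha.trans (natCast_lt_omega0 2))
      exact ⟨n, rfl, by exact_mod_cast ha⟩
    obtain ⟨x, rfl⟩ := lt_omega0.1 hx
    obtain ⟨y, rfl⟩ := lt_omega0.1 hy
    obtain ⟨z, rfl⟩ := lt_omega0.1 hz
    obtain ⟨u, rfl⟩ := lt_omega0.1 hu
    obtain ⟨v, rfl⟩ := lt_omega0.1 hv
    obtain ⟨w, rfl⟩ := lt_omega0.1 hw
    obtain ⟨x', rfl, hx'⟩ := hnat hx'
    obtain ⟨y', rfl, hy'⟩ := hnat hy'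
    obtain ⟨z', rfl, hz'⟩ := hnat hz'
    obtain ⟨u', rfl, hu'⟩ := hnat hu'
    obtain ⟨v', rfl, hv'⟩ := hnat hv'
    obtain ⟨w', rfl, hw'⟩ := hnat hw'
    simp only [flags, Prod.mk.injEq, eq_iff_iff] at h h' ⊢
    norm_cast at h h' ⊢
    omega
  | succ k =>
    simp only [flags, Prod.mk.injEq, eq_iff_iff] at h h' ⊢
    simp only [mul_add_eq_zero, mul_add_inj, mul_add_add_eq_iff, hx', hy', hz', hu', hv', hw']
    obtain ⟨h₁, h₂, h₃, h₄, h₅, h₆, -⟩ := h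
    obtain ⟨h₁', h₂', h₃', h₄', h₅', h₆', -⟩ := h'
    -- Above level 1 no carry occurs, and the last flag is constantly false.
    have : ¬ k + 1 + 1 ≤ 1 := by omega
    simp only [ne_eq, h₁, h₂, h₃, h₄, h₅, h₆, h₁', h₂', h₃', h₄', h₅', h₆', this]
    simp

/-- `T k` is an invariant of tuples below `base k`, where the invariant of a tuple is determined by
those of the tuples of the quotients and of the remainders. -/
def Compositional {τ : Type} (T : ℕ → (ℕ → Ordinal.{0}) → τ) : Prop :=
  ∀ k v w, (∀ j, v j < base (k + 1)) → (∀ j, w j < base (k + 1)) →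
    T k (fun j => v j % base k) = T k (fun j => w j % base k) →
    T (k + 1) (fun j => v j / base k) = T (k + 1) (fun j => w j / base k) →
    T (k + 1) v = T (k + 1) w

theorem update_mod (v : ℕ → Ordinal.{0}) (x : ℕ) (a b : Ordinal.{0}) :
    (fun j => Function.update v x a j % b) = Function.update (fun j => v j % b) x (a % b) := by
  funext j
  by_cases h : j = x
  · subst h; simp
  · simp [h]

theorem update_div (v : ℕ → Ordinal.{0}) (x : ℕ) (a b : Ordinal.{0}) :
    (fun j => Function.update v x a j / b) = Function.update (fun j => v j / b) x (a / b) := by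
  funext j
  by_cases h : j = x
  · subst h; simp
  · simp [h]

theorem update_lt {v : ℕ → Ordinal.{0}} {a b : Ordinal.{0}} (hv : ∀ j, v j < b) (ha : a < b)
    (x j : ℕ) : Function.update v x a j < b := by
  by_cases h : j = x
  · subst h; simpa
  · simpa [h] using hv j

theorem Compositional.update_congr {τ : Type} {T : ℕ → (ℕ → Ordinal.{0}) → τ}
    (hT : Compositional T) {k : ℕ} {v w : ℕ → Ordinal.{0}} {a b : Ordinal.{0}} {x : ℕ}
    (hv : ∀ j, v j < base (k + 1)) (hw : ∀ j, w j < base (k + 1)) (ha : a < base (k + 1))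
    (hb : b < base (k + 1))
    (h₁ : T k (Function.update (fun j => v j % base k) x (a % base k)) =
      T k (Function.update (fun j => w j % base k) x (b % base k)))
    (h₂ : T (k + 1) (Function.update (fun j => v j / base k) x (a / base k)) =
      T (k + 1) (Function.update (fun j => w j / base k) x (b / base k))) :
    T (k + 1) (Function.update v x a) = T (k + 1) (Function.update w x b) := by
  refine hT k _ _ (update_lt hv ha x) (update_lt hw hb x) ?_ ?_
  · rwa [update_mod, update_mod]
  · rwa [update_div, update_div]

theorem compositional_flags (x y z : ℕ) :
    Compositional fun k v => flags k (v x) (v y) (v z) := by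
  intro k v w hv hw h₁ h₂
  have := flags_congr (div_base_lt (hv x)) (div_base_lt (hv y)) (div_base_lt (hv z))
    (mod_base_lt k (v x)) (mod_base_lt k (v y)) (mod_base_lt k (v z))
    (div_base_lt (hw x)) (div_base_lt (hw y)) (div_base_lt (hw z))
    (mod_base_lt k (w x)) (mod_base_lt k (w y)) (mod_base_lt k (w z)) h₂ h₁
  simpa only [div_add_mod] using this

theorem Compositional.prod {τ τ' : Type} {T : ℕ → (ℕ → Ordinal.{0}) → τ}
    {T' : ℕ → (ℕ → Ordinal.{0}) → τ'} (hT : Compositional T) (hT' : Compositional T') :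
    Compositional fun k v => (T k v, T' k v) := by
  intro k v w hv hw h₁ h₂
  simp only [Prod.mk.injEq] at h₁ h₂ ⊢
  exact ⟨hT k v w hv hw h₁.1 h₂.1, hT' k v w hv hw h₁.2 h₂.2⟩

/-- This is the subset construction: the new invariant is the set of old values attainable by
varying `x`. A witness for one tuple is transferred to the other by transferring its quotient and
its remainder independently. -/
theorem Compositional.projection {τ : Type} {T : ℕ → (ℕ → Ordinal.{0}) → τ}
    (hT : Compositional T) (x : ℕ) :
    Compositional fun k v => {t | ∃ a < base k, T k (Function.update v x a) = t} := by
  have key : ∀ k v w, (∀ j, v j < base (k + 1)) → (∀ j, w j < base (k + 1)) →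
      {t | ∃ a < base k, T k (Function.update (fun j => v j % base k) x a) = t} =
        {t | ∃ a < base k, T k (Function.update (fun j => w j % base k) x a) = t} →
      {t | ∃ a < base (k + 1), T (k + 1) (Function.update (fun j => v j / base k) x a) = t} =
        {t | ∃ a < base (k + 1), T (k + 1) (Function.update (fun j => w j / base k) x a) = t} →
      ∀ a < base (k + 1), ∃ b < base (k + 1),
        T (k + 1) (Function.update w x b) = T (k + 1) (Function.update v x a) := by
    intro k v w hv hw h₁ h₂ a ha
    obtain ⟨r, hr, er⟩ : T k (Function.update (fun j => v j % base k) x (a % base k)) ∈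
        {t | ∃ a < base k, T k (Function.update (fun j => w j % base k) x a) = t} := by
      rw [← h₁]
      exact ⟨_, mod_base_lt k a, rfl⟩
    obtain ⟨q, hq, eq⟩ : T (k + 1) (Function.update (fun j => v j / base k) x (a / base k)) ∈
        {t | ∃ a < base (k + 1), T (k + 1) (Function.update (fun j => w j / base k) x a) = t} := by
      rw [← h₂]
      exact ⟨_, div_base_lt ha, rfl⟩
    -- Every pair of a quotient and a remainder below the respective bases comes from an ordinal, so
    -- the two partial witnesses can be glued.
    refine ⟨base k * q + r, mul_add_lt_base hq hr,
      hT.update_congr hw hv (mul_add_lt_base hq hr) ha ?_ ?_⟩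
    · rw [mul_add_mod_base hr, er]
    · rw [mul_add_div_base hr, eq]
  intro k v w hv hw h₁ h₂
  ext t
  constructor
  · rintro ⟨a, ha, rfl⟩
    exact key k v w hv hw h₁ h₂ a ha
  · rintro ⟨a, ha, rfl⟩
    exact key k w v hw hv h₁.symm h₂.symm a ha

/-- A bound for the number of values of an invariant that determines the truth of a formula. -/
def Formula.states : Formula → ℕ
  | plus _ _ _ => 128
  | neg φ => φ.states
  | conj φ ψ | disj φ ψ | imp φ ψ | iff φ ψ => φ.states * ψ.states
  | ex _ φ => 2 ^ φ.states

theorem Formula.states_pos (φ : Formula) : 0 < φ.states := by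
  induction φ <;> simp_all [Formula.states]

theorem exists_invariant_pair {φ ψ : Formula} {F : Prop → Prop → Prop} {τ τ' : Type} [Fintype τ]
    [Fintype τ'] {T : ℕ → (ℕ → Ordinal.{0}) → τ} {T' : ℕ → (ℕ → Ordinal.{0}) → τ'}
    (hcard : Fintype.card τ ≤ φ.states) (hT : Compositional T)
    (h : ∀ k (v w : ℕ → Set.Iio (base k)), T k (fun j => v j) = T k (fun j => w j) →
      (φ.Holds (base k) v ↔ φ.Holds (base k) w))
    (hcard' : Fintype.card τ' ≤ ψ.states) (hT' : Compositional T')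
    (h' : ∀ k (v w : ℕ → Set.Iio (base k)), T' k (fun j => v j) = T' k (fun j => w j) →
      (ψ.Holds (base k) v ↔ ψ.Holds (base k) w)) :
    ∃ (τ : Type) (_ : Fintype τ) (T : ℕ → (ℕ → Ordinal.{0}) → τ),
      Fintype.card τ ≤ φ.states * ψ.states ∧ Compositional T ∧
      ∀ k (v w : ℕ → Set.Iio (base k)), T k (fun j => v j) = T k (fun j => w j) →
        (F (φ.Holds (base k) v) (ψ.Holds (base k) v) ↔
          F (φ.Holds (base k) w) (ψ.Holds (base k) w)) := by
  refine ⟨τ × τ', inferInstance, _, ?_, hT.prod hT', ?_⟩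
  · rw [Fintype.card_prod]
    exact Nat.mul_le_mul hcard hcard'
  · intro k v w e
    simp only [Prod.mk.injEq] at e
    rw [h k v w e.1, h' k v w e.2]

/-- Atomic formulas use the flags, binary connectives the product and a quantifier the power set.
The type of values and its size serve all levels `k` simultaneously; this is what makes the height
of the tower independent of `i`. -/
theorem exists_invariant (φ : Formula) :
    ∃ (τ : Type) (_ : Fintype τ) (T : ℕ → (ℕ → Ordinal.{0}) → τ),
      Fintype.card τ ≤ φ.states ∧ Compositional T ∧
      ∀ k (v w : ℕ → Set.Iio (base k)), T k (fun j => v j) = T k (fun j => w j) →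
        (φ.Holds (base k) v ↔ φ.Holds (base k) w) := by
  induction φ with
  | plus x y z =>
    classical
    refine ⟨_, inferInstance, _, ?_, compositional_flags x y z, ?_⟩
    -- Seven propositions have `2 ^ 7 = 128` possible values.
    · simp [Formula.states]
    · intro k v w e
      simp only [flags, Prod.mk.injEq] at e
      exact iff_of_eq e.2.2.2.2.2.1
  | neg φ ih =>
    obtain ⟨τ, _, T, hcard, hT, h⟩ := ih
    exact ⟨τ, _, T, hcard, hT, fun k v w e => not_congr (h k v w e)⟩
  | conj φ ψ ihφ ihψ =>
    obtain ⟨τ, _, T, hcard, hT, h⟩ := ihφ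
    obtain ⟨τ', _, T', hcard', hT', h'⟩ := ihψ
    exact exists_invariant_pair hcard hT h hcard' hT' h'
  | disj φ ψ ihφ ihψ =>
    obtain ⟨τ, _, T, hcard, hT, h⟩ := ihφ
    obtain ⟨τ', _, T', hcard', hT', h'⟩ := ihψ
    exact exists_invariant_pair hcard hT h hcard' hT' h'
  | imp φ ψ ihφ ihψ =>
    obtain ⟨τ, _, T, hcard, hT, h⟩ := ihφ
    obtain ⟨τ', _, T', hcard', hT', h'⟩ := ihψ
    exact exists_invariant_pair (F := fun p q => p → q) hcard hT h hcard' hT' h'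
  | iff φ ψ ihφ ihψ =>
    obtain ⟨τ, _, T, hcard, hT, h⟩ := ihφ
    obtain ⟨τ', _, T', hcard', hT', h'⟩ := ihψ
    exact exists_invariant_pair hcard hT h hcard' hT' h'
  | ex x φ ih =>
    classical
    obtain ⟨τ, _, T, hcard, hT, h⟩ := ih
    refine ⟨Set τ, inferInstance, _, ?_, hT.projection x, ?_⟩
    · rw [Fintype.card_set]
      exact Nat.pow_le_pow_right (by norm_num) hcard
    · have coe : ∀ k (v : ℕ → Set.Iio (base k)) (a : Set.Iio (base k)),
          (fun j => (Function.update v x a j : Ordinal.{0})) =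
            Function.update (fun j => (v j : Ordinal.{0})) x a := by
        intro k v a
        funext j
        by_cases hj : j = x
        · subst hj; simp
        · simp [hj]
      have key : ∀ k (v w : ℕ → Set.Iio (base k)),
          {t | ∃ a < base k, T k (Function.update (fun j => (v j : Ordinal.{0})) x a) = t} =
            {t | ∃ a < base k, T k (Function.update (fun j => (w j : Ordinal.{0})) x a) = t} →
          (Formula.ex x φ).Holds (base k) v → (Formula.ex x φ).Holds (base k) w := by
        rintro k v w e ⟨a, ha⟩
        obtain ⟨b, hb, eb⟩ : T k (Function.update (fun j => (v j : Ordinal.{0})) x a) ∈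
            {t | ∃ a < base k, T k (Function.update (fun j => (w j : Ordinal.{0})) x a) = t} := by
          rw [← e]
          exact ⟨a, a.2, rfl⟩
        refine ⟨⟨b, hb⟩, (h k _ _ ?_).1 ha⟩
        rw [coe, coe, eb]
      exact fun k v w e => ⟨key k v w e, key k w v e.symm⟩

/-! ### Small witnesses -/

/-- The ordinals `b ^ (s - 1) * r_(s - 1) + ⋯ + b * r_1 + r_0` with coefficients in `P`. -/
def digits (b : Ordinal.{0}) (P : Set Ordinal.{0}) : ℕ → Set Ordinal.{0}
  | 0 => {0}
  | s + 1 => {a | ∃ q ∈ digits b P s, ∃ r ∈ P, a = b * q + r}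

/-- The ordinals below `base k` all of whose iterated sequences of digits have length at
most `s`. -/
noncomputable def box : ℕ → ℕ → Set Ordinal.{0}
  | 0, _ => Set.Iio 2
  | k + 1, s => digits (base k) (box k s) s

theorem digits_lt {k s : ℕ} {P : Set Ordinal.{0}} (hP : P ⊆ Set.Iio (base k)) {a : Ordinal.{0}}
    (ha : a ∈ digits (base k) P s) : a < base (k + 1) := by
  induction s generalizing a with
  | zero =>
    rw [Set.mem_singleton_iff.1 ha]
    exact base_pos _
  | succ s ih =>
    obtain ⟨q, hq, r, hr, rfl⟩ := ha
    exact mul_add_lt_base (ih hq) (hP hr)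

theorem box_subset (k s : ℕ) : box k s ⊆ Set.Iio (base k) := by
  induction k with
  | zero => exact subset_rfl
  | succ k ih => exact fun a ha => digits_lt ih ha

theorem zero_mem_digits {b : Ordinal.{0}} {P : Set Ordinal.{0}} (hP : 0 ∈ P) (s : ℕ) :
    0 ∈ digits b P s := by
  induction s with
  | zero => exact rfl
  | succ s ih => exact ⟨0, ih, 0, hP, by simp⟩

theorem zero_mem_box (k s : ℕ) : 0 ∈ box k s := by
  induction k with
  | zero => exact (two_pos : (0 : Ordinal.{0}) < 2)
  | succ k ih => exact zero_mem_digits ih s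

theorem digits_mono_length {b : Ordinal.{0}} {P : Set Ordinal.{0}} (hP : 0 ∈ P) :
    Monotone (digits b P) := by
  refine monotone_nat_of_le_succ fun s => ?_
  induction s with
  | zero =>
    rintro a rfl
    exact zero_mem_digits hP 1
  | succ s ih =>
    rintro a ⟨q, hq, r, hr, rfl⟩
    exact ⟨q, ih hq, r, hr, rfl⟩

theorem exists_mem_digits {k : ℕ} {a : Ordinal.{0}} (ha : a < base (k + 1)) :
    ∃ s, a ∈ digits (base k) (Set.Iio (base k)) s := by
  obtain ⟨n, hn⟩ := exists_lt_pow ha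
  refine ⟨n, ?_⟩
  clear ha
  induction n generalizing a with
  | zero =>
    rw [pow_zero, Order.lt_one_iff] at hn
    exact hn
  | succ n ih =>
    refine ⟨a / base k, ih ?_, a % base k, mod_base_lt k a, (div_add_mod a _).symm⟩
    rwa [← lt_mul_iff_div_lt (base_ne_zero k), ← pow_succ']

/-- An increasing chain of subsets of a finite set that stops growing once it does not grow is
exhausted after as many steps as the set has elements. -/
theorem chain_subset {τ : Type} [Fintype τ] {R : ℕ → Set τ} (hR : Monotone R)
    (h0 : (R 0).Nonempty) (hstable : ∀ m, R m = R (m + 1) → R (m + 1) = R (m + 2)) {N : ℕ}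
    (hN : Fintype.card τ ≤ N) (m : ℕ) : R m ⊆ R N := by
  classical
  -- As long as the chain has grown at every step, `R m` has at least `m + 1` elements, which is
  -- impossible for `m = N`.
  have grow : ∀ m, R m = R (m + 1) ∨ m + 1 ≤ (R m).ncard := by
    intro m
    induction m with
    | zero => exact Or.inr ((Set.ncard_pos).2 h0)
    | succ m ih =>
      by_cases e : R m = R (m + 1)
      · exact Or.inl (hstable m e)
      · have h1 := ih.resolve_left e
        have h2 : (R m).ncard < (R (m + 1)).ncard :=
          Set.ncard_lt_ncard ((hR m.le_succ).ssubset_of_ne e)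
        exact Or.inr (by omega)
  have stable : R N = R (N + 1) := by
    refine (grow N).resolve_right fun h => ?_
    have := Set.ncard_le_card (R N)
    rw [Nat.card_eq_fintype_card] at this
    omega
  have const : ∀ d, R (N + d) = R N ∧ R (N + d) = R (N + d + 1) := by
    intro d
    induction d with
    | zero => exact ⟨rfl, stable⟩
    | succ d ih => exact ⟨ih.2.symm.trans ih.1, hstable _ ih.2⟩
  rcases le_total m N with h | h
  · exact hR h
  · obtain ⟨d, rfl⟩ := Nat.exists_eq_add_of_le h
    exact (const d).1.le

/-- A witness is shrunk level by level. Its digits at positions where parameters may have digits are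
replaced by small ones through the induction on `k`. Beyond these positions all parameters are zero,
and the sequence is pumped down to length `N`. -/
theorem Compositional.exists_mem_box {τ : Type} [Fintype τ] {T : ℕ → (ℕ → Ordinal.{0}) → τ}
    (hT : Compositional T) {N : ℕ} (hN : Fintype.card τ ≤ N) (x k s : ℕ) {v : ℕ → Ordinal.{0}}
    (hv : ∀ j, v j ∈ box k s) {a : Ordinal.{0}} (ha : a < base k) :
    ∃ b ∈ box k (s + N), T k (Function.update v x b) = T k (Function.update v x a) := by
  induction k generalizing v a with
  -- On level 0 the box contains all bits.
  | zero => exact ⟨a, ha, rfl⟩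
  | succ k ih =>
    have hP : box k (s + N) ⊆ Set.Iio (base k) := box_subset k _
    have hP0 : 0 ∈ box k (s + N) := zero_mem_box k _
    have bound : ∀ {c : Ordinal.{0}} {m : ℕ}, c ∈ digits (base k) (box k (s + N)) m →
      c < base (k + 1) := fun hc => digits_lt hP hc
    have zero_lt : ∀ j : ℕ, (fun _ => 0 : ℕ → Ordinal.{0}) j < base (k + 1) :=
      fun _ => base_pos _
    have step : ∀ {w : ℕ → Ordinal.{0}} {q q' r r' : Ordinal.{0}}, (∀ j, w j < base (k + 1)) →
        q < base (k + 1) → q' < base (k + 1) → r < base k → r' < base k →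
        T k (Function.update (fun j => w j % base k) x r) =
          T k (Function.update (fun j => w j % base k) x r') →
        T (k + 1) (Function.update (fun j => w j / base k) x q) =
          T (k + 1) (Function.update (fun j => w j / base k) x q') →
        T (k + 1) (Function.update w x (base k * q + r)) =
          T (k + 1) (Function.update w x (base k * q' + r')) := by
      intro w q q' r r' hw hq hq' hr hr' h₁ h₂
      refine hT.update_congr hw hw (mul_add_lt_base hq hr) (mul_add_lt_base hq' hr') ?_ ?_
      · rwa [mul_add_mod_base hr, mul_add_mod_base hr']
      · rwa [mul_add_div_base hr, mul_add_div_base hr']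
    let R : ℕ → Set τ := fun m => {t | ∃ c ∈ digits (base k) (box k (s + N)) m,
      T (k + 1) (Function.update (fun _ => 0) x c) = t}
    have hR : Monotone R := by
      rintro m m' hm t ⟨c, hc, rfl⟩
      exact ⟨c, digits_mono_length hP0 hm hc, rfl⟩
    -- Given `base k * q + r`, replace `q` by a shorter `q'` with the same invariant and append the
    -- same `r`. The zero parameters have zero quotients and remainders, so no context is lost.
    have hstable : ∀ m, R m = R (m + 1) → R (m + 1) = R (m + 2) := by
      intro m e
      refine (hR (m + 1).le_succ).antisymm ?_
      rintro t ⟨c, ⟨q, hq, r, hr, rfl⟩, rfl⟩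
      obtain ⟨q', hq', eq⟩ : T (k + 1) (Function.update (fun _ => 0) x q) ∈ R m := by
        rw [e]
        exact ⟨q, hq, rfl⟩
      refine ⟨base k * q' + r, ⟨q', hq', r, hr, rfl⟩, ?_⟩
      refine step zero_lt (bound hq') (bound hq) (hP hr) (hP hr) rfl ?_
      simpa only [zero_div] using eq
    have hsub := chain_subset hR ⟨_, 0, rfl, rfl⟩ hstable hN
    -- With zero parameters, making the digits small keeps the length of the sequence; the chain `R`
    -- then bounds the length by `N`.
    have zero_case : ∀ a < base (k + 1), ∃ b ∈ digits (base k) (box k (s + N)) N,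
        T (k + 1) (Function.update (fun _ => 0) x b) =
          T (k + 1) (Function.update (fun _ => 0) x a) := by
      intro a ha
      obtain ⟨m, hm⟩ := exists_mem_digits ha
      have : T (k + 1) (Function.update (fun _ => 0) x a) ∈ R m := by
        clear ha
        induction m generalizing a with
        | zero => exact ⟨a, hm, rfl⟩
        | succ m ihm =>
          obtain ⟨q, hq, r, hr, rfl⟩ := hm
          obtain ⟨q', hq', eq⟩ := ihm q hq
          obtain ⟨r', hr', er⟩ := ih (v := fun _ => 0) (fun _ => zero_mem_box k s) hr
          refine ⟨base k * q' + r', ⟨q', hq', r', hr', rfl⟩, ?_⟩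
          refine step zero_lt (bound hq') (digits_lt subset_rfl hq) (hP hr') hr ?_ ?_
          · simpa only [zero_mod] using er
          · simpa only [zero_div] using eq
      exact hsub m this
    -- Here `s'` bounds the lengths of the outermost sequences of the parameters only; it decreases
    -- as digits are split off, whereas the bound `s` for the inner sequences stays fixed.
    have main : ∀ s', s' ≤ s → ∀ v : ℕ → Ordinal.{0},
        (∀ j, v j ∈ digits (base k) (box k s) s') → ∀ a < base (k + 1),
        ∃ b ∈ digits (base k) (box k (s + N)) (s' + N),
          T (k + 1) (Function.update v x b) = T (k + 1) (Function.update v x a) := by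
      intro s'
      induction s' with
      | zero =>
        intro _ v hv a ha
        obtain rfl : v = fun _ => 0 := funext hv
        rw [zero_add]
        exact zero_case a ha
      | succ s' ih' =>
        intro hs v hv a ha
        have hv' : ∀ j, v j < base (k + 1) := fun j => digits_lt (box_subset k s) (hv j)
        have hdiv : ∀ j, v j / base k ∈ digits (base k) (box k s) s' := by
          intro j
          obtain ⟨q, hq, r, hr, e⟩ := hv j
          rwa [e, mul_add_div_base (box_subset k s hr)]
        have hmod : ∀ j, v j % base k ∈ box k s := by
          intro j
          obtain ⟨q, hq, r, hr, e⟩ := hv j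
          rwa [e, mul_add_mod_base (box_subset k s hr)]
        obtain ⟨q, hq, eq⟩ := ih' (by omega) _ hdiv _ (div_base_lt ha)
        obtain ⟨r, hr, er⟩ := ih hmod (mod_base_lt k a)
        refine ⟨base k * q + r, ?_, ?_⟩
        · rw [Nat.succ_add]
          exact ⟨q, hq, r, hr, rfl⟩
        · have := step hv' (bound hq) (div_base_lt ha) (hP hr) (mod_base_lt k a) er eq
          rwa [div_add_mod] at this
    exact main s le_rfl v hv a ha

end OrdinalAddition

/-! ## Words that denote ordinals -/

namespace OrdinalAddition

open Ordinal

/-- The digits of words that denote ordinals below `ω ^ ω ^ i`: bits, and for each `m < i` a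
separator that ends an element of level `m`. -/
abbrev Dig (i : ℕ) : Type := Bool ⊕ Fin i

/-- The value of the sequence on level `l` whose first element is the sequence on level `l - 1`,
and so on, when `r l` is the value of the rest of the sequence on level `l`. -/
noncomputable def whole (r : ℕ → Ordinal.{0}) : ℕ → Ordinal.{0}
  | 0 => r 0
  | l + 1 => base (l + 1) * r (l + 1) + whole r l

/-- The effect of prepending a digit. -/
noncomputable def act {i : ℕ} : Dig i → (ℕ → Ordinal.{0}) → ℕ → Ordinal.{0}
  | .inl b, r => Function.update r 0 (base 0 * r 0 + if b then 1 else 0)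
  | .inr m, r => fun l => if l ≤ m then 0 else if l = m + 1 then whole r l else r l

/-- The values of the rests on all levels of a word, the least significant digit first. -/
noncomputable def rests {i : ℕ} : List (Dig i) → ℕ → Ordinal.{0}
  | [] => fun _ => 0
  | d :: w => act d (rests w)

/-- The ordinal denoted by a word. -/
noncomputable def value {i : ℕ} (w : List (Dig i)) : Ordinal.{0} := whole (rests w) i

theorem bit_lt_base (b : Bool) : (if b then 1 else 0 : Ordinal.{0}) < base 0 := by
  cases b
  · exact base_pos 0
  · exact one_lt_base 0

theorem whole_lt {r : ℕ → Ordinal.{0}} (hr : ∀ l, r l < base (l + 1)) (l : ℕ) :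
    whole r l < base (l + 1) := by
  induction l with
  | zero => exact hr 0
  | succ l ih => exact mul_add_lt_base (hr _) ih

theorem act_lt {i : ℕ} (d : Dig i) {r : ℕ → Ordinal.{0}} (hr : ∀ l, r l < base (l + 1)) (l : ℕ) :
    act d r l < base (l + 1) := by
  cases d with
  | inl b =>
    by_cases h : l = 0
    · subst h
      simpa [act] using mul_add_lt_base (hr 0) (bit_lt_base b)
    · simpa [act, h] using hr l
  | inr m =>
    simp only [act]
    split_ifs
    exacts [base_pos _, whole_lt hr l, hr l]

theorem rests_lt {i : ℕ} (w : List (Dig i)) (l : ℕ) : rests w l < base (l + 1) := by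
  induction w generalizing l with
  | nil => exact base_pos _
  | cons d w ih => exact act_lt d ih l

theorem value_lt {i : ℕ} (w : List (Dig i)) : value w < base (i + 1) := whole_lt (rests_lt w) i

/-! ### The words of bounded length and the boxes -/

/-- A letter lengthens the sequence on any level by at most one digit. Forming `whole` adds one more
digit, hence the strict inequality `w.length < s`. -/
theorem rests_mem_digits {i s : ℕ} (w : List (Dig i)) (hs : w.length < s) (l : ℕ) :
    rests w l ∈ digits (base l) (box l s) w.length ∧
      whole (rests w) l ∈ digits (base l) (box l s) (w.length + 1) := by
  have step : ∀ w : List (Dig i), w.length < s →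
      (∀ l, rests w l ∈ digits (base l) (box l s) w.length) →
      ∀ l, whole (rests w) l ∈ digits (base l) (box l s) (w.length + 1) := by
    intro w hs h l
    induction l with
    | zero => exact digits_mono_length (zero_mem_box 0 s) (Nat.le_succ _) (h 0)
    | succ l ih =>
      exact ⟨_, h (l + 1), _, digits_mono_length (zero_mem_box l s) hs ih, rfl⟩
  have main : ∀ l, rests w l ∈ digits (base l) (box l s) w.length := by
    induction w with
    | nil => exact fun l => rfl
    | cons d w ih =>
      have hs' : w.length < s := (Nat.lt_succ_self _).trans hs
      have ih := ih hs'
      have mono : ∀ l, rests w l ∈ digits (base l) (box l s) (w.length + 1) :=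
        fun l => digits_mono_length (zero_mem_box l s) (Nat.le_succ _) (ih l)
      intro l
      cases d with
      | inl b =>
        by_cases h : l = 0
        · subst h
          simp only [rests, act, Function.update_self]
          exact ⟨_, ih 0, _, bit_lt_base b, rfl⟩
        · simpa [rests, act, h] using mono l
      | inr m =>
        simp only [rests, act]
        split_ifs
        · exact zero_mem_digits (zero_mem_box l s) _
        · exact step w hs' ih l
        · exact mono l
  exact ⟨main l, step w hs main l⟩

theorem value_mem_box {i s : ℕ} (w : List (Dig i)) (hs : w.length < s) :
    value w ∈ box (i + 1) s :=
  digits_mono_length (zero_mem_box i s) hs (rests_mem_digits w hs i).2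

/-- An element of level `k + 1` is a sequence of at most `s` elements of level `k`, each written
with a separator behind it. The `+ 1` in the bound pays for this separator, and the lengths multiply
by at most `s + 1` per level. -/
theorem exists_prefix {i s k : ℕ} (hk : k ≤ i) {x : Ordinal.{0}} (hx : x ∈ box (k + 1) s) :
    ∃ u : List (Dig i), u.length + 1 ≤ (s + 1) ^ (k + 1) ∧
      ∀ w : List (Dig i), (∀ l ≤ k, rests w l = 0) →
        whole (rests (u ++ w)) k = x ∧ ∀ l, k < l → rests (u ++ w) l = rests w l := by
  induction k generalizing x with
  | zero =>
    have main : ∀ m, ∀ x ∈ digits (base 0) (box 0 s) m, ∃ u : List (Dig i), u.length ≤ m ∧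
        ∀ w : List (Dig i), (∀ l ≤ 0, rests w l = 0) →
          whole (rests (u ++ w)) 0 = x ∧ ∀ l, 0 < l → rests (u ++ w) l = rests w l := by
      intro m
      induction m with
      | zero =>
        intro x hx
        exact ⟨[], le_rfl, fun w hw => ⟨(hw 0 le_rfl).trans hx.symm, fun l _ => rfl⟩⟩
      | succ m ih =>
        rintro x ⟨q, hq, r, hr, rfl⟩
        obtain ⟨u, hu, h⟩ := ih q hq
        obtain ⟨b, rfl⟩ : ∃ b : Bool, (if b then 1 else 0 : Ordinal.{0}) = r := by
          have h2 : r < ((2 : ℕ) : Ordinal.{0}) := by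
            rw [Nat.cast_ofNat]
            exact hr
          obtain ⟨n, rfl⟩ := lt_omega0.1 (h2.trans (natCast_lt_omega0 2))
          have hn : n < 2 := by exact_mod_cast h2
          interval_cases n
          · exact ⟨false, by simp⟩
          · exact ⟨true, by simp⟩
        refine ⟨.inl b :: u, by simpa using hu, fun w hw => ?_⟩
        obtain ⟨h₁, h₂⟩ := h w hw
        refine ⟨?_, fun l hl => ?_⟩
        · rw [← h₁]
          simp [rests, act, whole]
        · rw [← h₂ l hl]
          simp [rests, act, hl.ne']
    obtain ⟨u, hu, h⟩ := main s x hx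
    exact ⟨u, by simpa using hu, h⟩
  | succ k ih =>
    have main : ∀ m, ∀ x ∈ digits (base (k + 1)) (box (k + 1) s) m, ∃ u : List (Dig i),
        u.length ≤ m * (s + 1) ^ (k + 1) ∧
        ∀ w : List (Dig i), (∀ l ≤ k + 1, rests w l = 0) →
          whole (rests (u ++ w)) (k + 1) = x ∧ ∀ l, k + 1 < l → rests (u ++ w) l = rests w l := by
      intro m
      induction m with
      | zero =>
        intro x hx
        refine ⟨[], Nat.zero_le _, fun w hw => ⟨?_, fun l _ => rfl⟩⟩
        have : ∀ j ≤ k + 1, whole (rests w) j = 0 := by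
          intro j hj
          induction j with
          | zero => exact hw 0 (Nat.zero_le _)
          | succ j ihj => rw [whole, hw _ hj, ihj (by omega), mul_zero, zero_add]
        exact (this _ le_rfl).trans hx.symm
      | succ m ihm =>
        rintro x ⟨q, hq, r, hr, rfl⟩
        obtain ⟨u, hu, h⟩ := ihm q hq
        obtain ⟨u', hu', h'⟩ := ih (by omega) hr
        -- `u'` spells the least significant element `r`, the separator closes it, and `u` spells
        -- the remaining sequence `q`.
        refine ⟨u' ++ .inr ⟨k, by omega⟩ :: u, ?_, fun w hw => ?_⟩
        · rw [List.length_append, List.length_cons, Nat.succ_mul]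
          omega
        obtain ⟨h₁, h₂⟩ := h w hw
        have e : rests (.inr ⟨k, by omega⟩ :: u ++ w : List (Dig i)) =
            fun l => if l ≤ k then 0 else if l = k + 1 then q else rests w l := by
          funext l
          simp only [List.cons_append, rests, act]
          split_ifs with hl hl'
          · rfl
          · rw [hl', h₁]
          · exact h₂ l (by omega)
        obtain ⟨h₃, h₄⟩ := h' (.inr ⟨k, by omega⟩ :: u ++ w) fun l hl => by rw [e]; exact if_pos hl
        refine ⟨?_, fun l hl => ?_⟩
        · rw [List.append_assoc, whole, h₃, h₄ _ k.lt_succ_self, e]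
          simp
        · rw [List.append_assoc, h₄ l (by omega), e]
          simp only
          rw [if_neg (by omega), if_neg (by omega)]
    obtain ⟨u, hu, h⟩ := main s x hx
    refine ⟨u, ?_, h⟩
    have : 1 ≤ (s + 1) ^ (k + 1) := Nat.one_le_pow _ _ (Nat.succ_pos s)
    calc u.length + 1 ≤ s * (s + 1) ^ (k + 1) + (s + 1) ^ (k + 1) := by omega
      _ = (s + 1) ^ (k + 1 + 1) := by ring

/-- Zero bits at the most significant end change nothing, so words can be padded to a prescribed
length. -/
theorem rests_replicate {i : ℕ} (n l : ℕ) :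
    rests (List.replicate n (.inl false) : List (Dig i)) l = 0 := by
  induction n generalizing l with
  | zero => rfl
  | succ n ih =>
    simp only [List.replicate_succ, rests, act]
    by_cases h : l = 0
    · subst h
      simp [ih]
    · simp [h, ih]

theorem exists_word {i s n : ℕ} {x : Ordinal.{0}} (hx : x ∈ box (i + 1) s)
    (hn : (s + 1) ^ (i + 1) ≤ n) : ∃ w : List (Dig i), w.length = n ∧ value w = x := by
  obtain ⟨u, hu, h⟩ := exists_prefix le_rfl hx
  refine ⟨u ++ List.replicate (n - u.length) (.inl false : Dig i), ?_,
    (h (List.replicate (n - u.length) (.inl false)) fun l _ => rests_replicate _ l).1⟩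
  rw [List.length_append, List.length_replicate]
  omega

/-! ### Evaluation of formulas with bounded quantifiers -/

/-- An assignment of words to variables, the latest one first. -/
abbrev Env (i : ℕ) : Type := List (ℕ × List (Dig i))

/-- The word assigned to a variable, by default the empty one. -/
def Env.word {i : ℕ} (x : ℕ) : Env i → List (Dig i)
  | [] => []
  | (y, w) :: ρ => if x = y then w else word x ρ

/-- The length of the latest word. -/
def Env.size {i : ℕ} : Env i → ℕ
  | [] => 0
  | (_, w) :: _ => w.length

/-- The ordinals assigned to the variables. Here the most significant digit of a word comes
first. -/
noncomputable def Env.val {i : ℕ} (ρ : Env i) (x : ℕ) : Set.Iio (base (i + 1)) :=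
  ⟨value (ρ.word x).reverse, value_lt _⟩

open Classical in
/-- Truth of a formula when the quantifiers range over the words of a certain length. -/
noncomputable def Formula.eval {i : ℕ} : Formula → Env i → Bool
  | plus x y z, ρ => decide ((ρ.val x : Ordinal.{0}) + ρ.val y = ρ.val z)
  | neg φ, ρ => !φ.eval ρ
  | conj φ ψ, ρ => φ.eval ρ && ψ.eval ρ
  | disj φ ψ, ρ => φ.eval ρ || ψ.eval ρ
  | imp φ ψ, ρ => !φ.eval ρ || ψ.eval ρ
  | iff φ ψ, ρ => φ.eval ρ == ψ.eval ρ
  | ex x φ, ρ => decide (∃ w : List (Dig i), w.length = ρ.size ^ (2 * (i + 1)) ∧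
      φ.eval ((x, w) :: ρ) = true)

theorem Env.val_cons {i : ℕ} (ρ : Env i) (x : ℕ) (w : List (Dig i)) :
    Env.val ((x, w) :: ρ) = Function.update ρ.val x ⟨value w.reverse, value_lt _⟩ := by
  funext j
  by_cases h : j = x
  · subst h
    simp [Env.val, Env.word]
  · simp [Env.val, Env.word, h]

theorem Env.word_length_le {i n : ℕ} {ρ : Env i} (h : ∀ p ∈ ρ, p.2.length ≤ n) (x : ℕ) :
    (ρ.word x).length ≤ n := by
  induction ρ with
  | nil => exact Nat.zero_le _
  | cons p ρ ih =>
    obtain ⟨y, w⟩ := p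
    rw [Env.word]
    split_ifs
    · exact h _ List.mem_cons_self
    · exact ih fun p hp => h p (List.mem_cons_of_mem _ hp)

/-- An existential witness can be chosen as in `Compositional.exists_mem_box` for the invariant of
the scope, and it then has a word of the prescribed length. The bound on `states` is what keeps this
length polynomial in the current one. -/
theorem Formula.eval_iff {i : ℕ} (φ : Formula) (ρ : Env i) (h4 : 4 ≤ ρ.size)
    (hφ : φ.states ≤ ρ.size) (hρ : ∀ p ∈ ρ, p.2.length ≤ ρ.size) :
    φ.eval ρ = true ↔ φ.Holds (base (i + 1)) ρ.val := by
  induction φ generalizing ρ with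
  | plus x y z => simp [Formula.eval, Formula.Holds]
  | neg φ ih => simp [Formula.eval, Formula.Holds, ← ih ρ h4 hφ hρ]
  | conj φ ψ ihφ ihψ =>
    have h₁ := (Nat.le_mul_of_pos_right φ.states ψ.states_pos).trans hφ
    have h₂ := (Nat.le_mul_of_pos_left ψ.states φ.states_pos).trans hφ
    simp [Formula.eval, Formula.Holds, ← ihφ ρ h4 h₁ hρ, ← ihψ ρ h4 h₂ hρ]
  | disj φ ψ ihφ ihψ =>
    have h₁ := (Nat.le_mul_of_pos_right φ.states ψ.states_pos).trans hφ
    have h₂ := (Nat.le_mul_of_pos_left ψ.states φ.states_pos).trans hφ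
    simp [Formula.eval, Formula.Holds, ← ihφ ρ h4 h₁ hρ, ← ihψ ρ h4 h₂ hρ]
  | imp φ ψ ihφ ihψ =>
    have h₁ := (Nat.le_mul_of_pos_right φ.states ψ.states_pos).trans hφ
    have h₂ := (Nat.le_mul_of_pos_left ψ.states φ.states_pos).trans hφ
    simp only [Formula.eval, Formula.Holds, ← ihφ ρ h4 h₁ hρ, ← ihψ ρ h4 h₂ hρ]
    cases φ.eval ρ <;> simp
  | iff φ ψ ihφ ihψ =>
    have h₁ := (Nat.le_mul_of_pos_right φ.states ψ.states_pos).trans hφ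
    have h₂ := (Nat.le_mul_of_pos_left ψ.states φ.states_pos).trans hφ
    simp only [Formula.eval, Formula.Holds, ← ihφ ρ h4 h₁ hρ, ← ihψ ρ h4 h₂ hρ]
    cases φ.eval ρ <;> cases ψ.eval ρ <;> simp
  | ex x φ ih =>
    -- The quantifier accounts for one exponential, so the scope has strictly fewer states than
    -- `ρ.size`.
    have hφ' : φ.states < ρ.size := (Nat.lt_two_pow_self).trans_le hφ
    have grow : ρ.size ≤ ρ.size ^ (2 * (i + 1)) := Nat.le_self_pow (by omega) _
    have ih' : ∀ w : List (Dig i), w.length = ρ.size ^ (2 * (i + 1)) →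
        (φ.eval ((x, w) :: ρ) = true ↔ φ.Holds (base (i + 1)) (Env.val ((x, w) :: ρ))) := by
      intro w hw
      have e : Env.size ((x, w) :: ρ) = ρ.size ^ (2 * (i + 1)) := hw
      refine ih _ (by omega) (by omega) fun p hp => ?_
      rw [e]
      rcases List.mem_cons.1 hp with rfl | hp
      · exact hw.le
      · exact (hρ p hp).trans grow
    simp only [Formula.eval, decide_eq_true_eq, Formula.Holds]
    constructor
    · rintro ⟨w, hw, h⟩
      rw [ih' w hw, Env.val_cons] at h
      exact ⟨_, h⟩
    · rintro ⟨a, ha⟩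
      obtain ⟨τ, _, T, hcard, hT, h⟩ := exists_invariant φ
      have hbox : ∀ j, (ρ.val j : Ordinal.{0}) ∈ box (i + 1) (ρ.size + 1) := by
        intro j
        refine value_mem_box _ ?_
        rw [List.length_reverse]
        exact Nat.lt_succ_of_le (Env.word_length_le hρ j)
      obtain ⟨b, hb, e⟩ := hT.exists_mem_box hcard x _ _ hbox a.2
      -- The new box has parameter `ρ.size + 1 + φ.states`. One more than this is at most `2 *
      -- ρ.size + 1`, hence at most `ρ.size ^ 2`; the exponent `i + 1` comes from flattening.
      obtain ⟨w, hw, rfl⟩ := exists_word hb (n := ρ.size ^ (2 * (i + 1))) (by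
        rw [pow_mul]
        refine Nat.pow_le_pow_left ?_ _
        nlinarith)
      refine ⟨w.reverse, by simpa using hw, ?_⟩
      rw [ih' _ (by simpa using hw), Env.val_cons]
      refine (h _ _ _ ?_).1 ha
      have coe : ∀ c : Set.Iio (base (i + 1)),
          (fun j => (Function.update ρ.val x c j : Ordinal.{0})) =
            Function.update (fun j => (ρ.val j : Ordinal.{0})) x c := by
        intro c
        funext j
        by_cases hj : j = x
        · subst hj; simp
        · simp [hj]
      rw [coe, coe]
      simpa using e.symm

/-! ### A finite automaton for addition -/

/-- The facts about the rests of three words that are traced by the automaton. -/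
abbrev Vec (i : ℕ) : Type :=
  Fin (i + 1) → Prop × Prop × Prop × Prop × Prop × Prop × Prop

/-- The facts about three families of rests. -/
def vec {i : ℕ} (r s t : ℕ → Ordinal.{0}) : Vec i :=
  fun l => flags (l + 1) (r l) (s l) (t l)

/-- `whole` appends the rests of the lower levels as digits, one level after the other, so
`flags_congr` can be iterated. -/
theorem flags_whole_congr {i l : ℕ} (hl : l ≤ i) {r s t r' s' t' : ℕ → Ordinal.{0}}
    (hr : ∀ l, r l < base (l + 1)) (hs : ∀ l, s l < base (l + 1)) (ht : ∀ l, t l < base (l + 1))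
    (hr' : ∀ l, r' l < base (l + 1)) (hs' : ∀ l, s' l < base (l + 1))
    (ht' : ∀ l, t' l < base (l + 1)) (h : (vec r s t : Vec i) = vec r' s' t') :
    flags (l + 1) (whole r l) (whole s l) (whole t l) =
      flags (l + 1) (whole r' l) (whole s' l) (whole t' l) := by
  induction l with
  | zero => exact congrFun h 0
  | succ l ih =>
    exact flags_congr (hr _) (hs _) (ht _) (whole_lt hr l) (whole_lt hs l) (whole_lt ht l)
      (hr' _) (hs' _) (ht' _) (whole_lt hr' l) (whole_lt hs' l) (whole_lt ht' l)
      (congrFun h ⟨l + 1, by omega⟩) (ih (by omega))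

theorem vec_act_bit_congr {i : ℕ} (a b c : Bool) {r s t r' s' t' : ℕ → Ordinal.{0}}
    (hr : ∀ l, r l < base (l + 1)) (hs : ∀ l, s l < base (l + 1)) (ht : ∀ l, t l < base (l + 1))
    (hr' : ∀ l, r' l < base (l + 1)) (hs' : ∀ l, s' l < base (l + 1))
    (ht' : ∀ l, t' l < base (l + 1)) (h : (vec r s t : Vec i) = vec r' s' t') :
    (vec (act (.inl a : Dig i) r) (act (.inl b : Dig i) s) (act (.inl c : Dig i) t) : Vec i) =
      vec (act (.inl a : Dig i) r') (act (.inl b : Dig i) s') (act (.inl c : Dig i) t') := by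
  funext ⟨l, hl⟩
  by_cases h0 : l = 0
  · subst h0
    simp only [vec, act, Function.update_self]
    exact flags_congr (hr 0) (hs 0) (ht 0) (bit_lt_base a) (bit_lt_base b) (bit_lt_base c)
      (hr' 0) (hs' 0) (ht' 0) (bit_lt_base a) (bit_lt_base b) (bit_lt_base c) (congrFun h 0) rfl
  · simpa [vec, act, h0] using congrFun h ⟨l, hl⟩

theorem vec_act_sep_congr {i : ℕ} (m : Fin i) {r s t r' s' t' : ℕ → Ordinal.{0}}
    (hr : ∀ l, r l < base (l + 1)) (hs : ∀ l, s l < base (l + 1)) (ht : ∀ l, t l < base (l + 1))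
    (hr' : ∀ l, r' l < base (l + 1)) (hs' : ∀ l, s' l < base (l + 1))
    (ht' : ∀ l, t' l < base (l + 1)) (h : (vec r s t : Vec i) = vec r' s' t') :
    (vec (act (.inr m : Dig i) r) (act (.inr m : Dig i) s) (act (.inr m : Dig i) t) : Vec i) =
      vec (act (.inr m : Dig i) r') (act (.inr m : Dig i) s') (act (.inr m : Dig i) t') := by
  funext ⟨l, hl⟩
  simp only [vec, act]
  split_ifs
  · rfl
  · exact flags_whole_congr (by omega) hr hs ht hr' hs' ht' h
  · exact congrFun h ⟨l, hl⟩

/-- The digit that a word contributes when the digit `d` is read, if `o` is its first digit. -/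
def supply {i : ℕ} (d : Dig i) (o : Option (Dig i)) : Dig i :=
  match d, o with
  | .inl _, some (.inl b) => .inl b
  | .inl _, _ => .inl false
  | .inr m, _ => .inr m

theorem vec_act_congr {i : ℕ} (d : Dig i) (o o' o'' : Option (Dig i))
    {r s t r' s' t' : ℕ → Ordinal.{0}}
    (hr : ∀ l, r l < base (l + 1)) (hs : ∀ l, s l < base (l + 1)) (ht : ∀ l, t l < base (l + 1))
    (hr' : ∀ l, r' l < base (l + 1)) (hs' : ∀ l, s' l < base (l + 1))
    (ht' : ∀ l, t' l < base (l + 1)) (h : (vec r s t : Vec i) = vec r' s' t') :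
    (vec (act (supply d o) r) (act (supply d o') s) (act (supply d o'') t) : Vec i) =
      vec (act (supply d o) r') (act (supply d o') s') (act (supply d o'') t') := by
  cases d with
  | inl b =>
    have : ∀ o : Option (Dig i), ∃ c, supply (.inl b) o = .inl c := by
      rintro (_ | _ | _) <;> exact ⟨_, rfl⟩
    obtain ⟨_, e⟩ := this o
    obtain ⟨_, e'⟩ := this o'
    obtain ⟨_, e''⟩ := this o''
    rw [e, e', e'']
    exact vec_act_bit_congr _ _ _ hr hs ht hr' hs' ht' h
  | inr m => exact vec_act_sep_congr m hr hs ht hr' hs' ht' h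

open Classical in
/-- The transition function of the automaton. -/
noncomputable def transition {i : ℕ} (d : Dig i) (o o' o'' : Option (Dig i)) (q : Vec i) :
    Vec i :=
  if h : ∃ p : (ℕ → Ordinal.{0}) × (ℕ → Ordinal.{0}) × (ℕ → Ordinal.{0}),
      (∀ l, p.1 l < base (l + 1)) ∧ (∀ l, p.2.1 l < base (l + 1)) ∧
        (∀ l, p.2.2 l < base (l + 1)) ∧ vec p.1 p.2.1 p.2.2 = q then
    vec (act (supply d o) h.choose.1) (act (supply d o') h.choose.2.1)
      (act (supply d o'') h.choose.2.2)
  else q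

/-- The transition is computed on arbitrarily chosen representatives of the state; `vec_act_congr`
says that the choice does not matter. -/
theorem transition_vec {i : ℕ} (d : Dig i) (o o' o'' : Option (Dig i))
    {r s t : ℕ → Ordinal.{0}} (hr : ∀ l, r l < base (l + 1)) (hs : ∀ l, s l < base (l + 1))
    (ht : ∀ l, t l < base (l + 1)) :
    transition d o o' o'' (vec r s t) =
      vec (act (supply d o) r) (act (supply d o') s) (act (supply d o'') t) := by
  have h : ∃ p : (ℕ → Ordinal.{0}) × (ℕ → Ordinal.{0}) × (ℕ → Ordinal.{0}),
      (∀ l, p.1 l < base (l + 1)) ∧ (∀ l, p.2.1 l < base (l + 1)) ∧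
        (∀ l, p.2.2 l < base (l + 1)) ∧ vec p.1 p.2.1 p.2.2 = (vec r s t : Vec i) :=
    ⟨(r, s, t), hr, hs, ht, rfl⟩
  rw [transition, dif_pos h]
  obtain ⟨h₁, h₂, h₃, h₄⟩ := h.choose_spec
  exact vec_act_congr d o o' o'' h₁ h₂ h₃ hr hs ht h₄

open Classical in
/-- Whether the automaton accepts in a state. -/
noncomputable def accepts {i : ℕ} (q : Vec i) : Bool :=
  decide (∃ r s t : ℕ → Ordinal.{0}, (∀ l, r l < base (l + 1)) ∧ (∀ l, s l < base (l + 1)) ∧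
    (∀ l, t l < base (l + 1)) ∧ vec r s t = q ∧ whole r i + whole s i = whole t i)

open Classical in
theorem accepts_vec {i : ℕ} (w w' w'' : List (Dig i)) :
    accepts (vec (rests w) (rests w') (rests w'') : Vec i) =
      decide (value w + value w' = value w'') := by
  refine decide_eq_decide.2 ⟨?_, fun h =>
    ⟨_, _, _, rests_lt w, rests_lt w', rests_lt w'', rfl, h⟩⟩
  rintro ⟨r, s, t, hr, hs, ht, e, h⟩
  have := flags_whole_congr le_rfl hr hs ht (rests_lt w) (rests_lt w') (rests_lt w'') e
  simp only [flags, Prod.mk.injEq, eq_iff_iff] at this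
  exact this.2.2.2.2.2.1.1 h

/-! ### Synchronizing the three words at their separators. -/

/-- The level of the first digit of a word. -/
def level {i : ℕ} : Option (Dig i) → ℕ
  | none => i + 1
  | some (.inl _) => 0
  | some (.inr m) => m + 1

/-- The one of two first digits of words that is to be read first. -/
def least {i : ℕ} (o o' : Option (Dig i)) : Option (Dig i) :=
  if level o ≤ level o' then o else o'

theorem rests_tail {i : ℕ} (d : Dig i) (w : List (Dig i)) (h : level w.head? = level (some d)) :
    rests w = act (supply d w.head?) (rests w.tail) := by
  cases w with
  | nil =>
    cases d with
    | inl b => simp [level] at h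
    | inr m =>
      have := m.2
      simp only [level, List.head?_nil] at h
      omega
  | cons e w =>
    cases d with
    | inl b =>
      cases e with
      | inl c => rfl
      | inr m => simp [level] at h
    | inr m =>
      cases e with
      | inl c => simp [level] at h
      | inr m' =>
        obtain rfl : m' = m := by
          simp only [level, List.head?_cons] at h
          exact Fin.ext (by omega)
        rfl

/-- A word that begins on a higher level than `d` has an empty element below that level. A zero bit
or a separator that closes an empty element therefore leaves it unchanged, and the word can wait
while the others are read. -/
theorem rests_hold {i : ℕ} (d : Dig i) (w : List (Dig i)) (h : level (some d) < level w.head?) :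
    rests w = act (supply d w.head?) (rests w) := by
  have hz : ∀ l, l < level w.head? → l ≤ i → rests w l = 0 := by
    intro l hl hi
    cases w with
    | nil => rfl
    | cons e w =>
      cases e with
      | inl b => simp [level] at hl
      | inr m =>
        have : l ≤ m := Nat.lt_succ_iff.1 hl
        simp [rests, act, this]
  cases d with
  | inl b =>
    have : supply (.inl b) w.head? = (.inl false : Dig i) := by
      cases w with
      | nil => rfl
      | cons e w =>
        cases e with
        | inl c => simp [level] at h
        | inr m => rfl
    rw [this]
    funext l
    by_cases hl : l = 0
    · subst hl
      simp [act, hz 0 (by simpa [level] using h) (Nat.zero_le _)]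
    · simp [act, hl]
  | inr m =>
    have hm := m.2
    have h' : (m : ℕ) + 1 < level w.head? := h
    have hw : ∀ l, l ≤ (m : ℕ) + 1 → whole (rests w) l = 0 := by
      intro l hl
      induction l with
      | zero => exact hz 0 (by omega) (Nat.zero_le _)
      | succ l ih => rw [whole, hz _ (by omega) (by omega), ih (by omega), mul_zero, zero_add]
    funext l
    simp only [supply, act]
    split_ifs with h₁ h₂
    · exact hz l (by omega) (by omega)
    · rw [hw l (by omega)]
      exact hz l (by omega) (by omega)
    · rfl

end OrdinalAddition

/-! ## The stacks of the decision procedure -/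

namespace OrdinalAddition

open StackProgram

instance : Finite Letter := by
  refine Finite.of_surjective (fun c : Bool ⊕ Fin 8 => match c with
    | .inl b => Letter.digit b
    | .inr j => ![.plus, .neg, .conj, .disj, .imp, .iff, .ex, .var] j) fun l => ?_
  cases l with
  | digit b => exact ⟨.inl b, rfl⟩
  | plus => exact ⟨.inr 0, rfl⟩
  | neg => exact ⟨.inr 1, rfl⟩
  | conj => exact ⟨.inr 2, rfl⟩
  | disj => exact ⟨.inr 3, rfl⟩
  | imp => exact ⟨.inr 4, rfl⟩
  | iff => exact ⟨.inr 5, rfl⟩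
  | ex => exact ⟨.inr 6, rfl⟩
  | var => exact ⟨.inr 7, rfl⟩

/-- The symbols on the control stack: pending connectives, and for each pending quantifier a frame
with the text of its scope. -/
inductive CSym : Type
  | fst (g : Bool → Bool → Bool)
  | snd (h : Bool → Bool)
  | ex
  | txt (l : Letter)
  | base

instance : Finite CSym := by
  refine Finite.of_surjective (fun c : ((Bool → Bool → Bool) ⊕ (Bool → Bool)) ⊕ Bool ⊕ Letter =>
    match c with
    | .inl (.inl g) => CSym.fst g
    | .inl (.inr h) => CSym.snd h
    | .inr (.inl b) => if b then CSym.ex else CSym.base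
    | .inr (.inr l) => CSym.txt l) fun s => ?_
  cases s with
  | fst g => exact ⟨.inl (.inl g), rfl⟩
  | snd h => exact ⟨.inl (.inr h), rfl⟩
  | ex => exact ⟨.inr (.inl true), rfl⟩
  | base => exact ⟨.inr (.inl false), rfl⟩
  | txt l => exact ⟨.inr (.inr l), rfl⟩

/-- The symbols on the stack that holds the environment: the digits of the names of variables, the
digits of words, and marks for the ends of both. -/
inductive ESym (i : ℕ) : Type
  | nm (b : Bool)
  | dig (d : Dig i)
  | hash
  | dol

instance (i : ℕ) : Finite (ESym i) := by
  refine Finite.of_surjective (fun c : (Bool ⊕ Dig i) ⊕ Bool => match c with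
    | .inl (.inl b) => ESym.nm b
    | .inl (.inr d) => ESym.dig d
    | .inr b => if b then ESym.hash else ESym.dol) fun s => ?_
  cases s with
  | nm b => exact ⟨.inl (.inl b), rfl⟩
  | dig d => exact ⟨.inl (.inr d), rfl⟩
  | hash => exact ⟨.inr true, rfl⟩
  | dol => exact ⟨.inr false, rfl⟩

/-- The stacks. -/
inductive Stk : Type
  | inp | out | text | text2 | ctrl | env | env2 | name | name2
  | vals (j : Fin 3)
  | a | b | b2 | t
  deriving DecidableEq

instance : Finite Stk := by
  refine Finite.of_surjective (fun c : Fin 3 ⊕ Fin 13 => match c with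
    | .inl j => Stk.vals j
    | .inr j => ![.inp, .out, .text, .text2, .ctrl, .env, .env2, .name, .name2, .a, .b, .b2, .t] j)
    fun s => ?_
  cases s with
  | vals j => exact ⟨.inl j, rfl⟩
  | inp => exact ⟨.inr 0, rfl⟩
  | out => exact ⟨.inr 1, rfl⟩
  | text => exact ⟨.inr 2, rfl⟩
  | text2 => exact ⟨.inr 3, rfl⟩
  | ctrl => exact ⟨.inr 4, rfl⟩
  | env => exact ⟨.inr 5, rfl⟩
  | env2 => exact ⟨.inr 6, rfl⟩
  | name => exact ⟨.inr 7, rfl⟩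
  | name2 => exact ⟨.inr 8, rfl⟩
  | a => exact ⟨.inr 9, rfl⟩
  | b => exact ⟨.inr 10, rfl⟩
  | b2 => exact ⟨.inr 11, rfl⟩
  | t => exact ⟨.inr 12, rfl⟩

/-- The alphabets of the stacks. -/
@[reducible] def Alph (i : ℕ) : Stk → Type
  | .inp | .text | .text2 => Letter
  | .out | .name | .name2 => Bool
  | .ctrl => CSym
  | .env | .env2 => ESym i
  | .vals _ => Dig i
  | .a | .b | .b2 | .t => Unit

instance (i : ℕ) (k : Stk) : Finite (Alph i k) := by
  cases k <;> dsimp only [Alph] <;> infer_instance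

/-- The contents of the stacks. -/
@[ext] structure Store (i : ℕ) : Type where
  inp : List Letter := []
  out : List Bool := []
  text : List Letter := []
  text2 : List Letter := []
  ctrl : List CSym := []
  env : List (ESym i) := []
  env2 : List (ESym i) := []
  name : List Bool := []
  name2 : List Bool := []
  vals : Fin 3 → List (Dig i) := fun _ => []
  a : List Unit := []
  b : List Unit := []
  b2 : List Unit := []
  t : List Unit := []

namespace Store

variable {i : ℕ}

/-- The content of a stack. -/
def get (S : Store i) : ∀ k, List (Alph i k)
  | .inp => S.inp
  | .out => S.out
  | .text => S.text
  | .text2 => S.text2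
  | .ctrl => S.ctrl
  | .env => S.env
  | .env2 => S.env2
  | .name => S.name
  | .name2 => S.name2
  | .vals j => S.vals j
  | .a => S.a
  | .b => S.b
  | .b2 => S.b2
  | .t => S.t

/-- Replace the content of a stack. -/
def set (S : Store i) : ∀ k, List (Alph i k) → Store i
  | .inp, l => { S with inp := l }
  | .out, l => { S with out := l }
  | .text, l => { S with text := l }
  | .text2, l => { S with text2 := l }
  | .ctrl, l => { S with ctrl := l }
  | .env, l => { S with env := l }
  | .env2, l => { S with env2 := l }
  | .name, l => { S with name := l }
  | .name2, l => { S with name2 := l }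
  | .vals j, l => { S with vals := Function.update S.vals j l }
  | .a, l => { S with a := l }
  | .b, l => { S with b := l }
  | .b2, l => { S with b2 := l }
  | .t, l => { S with t := l }

theorem get_injective : Function.Injective (get (i := i)) := by
  intro S S' h
  have h' : ∀ k, S.get k = S'.get k := congrFun h
  exact Store.ext (h' .inp) (h' .out) (h' .text) (h' .text2) (h' .ctrl) (h' .env) (h' .env2)
    (h' .name) (h' .name2) (funext fun j => h' (.vals j)) (h' .a) (h' .b) (h' .b2) (h' .t)

theorem get_set (S : Store i) (k : Stk) (l : List (Alph i k)) :
    (S.set k l).get = Function.update S.get k l := by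
  funext k'
  by_cases h : k' = k
  · subst h
    rw [Function.update_self]
    cases k' <;> simp [get, set]
  · rw [Function.update_of_ne h]
    cases k <;> cases k' <;> first
      | rfl
      | exact absurd rfl h
      | exact Function.update_of_ne (fun e => h (congrArg Stk.vals e)) _ _

theorem get_set_self (S : Store i) (k : Stk) (l : List (Alph i k)) : (S.set k l).get k = l := by
  rw [get_set, Function.update_self]

theorem get_set_of_ne (S : Store i) {k k' : Stk} (h : k' ≠ k) (l : List (Alph i k)) :
    (S.set k l).get k' = S.get k' := by
  rw [get_set, Function.update_of_ne h]

theorem set_get (S : Store i) (k : Stk) : S.set k (S.get k) = S :=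
  get_injective (by rw [get_set, Function.update_eq_self])

theorem set_set (S : Store i) (k : Stk) (l l' : List (Alph i k)) :
    (S.set k l).set k l' = S.set k l' :=
  get_injective (by simp only [get_set, Function.update_idem])

theorem set_comm (S : Store i) {k k' : Stk} (h : k ≠ k') (l : List (Alph i k))
    (l' : List (Alph i k')) : (S.set k l).set k' l' = (S.set k' l').set k l :=
  get_injective (by simp only [get_set, Function.update_comm h])

end Store

/-! ### Reasoning about programs on named stacks. -/

/-- The programs on the stacks of the decision procedure. -/
abbrev Program (i : ℕ) (α : Type) : Type 1 := Prog (Alph i) α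

/-- `Does p S a S' t`: the program `p` leads from the stacks `S` to the stacks `S'` and exits with
the value `a`, in at most `t` steps. -/
def Does {i : ℕ} {α : Type} (p : Program i α) (S : Store i) (a : α) (S' : Store i) (t : ℕ) :
    Prop :=
  Prog.RunsIn p S.get a S'.get t

namespace Does

open Prog

variable {i : ℕ} {α β : Type} {S S₁ S₂ S' : Store i} {t t₁ t₂ : ℕ}

theorem mono {p : Program i α} {a : α} (h : Does p S a S' t₁) (ht : t₁ ≤ t) : Does p S a S' t :=
  RunsIn.mono h ht

theorem congr {p : Program i α} {a : α} (h : Does p S a S₁ t₁) (e : S₁ = S') (ht : t₁ ≤ t) :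
    Does p S a S' t :=
  e ▸ h.mono ht

theorem pure (a : α) : Does (Prog.pure a) S a S 1 := RunsIn.pure a

theorem push (k : Stk) (a : Alph i k) : Does (Prog.push k a) S () (S.set k (a :: S.get k)) 1 := by
  rw [Does, Store.get_set]
  exact RunsIn.push k a

theorem pop_cons {k : Stk} {a : Alph i k} {l : List (Alph i k)} (h : S.get k = a :: l) :
    Does (Prog.pop k) S (some a) (S.set k l) 1 := by
  have := RunsIn.pop (Γ := Alph i) (S := S.get) k
  rw [h] at this
  rwa [Does, Store.get_set]

theorem pop_nil {k : Stk} (h : S.get k = []) : Does (Prog.pop k) S none S 1 := by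
  have := RunsIn.pop (Γ := Alph i) (S := S.get) k
  rw [h] at this
  rw [Does]
  have e : Function.update S.get k [] = S.get := by
    rw [← h, Function.update_eq_self]
  rw [List.tail_nil, e] at this
  exact this

theorem next [Finite α] {p : Program i α} {f : α → Program i β} {a : α} {b : β}
    (h₁ : Does p S a S₁ t₁) (h₂ : Does (f a) S₁ b S' t₂) : Does (p.next f) S b S' (t₁ + t₂) :=
  RunsIn.bind h₁ h₂

theorem andThen {p : Program i Unit} {q : Program i β} {b : β}
    (h₁ : Does p S () S₁ t₁) (h₂ : Does q S₁ b S' t₂) : Does (p.andThen q) S b S' (t₁ + t₂) :=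
  RunsIn.bind h₁ h₂

theorem iter_stop [Finite α] {f : α → Program i (α ⊕ β)} {a : α} {b : β}
    (h : Does (f a) S (Sum.inr b) S' t) : Does (iter f a) S b S' t :=
  RunsIn.loop_stop h

theorem iter_next [Finite α] {f : α → Program i (α ⊕ β)} {a a' : α} {b : β}
    (h₁ : Does (f a) S (Sum.inl a') S₁ t₁) (h₂ : Does (iter f a') S₁ b S' t₂) :
    Does (iter f a) S b S' (t₁ + t₂) :=
  RunsIn.loop_next h₁ h₂

theorem scan_nil {k : Stk} {ends : Alph i k → Bool} {h : Alph i k → Program i Unit}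
    (hS : S.get k = []) : Does (scan k ends h) S () S 2 := by
  refine iter_stop (next (t₂ := 1) (pop_nil hS) ?_)
  exact pure _

theorem scan_stop {k : Stk} {ends : Alph i k → Bool} {h : Alph i k → Program i Unit}
    {a : Alph i k} {l : List (Alph i k)} (hS : S.get k = a :: l) (ha : ends a = true)
    (hh : Does (h a) (S.set k l) () S' t) : Does (scan k ends h) S () S' (t + 2) := by
  refine mono (iter_stop (next (pop_cons hS) (next hh ?_))) (t₁ := 1 + (t + 1)) (by omega)
  simp only [ha, if_true]
  exact pure _

theorem scan_cons {k : Stk} {ends : Alph i k → Bool} {h : Alph i k → Program i Unit}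
    {a : Alph i k} {l : List (Alph i k)} (hS : S.get k = a :: l) (ha : ends a = false)
    (hh : Does (h a) (S.set k l) () S₁ t₁) (h₂ : Does (scan k ends h) S₁ () S' t₂) :
    Does (scan k ends h) S () S' (t₁ + t₂ + 2) := by
  refine mono (iter_next (next (pop_cons hS) (next hh ?_)) h₂) (t₁ := 1 + (t₁ + 1) + t₂) (by omega)
  simp only [ha]
  exact pure _

theorem drain_cons {k : Stk} {h : Alph i k → Program i Unit} {a : Alph i k} {l : List (Alph i k)}
    (hS : S.get k = a :: l) (hh : Does (h a) (S.set k l) () S₁ t₁)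
    (h₂ : Does (drain k h) S₁ () S' t₂) : Does (drain k h) S () S' (t₁ + t₂ + 2) :=
  scan_cons hS rfl hh h₂

theorem drain_nil {k : Stk} {h : Alph i k → Program i Unit} (hS : S.get k = []) :
    Does (drain k h) S () S 2 :=
  scan_nil hS

end Does

open Prog

variable {i : ℕ}

/-- Move the content of a stack to another one, where it appears in reverse order. -/
def move (k k' : Stk) (g : Alph i k → Alph i k') : Program i Unit :=
  drain k fun a => push k' (g a)

theorem does_move {k k' : Stk} (hk : k' ≠ k) (g : Alph i k → Alph i k') (S : Store i) :
    Does (move k k' g) S ()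
      ((S.set k []).set k' (((S.get k).map g).reverse ++ S.get k')) (3 * (S.get k).length + 2) := by
  generalize hl : S.get k = l
  induction l generalizing S with
  | nil =>
    refine (Does.drain_nil hl).congr ?_ (by simp)
    rw [← hl, Store.set_get, hl]
    exact (Store.set_get S k').symm
  | cons a l ih =>
    have h := ih ((S.set k l).set k' (g a :: (S.set k l).get k'))
      (by rw [Store.get_set_of_ne _ hk.symm, Store.get_set_self])
    refine (Does.drain_cons hl (Does.push k' (g a)) h).congr ?_ ?_
    · rw [Store.get_set_self, Store.set_comm _ hk, Store.set_set, Store.set_set,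
        Store.get_set_of_ne _ hk]
      simp
    · simp only [List.length_cons]
      omega

/-- Remove the content of a stack. -/
def clear (k : Stk) : Program i Unit := drain k fun _ => Prog.pure ()

theorem does_clear (k : Stk) (S : Store i) :
    Does (clear k) S () (S.set k []) (3 * (S.get k).length + 2) := by
  generalize hl : S.get k = l
  induction l generalizing S with
  | nil => exact (Does.drain_nil hl).congr (by rw [← hl, Store.set_get]) (by simp)
  | cons a l ih =>
    have h := ih (S.set k l) (by rw [Store.get_set_self])
    refine (Does.drain_cons hl (Does.pure _) h).congr ?_ ?_
    · rw [Store.set_set]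
    · simp only [List.length_cons]
      omega

end OrdinalAddition

/-! ## Subroutines -/

namespace OrdinalAddition

open StackProgram Prog

variable {i : ℕ}

/-- Push a symbol, if there is one. -/
def pushOption (k : Stk) : Option (Alph i k) → Program i Unit
  | none => Prog.pure ()
  | some a => push k a

theorem does_push_option (k : Stk) (o : Option (Alph i k)) (S : Store i) :
    Does (pushOption k o) S () (S.set k (o.toList ++ S.get k)) 1 := by
  cases o with
  | none => exact (Does.pure ()).congr (by simp [Store.set_get]) le_rfl
  | some a => exact Does.push k a

/-- Scan the stack `k` and push images of its symbols to the stacks `k₁` and `k₂`. -/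
def copy (k k₁ k₂ : Stk) (ends : Alph i k → Bool) (f : Alph i k → Option (Alph i k₁))
    (g : Alph i k → Option (Alph i k₂)) : Program i Unit :=
  scan k ends fun e => (pushOption k₁ (f e)).andThen (pushOption k₂ (g e))

/-- The stacks after some symbols were copied. -/
def Store.copied (S : Store i) {k : Stk} (k₁ k₂ : Stk) (f : Alph i k → Option (Alph i k₁))
    (g : Alph i k → Option (Alph i k₂)) (l rest : List (Alph i k)) : Store i :=
  ((S.set k rest).set k₁ ((l.filterMap f).reverse ++ S.get k₁)).set k₂
    ((l.filterMap g).reverse ++ S.get k₂)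

section

variable {k k₁ k₂ : Stk} {ends : Alph i k → Bool} {f : Alph i k → Option (Alph i k₁)}
  {g : Alph i k → Option (Alph i k₂)}

theorem does_copy_step (h₂₁ : k₂ ≠ k₁) (h₂ : k₂ ≠ k) (h₁ : k₁ ≠ k)
    (S : Store i) (e : Alph i k) (l : List (Alph i k)) :
    Does ((pushOption k₁ (f e)).andThen (pushOption k₂ (g e)))
      (S.set k l) () (S.copied k₁ k₂ f g [e] l) 2 := by
  refine Does.congr ((does_push_option k₁ (f e) _).andThen (does_push_option k₂ (g e) _)) ?_ le_rfl
  rw [Store.get_set_of_ne _ h₁, Store.get_set_of_ne _ h₂₁, Store.get_set_of_ne _ h₂,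
    Store.copied]
  cases hf : f e <;> cases hg : g e <;> simp [hf, hg]

theorem Store.copied_cons (h₂₁ : k₂ ≠ k₁) (h₂ : k₂ ≠ k) (h₁ : k₁ ≠ k) (S : Store i)
    (e : Alph i k) (l l' rest : List (Alph i k)) :
    (S.copied k₁ k₂ f g [e] l').copied k₁ k₂ f g l rest = S.copied k₁ k₂ f g (e :: l) rest := by
  apply Store.get_injective
  funext j
  by_cases hj₂ : j = k₂
  · subst hj₂
    simp only [copied, get_set_self]
    cases he : g e <;> simp [he]
  · simp only [copied, get_set_of_ne _ hj₂]
    by_cases hj₁ : j = k₁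
    · subst hj₁
      simp only [get_set_self, get_set_of_ne _ hj₂]
      cases he : f e <;> simp [he]
    · simp only [get_set_of_ne _ hj₁]
      by_cases hj : j = k
      · subst hj
        simp only [get_set_self]
      · simp only [get_set_of_ne _ hj₁, get_set_of_ne _ hj₂, get_set_of_ne _ hj]

theorem Store.get_copied (h₂ : k₂ ≠ k) (h₁ : k₁ ≠ k) (S : Store i)
    (l rest : List (Alph i k)) : (S.copied k₁ k₂ f g l rest).get k = rest := by
  rw [copied, get_set_of_ne _ h₂.symm, get_set_of_ne _ h₁.symm, get_set_self]

/-- The rest of the run is a hypothesis, so that the same induction serves a scan ended by a mark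
and one ended by the empty stack. -/
theorem does_copy_prefix (h₂₁ : k₂ ≠ k₁) (h₂ : k₂ ≠ k) (h₁ : k₁ ≠ k) {S S' : Store i} {t : ℕ}
    {l rest : List (Alph i k)} (hl : ∀ e ∈ l, ends e = false) (hS : S.get k = l ++ rest)
    (h : Does (copy k k₁ k₂ ends f g) (S.copied k₁ k₂ f g l rest) () S' t) :
    Does (copy k k₁ k₂ ends f g) S () S' (4 * l.length + t) := by
  induction l generalizing S with
  | nil =>
    have e : S.copied k₁ k₂ f g [] rest = S := by
      rw [List.nil_append] at hS
      simp only [Store.copied, List.filterMap_nil, List.reverse_nil, List.nil_append]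
      rw [← hS, Store.set_get, Store.set_get, Store.set_get]
    rw [e] at h
    exact h.mono (by simp)
  | cons e l ih =>
    have hS' : (S.copied k₁ k₂ f g [e] (l ++ rest)).get k = l ++ rest :=
      Store.get_copied h₂ h₁ S _ _
    have := ih (fun e he => hl e (List.mem_cons_of_mem _ he)) hS'
      (by rw [Store.copied_cons h₂₁ h₂ h₁]; exact h)
    refine Does.mono (Does.scan_cons hS (hl e List.mem_cons_self)
      (does_copy_step h₂₁ h₂ h₁ S e (l ++ rest)) this) ?_
    simp only [List.length_cons]
    omega

theorem does_copy_stop (h₂₁ : k₂ ≠ k₁) (h₂ : k₂ ≠ k) (h₁ : k₁ ≠ k) {S : Store i}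
    {l rest : List (Alph i k)} {e : Alph i k} (hl : ∀ e ∈ l, ends e = false)
    (he : ends e = true) (hS : S.get k = l ++ e :: rest) :
    Does (copy k k₁ k₂ ends f g) S () (S.copied k₁ k₂ f g (l ++ [e]) rest)
      (4 * l.length + 4) := by
  refine does_copy_prefix h₂₁ h₂ h₁ hl hS ?_
  refine Does.congr (Does.scan_stop (Store.get_copied h₂ h₁ S _ _) he
    (does_copy_step h₂₁ h₂ h₁ _ e rest)) ?_ le_rfl
  clear hS
  induction l generalizing S with
  | nil =>
    simp only [Store.copied, List.filterMap_nil, List.reverse_nil, List.nil_append]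
    apply Store.get_injective
    funext j
    by_cases hj₂ : j = k₂
    · subst hj₂
      simp only [Store.get_set_self]
    · by_cases hj₁ : j = k₁
      · subst hj₁
        simp only [Store.get_set_self, Store.get_set_of_ne _ hj₂]
      · by_cases hj : j = k
        · subst hj
          simp only [Store.get_set_self, Store.get_set_of_ne _ hj₂, Store.get_set_of_ne _ hj₁]
        · simp only [Store.get_set_of_ne _ hj₂, Store.get_set_of_ne _ hj₁,
            Store.get_set_of_ne _ hj]
  | cons d l ih =>
    rw [← Store.copied_cons h₂₁ h₂ h₁ S d l (e :: rest) (e :: rest),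
      ih fun e he => hl e (List.mem_cons_of_mem _ he), Store.copied_cons h₂₁ h₂ h₁]
    rfl

theorem does_copy_all (h₂₁ : k₂ ≠ k₁) (h₂ : k₂ ≠ k) (h₁ : k₁ ≠ k) (S : Store i) :
    Does (copy k k₁ k₂ (fun _ => false) f g) S ()
      (S.copied k₁ k₂ f g (S.get k) []) (4 * (S.get k).length + 2) :=
  does_copy_prefix h₂₁ h₂ h₁ (fun _ _ => rfl) (List.append_nil _).symm
    (Does.scan_nil (Store.get_copied h₂ h₁ S _ _))

end

/-! ### Arithmetic of unary numbers -/

/-- Double the number on the stack `b`. -/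
def double : Program i Unit :=
  (drain .b fun _ => (push .t ()).andThen (push .t ())).andThen (move .t .b id)

theorem replicate_append_cons (n : ℕ) (l : List Unit) :
    List.replicate n () ++ () :: l = List.replicate (n + 1) () ++ l := by
  rw [List.replicate_succ', List.append_assoc]
  rfl

theorem does_double {S : Store i} {n : ℕ} (hb : S.b = List.replicate n ()) (ht : S.t = []) :
    Does double S () { S with b := List.replicate (2 * n) () } (10 * n + 4) := by
  have aux : ∀ (n : ℕ) (S : Store i), S.b = List.replicate n () →
      Does (drain .b fun _ => (push .t ()).andThen (push .t ())) S ()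
        { S with b := [], t := List.replicate (2 * n) () ++ S.t } (4 * n + 2) := by
    intro n
    induction n with
    | zero =>
      intro S hb
      refine Does.congr (Does.drain_nil hb) ?_ (by omega)
      rw [← show S.b = [] from hb]
      rfl
    | succ n ih =>
      intro S hb
      refine Does.congr (Does.drain_cons (a := ()) (l := List.replicate n ()) hb
        ((Does.push _ _).andThen (Does.push _ _)) (ih _ rfl)) ?_ (by omega)
      change ({ S with b := [], t := List.replicate (2 * n) () ++ () :: () :: S.t } : Store i) = _
      rw [replicate_append_cons, replicate_append_cons]
      rfl
  refine Does.congr ((aux n S hb).andThen (does_move (by decide) _ _))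
    (S' := { S with b := List.replicate (2 * n) () }) ?_ ?_
  · change ({ S with
      b := ((List.replicate (2 * n) () ++ S.t).map id).reverse ++ []
      t := [] } : Store i) = _
    rw [ht]
    simp
  · change 4 * n + 2 + (3 * (List.replicate (2 * n) () ++ S.t).length + 2) ≤ _
    rw [ht]
    simp
    omega

/-- Replace the number `n` on the stack `a` by `2 ^ n`. -/
def expo : Program i Unit :=
  (push .b ()).andThen ((drain .a fun _ => double).andThen (move .b .a id))

theorem does_expo {S : Store i} {n : ℕ} (ha : S.a = List.replicate n ()) (hb : S.b = [])
    (ht : S.t = []) : Does expo S () { S with a := List.replicate (2 ^ n) () } (25 * 2 ^ n) := by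
  -- Starting from `m`, the numbers being doubled sum to `m * (2 ^ n - 1)`; doubling costs ten steps
  -- per unit and the loop six more per round.
  have aux : ∀ (n m : ℕ) (S : Store i), S.a = List.replicate n () → S.b = List.replicate m () →
      S.t = [] → Does (drain .a fun _ => double) S ()
        { S with a := [], b := List.replicate (m * 2 ^ n) () }
        (10 * (m * (2 ^ n - 1)) + 6 * n + 2) := by
    intro n
    induction n with
    | zero =>
      intro m S ha hb _
      refine Does.congr (Does.drain_nil ha) ?_ (by omega)
      rw [pow_zero, mul_one, ← hb, ← show S.a = [] from ha]
    | succ n ih =>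
      intro m S ha hb ht
      refine Does.congr (Does.drain_cons (a := ()) (l := List.replicate n ()) ha
        (does_double (n := m) hb ht) (ih (2 * m) _ rfl rfl ht)) ?_ ?_
      · change ({ S with a := [], b := List.replicate (2 * m * 2 ^ n) () } : Store i) = _
        rw [pow_succ']
        congr 2
        ring
      · obtain ⟨k, hk⟩ := Nat.exists_eq_add_of_le (Nat.one_le_two_pow (n := n))
        have e : 2 ^ (n + 1) - 1 = 2 * k + 1 := by
          rw [pow_succ', hk]
          omega
        rw [e, hk, Nat.add_sub_cancel_left, show m * (2 * k + 1) = 2 * m * k + m by ring]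
        omega
  refine Does.congr ((Does.push .b ()).andThen ((aux n 1 (S.set .b (() :: S.b)) ha (by
    change () :: S.b = _
    rw [hb]
    rfl) ht).andThen (does_move (k := .b) (k' := .a) (by decide) id _)))
    (S' := { S with a := List.replicate (2 ^ n) () }) ?_ ?_
  · change ({ S with
      a := ((List.replicate (1 * 2 ^ n) ()).map id).reverse ++ []
      b := [] } : Store i) = _
    simp [hb]
  · change 1 + (10 * (1 * (2 ^ n - 1)) + 6 * n + 2 +
      (3 * (List.replicate (1 * 2 ^ n) ()).length + 2)) ≤ _
    have : n < 2 ^ n := Nat.lt_two_pow_self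
    simp
    omega

/-- Multiply the number on the stack `a` by the number on the stack `b`. -/
def multiply : Program i Unit :=
  (drain .a fun _ => (copy .b .t .b2 (fun _ => false) some some).andThen (move .b2 .b id)).andThen
    (move .t .a id)

/-- For each mark on `a` a copy of `b` is added to `t`. Reading `b` destroys it, so a second copy
goes to `b2` and is moved back. -/
theorem does_multiply {S : Store i} {m n : ℕ} (ha : S.a = List.replicate m ())
    (hb : S.b = List.replicate n ()) (hb2 : S.b2 = []) (ht : S.t = []) :
    Does multiply S () { S with a := List.replicate (m * n) () }
      (10 * (m * n) + 6 * m + 4) := by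
  have inner : ∀ S : Store i, S.b = List.replicate n () → S.b2 = [] →
      Does ((copy .b .t .b2 (fun _ => false) some some).andThen (move .b2 .b id)) S ()
        { S with t := List.replicate n () ++ S.t } (7 * n + 4) := by
    intro S hb hb2
    refine Does.congr ((does_copy_all (by decide) (by decide) (by decide) S).andThen
      (does_move (by decide) _ _)) ?_ ?_
    · change ({ S with
        t := (S.b.filterMap some).reverse ++ S.t
        b2 := []
        b := (((S.b.filterMap some).reverse ++ S.b2).map id).reverse ++ [] } : Store i) = _
      rw [hb2]
      simp [hb]
    · change 4 * S.b.length + 2 + (3 * ((S.b.filterMap some).reverse ++ S.b2).length + 2) ≤ _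
      rw [hb2, hb]
      simp
      omega
  have outer : ∀ (m : ℕ) (S : Store i), S.a = List.replicate m () → S.b = List.replicate n () →
      S.b2 = [] → Does (drain .a fun _ =>
        (copy .b .t .b2 (fun _ => false) some some).andThen (move .b2 .b id)) S ()
        { S with a := [], t := List.replicate (m * n) () ++ S.t } (m * (7 * n + 6) + 2) := by
    intro m
    induction m with
    | zero =>
      intro S ha _ _
      refine Does.congr (Does.drain_nil ha) ?_ (by omega)
      rw [← show S.a = [] from ha]
      simp
    | succ m ih =>
      intro S ha hb hb2
      refine Does.congr (Does.drain_cons (a := ()) (l := List.replicate m ()) ha (inner _ hb hb2)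
        (ih _ rfl hb hb2)) ?_ ?_
      · change ({ S with
          a := []
          t := List.replicate (m * n) () ++ (List.replicate n () ++ S.t) } : Store i) = _
        rw [← List.append_assoc, List.replicate_append_replicate, Nat.succ_mul]
      · have : (m + 1) * (7 * n + 6) = m * (7 * n + 6) + (7 * n + 6) := by ring
        omega
  refine Does.congr ((outer m S ha hb hb2).andThen (does_move (by decide) _ _))
    (S' := { S with a := List.replicate (m * n) () }) ?_ ?_
  · change ({ S with
      t := []
      a := ((List.replicate (m * n) () ++ S.t).map id).reverse ++ [] } : Store i) = _
    rw [ht]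
    simp
  · change m * (7 * n + 6) + 2 + (3 * (List.replicate (m * n) () ++ S.t).length + 2) ≤ _
    rw [ht]
    simp
    nlinarith

/-- Multiply the number on the stack `a` by a power of the number on the stack `b`. -/
def multiplyPow : ℕ → Program i Unit
  | 0 => Prog.pure ()
  | c + 1 => multiply.andThen (multiplyPow c)

theorem does_multiply_pow (c : ℕ) {S : Store i} {m n : ℕ} (ha : S.a = List.replicate m ())
    (hb : S.b = List.replicate n ()) (hb2 : S.b2 = []) (ht : S.t = []) (hn : 0 < n) :
    Does (multiplyPow c) S () { S with a := List.replicate (m * n ^ c) () }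
      (20 * c * (m * n ^ c + 1) + 1) := by
  induction c generalizing S m with
  | zero => exact (Does.pure ()).congr (by simp [← ha]) (by simp)
  | succ c ih =>
    refine Does.congr ((does_multiply ha hb hb2 ht).andThen
      (ih (m := m * n) rfl hb hb2 ht)) ?_ ?_
    · rw [pow_succ', mul_assoc]
    -- Because `n` is positive, the final product dominates all intermediate ones, and each
    -- multiplication is charged to it.
    · have h1 : m * n ≤ m * n * n ^ c := Nat.le_mul_of_pos_right _ (pow_pos hn _)
      have h2 : m ≤ m * n := Nat.le_mul_of_pos_right _ hn
      rw [pow_succ', ← mul_assoc m n]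
      nlinarith

end OrdinalAddition

/-! ## Reading the values of variables -/

namespace OrdinalAddition

open StackProgram Prog

variable {i : ℕ}

/-- Variables can be identified by comparing the binary digits of their indices. -/
theorem bits_injective : Function.Injective Nat.bits := by
  refine Function.LeftInverse.injective (g := fun l => l.foldr Nat.bit 0) fun n => ?_
  induction n using Nat.binaryRec' with
  | zero => simp
  | bit b n h ih =>
    rw [Nat.bits_append_bit n b h]
    exact congrArg (Nat.bit b) ih

/-- The code of an entry of an environment. -/
def entryCode (p : ℕ × List (Dig i)) : List (ESym i) :=
  (Nat.bits p.1).map ESym.nm ++ ESym.hash :: (p.2.map ESym.dig ++ [ESym.dol])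

/-- The code of an environment. -/
def Env.code (ρ : Env i) : List (ESym i) := ρ.flatMap entryCode

theorem Env.code_cons (p : ℕ × List (Dig i)) (ρ : Env i) :
    Env.code (p :: ρ) = entryCode p ++ Env.code ρ := rfl

theorem length_entryCode (p : ℕ × List (Dig i)) :
    (entryCode p).length = (Nat.bits p.1).length + p.2.length + 2 := by
  simp [entryCode]
  omega

theorem Env.length_word_le (ρ : Env i) (x : ℕ) : (ρ.word x).length ≤ (Env.code ρ).length := by
  induction ρ with
  | nil => simp [Env.word]
  | cons p ρ ih =>
    rw [Env.code_cons, List.length_append, length_entryCode, Env.word]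
    split <;> omega

/-- The word does not begin with a digit. -/
def NoDigit (R : List Letter) : Prop := ∀ b R', R ≠ Letter.digit b :: R'

/-- Read the name of a variable from `text`, and push its digits to `name`. -/
def readName : Program i Unit :=
  scan .text (fun l => match l with | .digit _ => false | _ => true) fun l => match l with
    | .digit b => push .name b
    | l => push .text l

/-- The end of a name is noticed only at the first letter that is not a digit, which is pushed back;
hence the condition `NoDigit R`. -/
theorem does_read_name {S : Store i} {u : List Bool} {R : List Letter}
    (hS : S.text = u.map Letter.digit ++ R) (hR : NoDigit R) :
    Does readName S () { S with text := R, name := u.reverse ++ S.name } (3 * u.length + 3) := by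
  induction u generalizing S with
  | nil =>
    cases R with
    | nil =>
      refine Does.congr (Does.scan_nil hS) ?_ (by simp)
      change S = ({ S with text := [] } : Store i)
      rw [← show S.text = [] from hS]
    | cons l R =>
      have hS' : S.text = l :: R := hS
      refine Does.congr (Does.scan_stop (l := R) (a := l) (t := 1) hS' ?_
        (S' := { S with text := l :: R }) ?_) rfl (by simp)
      · cases l <;> first | rfl | exact absurd rfl (hR _ _)
      · cases l <;> first | exact absurd rfl (hR _ _) | exact Does.push Stk.text _
  | cons b u ih =>
    refine Does.congr (Does.scan_cons (a := Letter.digit b) (l := u.map Letter.digit ++ R) hS rfl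
      (Does.push .name b) (ih rfl)) ?_ ?_
    · change ({ S with text := R, name := u.reverse ++ b :: S.name } : Store i) = _
      simp
    · simp only [List.length_cons]
      omega

theorem does_pop (k : Stk) (S : Store i) :
    Does (pop k) S (S.get k).head? (S.set k (S.get k).tail) 1 := by
  cases h : S.get k with
  | nil => exact (Does.pop_nil h).congr (by rw [List.tail_nil, ← h, Store.set_get]) le_rfl
  | cons a l => exact Does.pop_cons h

/-- The outcome of the comparison of two symbols of names. -/
def compareSymbols (m : Bool) : Option (ESym i) → Option Bool → Bool ⊕ Option Bool
  | none, _ => Sum.inr none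
  | some .hash, o => Sum.inr (some (m && o.isNone))
  | some (.nm b), some b' => Sum.inl (m && (b == b'))
  | _, _ => Sum.inl false

/-- Compare the name on the stack `name2` with that of the first entry of the environment, by
moving them to `name` and `env2`. The exit value is `none` if the environment is empty. -/
def compareNames : Bool → Program i (Option Bool) :=
  iter fun m : Bool => (pop .env).next fun e => (pop .name2).next fun o =>
    ((pushOption .env2 e).andThen (pushOption .name o)).andThen (Prog.pure (compareSymbols m e o))

theorem does_compare_symbols (m : Bool) (S : Store i) :
    Does ((pop .env).next fun e => (pop .name2).next fun o =>
      ((pushOption .env2 e).andThen (pushOption .name o)).andThen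
        (Prog.pure (compareSymbols m e o))) S (compareSymbols m S.env.head? S.name2.head?)
      { S with
        env := S.env.tail
        env2 := S.env.head?.toList ++ S.env2
        name := S.name2.head?.toList ++ S.name
        name2 := S.name2.tail } 5 :=
  Does.mono ((does_pop .env S).next ((does_pop .name2 _).next (((does_push_option .env2 _ _).andThen
    (does_push_option .name _ _)).andThen (Does.pure _)))) le_rfl

/-- The flag `m` records whether the names have agreed so far. The step at the mark `hash` also
tries to pop a symbol of `v`, to see whether both names end together; this explains `u.length + 1`.
-/
theorem does_compare_names (u v : List Bool) (m : Bool) {S : Store i} {E : List (ESym i)}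
    (hS : S.env = u.map ESym.nm ++ ESym.hash :: E) (hv : S.name2 = v) :
    Does (compareNames m) S (some (m && decide (u = v))) { S with
      env := E
      env2 := ESym.hash :: ((u.map ESym.nm).reverse ++ S.env2)
      name := (v.take (u.length + 1)).reverse ++ S.name
      name2 := v.drop (u.length + 1) } (5 * u.length + 5) := by
  induction u generalizing v m S with
  | nil =>
    refine Does.congr (Does.iter_stop ?_) (?_ : ({ S with
        env := S.env.tail
        env2 := S.env.head?.toList ++ S.env2
        name := S.name2.head?.toList ++ S.name
        name2 := S.name2.tail } : Store i) = _) (le_refl 5)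
    · have := does_compare_symbols m S
      rw [hS, hv] at this ⊢
      cases v <;> exact this
    · rw [hS, hv]
      cases v <;> simp
  | cons b u ih =>
    have h := does_compare_symbols m S
    have e : compareSymbols m S.env.head? S.name2.head? =
        Sum.inl (m && decide (v.head? = some b)) := by
      rw [hS, hv]
      cases v with
      | nil => simp [compareSymbols]
      | cons c v => cases b <;> cases c <;> simp [compareSymbols]
    rw [e] at h
    have h' := Does.iter_next h (ih v.tail _ (by rw [hS]; rfl) (by rw [hv]))
    have e' : ((m && decide (v.head? = some b)) && decide (u = v.tail)) =
        (m && decide (b :: u = v)) := by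
      cases v with
      | nil => simp
      | cons c v =>
        by_cases h : b = c
        · subst h
          simp only [List.head?_cons, List.tail_cons, decide_true, Bool.and_true, List.cons.injEq,
            true_and]
          exact congrArg _ (decide_eq_decide.2 Iff.rfl)
        · simp [h, Ne.symm h]
    rw [e'] at h'
    refine Does.congr h' ?_ ?_
    · rw [hS, hv]
      cases v <;> simp
    · simp only [List.length_cons]
      omega

/-- The digit that is written in the code of an environment. -/
def ESym.digit? : ESym i → Option (Dig i)
  | .dig d => some d
  | _ => none

theorem filterMap_digit (w : List (Dig i)) :
    (w.map ESym.dig ++ [ESym.dol]).filterMap ESym.digit? = w := by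
  rw [List.filterMap_append, List.filterMap_map]
  change w.filterMap some ++ [] = w
  simp

/-- Whether a symbol is the mark at the end of an entry. -/
def ESym.isDol : ESym i → Bool
  | .dol => true
  | _ => false

/-- Search the environment for the variable whose name is on the stack `name2`, and push its value
to the stack `vals j`. The part of the environment that was read is moved to the stack `env2`. -/
def search (j : Fin 3) : Program i Unit :=
  iter (fun _ : Unit => (compareNames true).next fun r =>
    ((move .name .name2 id).andThen (copy .env .env2 (.vals j) ESym.isDol some
      fun e => if r = some true then e.digit? else none)).andThen
      (Prog.pure (if r = some false then Sum.inl () else Sum.inr ()))) ()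

theorem does_pure_of_eq {α : Type} {a b : α} (h : a = b) {S : Store i} :
    Does (Prog.pure a) S b S 1 :=
  h ▸ Does.pure a

theorem does_restore_name {S : Store i} {v : List Bool} {k : ℕ}
    (h : S.name = (v.take k).reverse) (h2 : S.name2 = v.drop k) :
    Does (move .name .name2 id) S () { S with name := [], name2 := v } (3 * k + 2) := by
  refine Does.congr (does_move (k := .name) (k' := .name2) (by decide) id S) ?_ ?_
  · change ({ S with name := [], name2 := (S.name.map id).reverse ++ S.name2 } : Store i) = _
    rw [h, h2]
    simp
  · change 3 * S.name.length + 2 ≤ _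
    rw [h]
    simp

theorem does_search_entry (j : Fin 3) (p : ℕ × List (Dig i)) (E : List (ESym i)) {S : Store i}
    (hS : S.env = entryCode p ++ E) (hname : S.name = []) :
    Does ((compareNames true).next fun r =>
      ((move .name .name2 id).andThen (copy .env .env2 (.vals j) ESym.isDol some
        fun e => if r = some true then e.digit? else none)).andThen
        (Prog.pure (if r = some false then Sum.inl () else Sum.inr ()))) S
      (if Nat.bits p.1 = S.name2 then Sum.inr () else Sum.inl ())
      { S with
        env := E
        env2 := (entryCode p).reverse ++ S.env2
        vals := Function.update S.vals j
          ((if Nat.bits p.1 = S.name2 then p.2.reverse else []) ++ S.vals j) }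
      (20 * (entryCode p).length) := by
  have hS' : S.env = (Nat.bits p.1).map ESym.nm ++ ESym.hash :: (p.2.map ESym.dig ++ ESym.dol :: E)
      := by
    rw [hS, entryCode]
    simp
  refine Does.congr ((does_compare_names _ _ true hS' rfl).next
    ((Does.andThen ((does_restore_name (v := S.name2) (k := (Nat.bits p.1).length + 1)
      (by rw [hname, List.append_nil]) rfl).andThen (does_copy_stop (k := .env) (k₁ := .env2)
        (k₂ := .vals j) (l := p.2.map ESym.dig) (e := ESym.dol) (rest := E) (by simp) (by simp)
        (by simp) (by simp only [List.mem_map]; rintro _ ⟨d, -, rfl⟩; rfl) rfl rfl)) (t₂ := 1) ?_)))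
    (S₁ := { S with
        env := E
        env2 := (entryCode p).reverse ++ S.env2
        vals := Function.update S.vals j
          ((if Nat.bits p.1 = S.name2 then p.2.reverse else []) ++ S.vals j) }) rfl ?_
  · refine Does.congr (does_pure_of_eq ?_) ?_ le_rfl
    · by_cases h : Nat.bits p.1 = S.name2 <;> simp [h]
    · change ({ S with
        name := []
        env := E
        env2 := ((p.2.map ESym.dig ++ [ESym.dol]).filterMap some).reverse ++
          ESym.hash :: (((Nat.bits p.1).map ESym.nm).reverse ++ S.env2)
        vals := Function.update S.vals j (((p.2.map ESym.dig ++ [ESym.dol]).filterMap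
          fun e => if some (true && decide (Nat.bits p.1 = S.name2)) = some true
            then ESym.digit? e else none).reverse ++ S.vals j) } : Store i) = _
      congr 1
      · simp [entryCode]
      · exact hname.symm
      · congr 2
        by_cases h : Nat.bits p.1 = S.name2
        · simp only [h, decide_true, Bool.and_true, if_true, filterMap_digit]
        · simp [h]
  · rw [length_entryCode, List.length_map]
    omega

/-- The place where the search stops depends on `ρ`. Only the concatenation of the read and the
unread part matters, since it allows the environment to be restored. -/
theorem does_search (j : Fin 3) (x : ℕ) (ρ : Env i) {S : Store i} (hS : S.env = Env.code ρ)
    (hname : S.name = []) (hx : S.name2 = Nat.bits x) :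
    ∃ E E' : List (ESym i), E'.reverse ++ E = S.env2.reverse ++ S.env ∧
      Does (search j) S () { S with
        env := E
        env2 := E'
        vals := Function.update S.vals j ((ρ.word x).reverse ++ S.vals j) }
        (20 * (Env.code ρ).length + 20) := by
  induction ρ generalizing S with
  | nil =>
    have h := does_compare_symbols true S
    rw [show S.env = [] from hS] at h
    refine ⟨[], S.env2, by rw [show S.env = [] from hS], Does.congr (Does.iter_stop
      ((Does.iter_stop h).next (Does.andThen ((does_restore_name (v := S.name2) (k := 1) ?_
      (List.drop_one).symm).andThen (Does.scan_nil rfl))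
      (Does.pure _)))) ?_ ?_⟩
    · change S.name2.head?.toList ++ S.name = _
      rw [hname]
      cases S.name2 <;> rfl
    · change ({ S with env := [], name := [] } : Store i) = _
      rw [← hname]
      simp [Env.word]
    · omega
  | cons p ρ ih =>
    have h := does_search_entry j p (Env.code ρ) hS hname
    rw [hx] at h
    have e : Nat.bits p.1 = Nat.bits x ↔ x = p.1 := bits_injective.eq_iff.trans eq_comm
    by_cases hp : x = p.1
    · rw [if_pos (e.2 hp), if_pos (e.2 hp)] at h
      refine ⟨Env.code ρ, (entryCode p).reverse ++ S.env2, ?_,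
        Does.congr (Does.iter_stop h) ?_ ?_⟩
      · rw [hS, Env.code_cons]
        simp
      · rw [Env.word, if_pos hp, hx]
      · rw [Env.code_cons, List.length_append]
        omega
    · rw [if_neg (mt e.1 hp), if_neg (mt e.1 hp)] at h
      obtain ⟨E, E', hE, h'⟩ := ih (S := { S with
        env := Env.code ρ
        env2 := (entryCode p).reverse ++ S.env2 }) rfl hname hx
      refine ⟨E, E', ?_, Does.congr (Does.iter_next (Does.congr h ?_ le_rfl) h') ?_ ?_⟩
      · rw [hE, hS, Env.code_cons]
        simp
      · rw [List.nil_append, Function.update_eq_self, hx]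
      · rw [Env.word, if_neg hp]
      · rw [Env.code_cons, List.length_append]
        omega

/-- Read a variable from `text` and push the word assigned to it to the stack `vals j`. -/
def lookup (j : Fin 3) : Program i Unit :=
  (pop .text).next fun _ => readName.andThen ((move .name .name2 id).andThen
    ((search j).andThen ((move .env2 .env id).andThen (clear .name2))))

theorem does_lookup (j : Fin 3) (x : ℕ) (ρ : Env i) {R : List Letter} {S : Store i}
    (htext : S.text = writeVar x ++ R) (hR : NoDigit R) (hS : S.env = Env.code ρ)
    (henv : S.env2 = []) (hname : S.name = []) (hname2 : S.name2 = []) (hvals : S.vals j = []) :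
    Does (lookup j) S () { S with
      text := R
      vals := Function.update S.vals j (ρ.word x).reverse }
      (23 * (Env.code ρ).length + 9 * (Nat.bits x).length + 30) := by
  have h₀ : S.get .text = Letter.var :: ((Nat.bits x).map Letter.digit ++ R) := htext
  have h₁ : Does readName (S.set .text ((Nat.bits x).map Letter.digit ++ R)) ()
      { S with text := R, name := (Nat.bits x).reverse } (3 * (Nat.bits x).length + 3) :=
    Does.congr (does_read_name (S := S.set .text ((Nat.bits x).map Letter.digit ++ R)) rfl hR)
      (by change ({ S with text := R, name := (Nat.bits x).reverse ++ S.name } : Store i) = _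
          rw [hname, List.append_nil]) le_rfl
  have h₂ : Does (move .name .name2 id) { S with text := R, name := (Nat.bits x).reverse } ()
      { S with text := R, name2 := Nat.bits x } (3 * (Nat.bits x).length + 2) := by
    refine Does.congr (does_move (by decide) _ _) ?_ ?_
    · change ({ S with
        text := R
        name := []
        name2 := ((Nat.bits x).reverse.map id).reverse ++ S.name2 } : Store i) = _
      rw [hname2, hname]
      simp
    · change 3 * (Nat.bits x).reverse.length + 2 ≤ _
      simp
  obtain ⟨E, E', hE, h₃⟩ := does_search j x ρ (S := { S with
    text := R
    name2 := Nat.bits x }) hS hname rfl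
  have hE' : E'.reverse ++ E = Env.code ρ := by
    rw [hE]
    change S.env2.reverse ++ S.env = _
    rw [henv, hS]
    rfl
  have h₄ : Does (move .env2 .env id) { S with
        text := R
        name2 := Nat.bits x
        env := E
        env2 := E'
        vals := Function.update S.vals j ((ρ.word x).reverse ++ S.vals j) } ()
      { S with
        text := R
        name2 := Nat.bits x
        vals := Function.update S.vals j (ρ.word x).reverse }
      (3 * (Env.code ρ).length + 2) := by
    refine Does.congr (does_move (by decide) _ _) ?_ ?_
    · change ({ S with
        text := R
        name2 := Nat.bits x
        env2 := []
        env := (E'.map id).reverse ++ E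
        vals := Function.update S.vals j ((ρ.word x).reverse ++ S.vals j) } : Store i) = _
      rw [List.map_id, hE', hvals, List.append_nil, ← hS, ← henv]
    · change 3 * E'.length + 2 ≤ _
      have := congrArg List.length hE'
      simp only [List.length_append, List.length_reverse] at this
      omega
  refine Does.congr ((Does.pop_cons h₀).next (h₁.andThen (h₂.andThen (h₃.andThen
    (h₄.andThen (does_clear .name2 _)))))) ?_ ?_
  · change ({ S with
      text := R
      name2 := []
      vals := Function.update S.vals j (ρ.word x).reverse } : Store i) = _
    rw [← hname2]
  · change 1 + (3 * (Nat.bits x).length + 3 + (3 * (Nat.bits x).length + 2 +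
      (20 * (Env.code ρ).length + 20 + (3 * (Env.code ρ).length + 2 +
      (3 * (Nat.bits x).length + 2))))) ≤ _
    omega

/-- The text that begins with a variable does not begin with a digit. -/
theorem noDigit_writeVar (x : ℕ) (R : List Letter) : NoDigit (writeVar x ++ R) := by
  intro b R' h
  cases h

end OrdinalAddition

/-! ## Checking an addition -/

namespace OrdinalAddition

open StackProgram Prog

variable {i : ℕ}

theorem level_least (o o' : Option (Dig i)) :
    level (least o o') ≤ level o ∧ level (least o o') ≤ level o' ∧
      (least o o' = o ∨ least o o' = o') := by
  unfold least
  split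
  · exact ⟨le_rfl, by assumption, Or.inl rfl⟩
  · exact ⟨by omega, le_rfl, Or.inr rfl⟩

/-- The digit that is to be put back when the digit `d` is read, if `o` is the first digit. -/
def hold (d : Dig i) (o : Option (Dig i)) : Option (Dig i) :=
  if level (some d) < level o then o else none

/-- The rest of a word when the digit `d` is read. -/
def advance (d : Dig i) (w : List (Dig i)) : List (Dig i) :=
  if level (some d) < level w.head? then w else w.tail

theorem hold_append (d : Dig i) (w : List (Dig i)) :
    (hold d w.head?).toList ++ w.tail = advance d w := by
  unfold hold advance
  split
  · cases w <;> rfl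
  · rfl

theorem rests_advance {d : Dig i} {w : List (Dig i)} (h : level (some d) ≤ level w.head?) :
    rests w = act (supply d w.head?) (rests (advance d w)) := by
  unfold advance
  split
  · exact rests_hold d w (by assumption)
  · exact rests_tail d w (by omega)

theorem length_advance_le (d : Dig i) (w : List (Dig i)) : (advance d w).length ≤ w.length := by
  unfold advance
  split
  · exact le_rfl
  · rw [List.length_tail]
    omega

theorem length_advance_lt {d : Dig i} {w : List (Dig i)} (h : w.head? = some d) :
    (advance d w).length < w.length := by
  rw [advance, h, if_neg (lt_irrefl _)]
  cases w with
  | nil => cases h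
  | cons e w => simp

/-- Read the words on the stacks `vals j` simultaneously, and decide whether the values of the
first two words add up to the value of the third one. -/
noncomputable def merge : (Vec i → Vec i) → Program i Bool :=
  iter fun f => (pop (.vals 0)).next fun o₀ => (pop (.vals 1)).next fun o₁ =>
    (pop (.vals 2)).next fun o₂ => match least o₀ (least o₁ o₂) with
      | none => Prog.pure (Sum.inr (accepts (f (vec 0 0 0))))
      | some d => ((pushOption (.vals 0) (hold d o₀)).andThen
          ((pushOption (.vals 1) (hold d o₁)).andThen (pushOption (.vals 2) (hold d o₂)))).andThen
            (Prog.pure (Sum.inl (f ∘ transition d o₀ o₁ o₂)))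

/-- The words are available from the least significant end, while the automaton runs from the other
end. So the program keeps in its control the composition `f` of the transitions read so far, an
element of the finite type `Vec i → Vec i`, and applies it to the initial state at the end. -/
theorem does_merge (f : Vec i → Vec i) (S : Store i) :
    Does (merge f) S (accepts (f (vec (rests (S.vals 0)) (rests (S.vals 1)) (rests (S.vals 2)))))
      { S with vals := fun _ => [] }
      (7 * ((S.vals 0).length + (S.vals 1).length + (S.vals 2).length) + 4) := by
  generalize hn : (S.vals 0).length + (S.vals 1).length + (S.vals 2).length = n
  induction n using Nat.strong_induction_on generalizing f S with
  | _ n ih =>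
  have hpop := fun {β : Type} (b : β) (S' : Store i) (t : ℕ)
      (g : Option (Dig i) → Option (Dig i) → Option (Dig i) → Program i β)
      (h : Does (g (S.vals 0).head? (S.vals 1).head? (S.vals 2).head?)
        { S with vals := fun j => (S.vals j).tail } b S' t) =>
    show Does ((pop (.vals 0)).next fun o₀ => (pop (.vals 1)).next fun o₁ =>
      (pop (.vals 2)).next fun o₂ => g o₀ o₁ o₂) S b S' (1 + (1 + (1 + t))) by
    have e : ((S.set (.vals 0) (S.vals 0).tail).set (.vals 1) (S.vals 1).tail).set (.vals 2)
        (S.vals 2).tail = { S with vals := fun j => (S.vals j).tail } := by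
      apply Store.get_injective
      funext k
      cases k <;> try rfl
      rename_i j
      fin_cases j <;> rfl
    rw [← e] at h
    exact (does_pop (.vals 0) S).next ((does_pop (.vals 1) _).next ((does_pop (.vals 2) _).next h))
  cases hl : least (S.vals 0).head? (least (S.vals 1).head? (S.vals 2).head?) with
  | none =>
    have h0 := level_least (S.vals 0).head? (least (S.vals 1).head? (S.vals 2).head?)
    have h1 := level_least (S.vals 1).head? (S.vals 2).head?
    rw [hl] at h0
    -- The level `i + 1` of a missing digit exceeds that of every digit, so a missing minimum means
    -- that all three words are exhausted.
    have hnil : ∀ w : List (Dig i), level (none : Option (Dig i)) ≤ level w.head? → w = [] := by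
      intro w hw
      cases w with
      | nil => rfl
      | cons e w =>
        cases e with
        | inl b => simp [level] at hw
        | inr m =>
          have := m.2
          simp only [level, List.head?_cons] at hw
          omega
    have e0 := hnil _ h0.1
    have e1 := hnil _ (h0.2.1.trans h1.1)
    have e2 := hnil _ (h0.2.1.trans h1.2.1)
    refine Does.congr (Does.iter_stop (hpop _ _ 1 _ ?_)) rfl (by omega)
    rw [hl, e0, e1, e2]
    refine Does.congr (Does.pure _) ?_ le_rfl
    congr 1
    funext j
    fin_cases j
    exacts [congrArg List.tail e0, congrArg List.tail e1, congrArg List.tail e2]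
  | some d =>
    have h0 := level_least (S.vals 0).head? (least (S.vals 1).head? (S.vals 2).head?)
    have h1 := level_least (S.vals 1).head? (S.vals 2).head?
    rw [hl] at h0
    -- The minimum `d` is the first digit of at least one of the words, which loses it; the others
    -- never grow.
    have hlt : (advance d (S.vals 0)).length + (advance d (S.vals 1)).length +
        (advance d (S.vals 2)).length < n := by
      have a0 := length_advance_le d (S.vals 0)
      have a1 := length_advance_le d (S.vals 1)
      have a2 := length_advance_le d (S.vals 2)
      have b0 := length_advance_lt (d := d) (w := S.vals 0)
      have b1 := length_advance_lt (d := d) (w := S.vals 1)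
      have b2 := length_advance_lt (d := d) (w := S.vals 2)
      rcases h0.2.2 with h | h
      · have := b0 h.symm
        omega
      · rcases h1.2.2 with h' | h'
        · have := b1 (h' ▸ h.symm)
          omega
        · have := b2 (h' ▸ h.symm)
          omega
    have e : ((({ S with vals := fun j => (S.vals j).tail } : Store i).set (.vals 0)
        ((hold d (S.vals 0).head?).toList ++ (S.vals 0).tail)).set (.vals 1)
        ((hold d (S.vals 1).head?).toList ++ (S.vals 1).tail)).set (.vals 2)
        ((hold d (S.vals 2).head?).toList ++ (S.vals 2).tail) =
        { S with vals := fun j => advance d (S.vals j) } := by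
      simp only [hold_append]
      apply Store.get_injective
      funext k
      cases k <;> try rfl
      rename_i j
      fin_cases j <;> rfl
    have hpush : Does ((pushOption (.vals 0) (hold d (S.vals 0).head?)).andThen
        ((pushOption (.vals 1) (hold d (S.vals 1).head?)).andThen
          (pushOption (.vals 2) (hold d (S.vals 2).head?))))
        { S with vals := fun j => (S.vals j).tail } ()
        { S with vals := fun j => advance d (S.vals j) } 3 := by
      rw [← e]
      exact ((does_push_option (.vals 0) _ _).andThen ((does_push_option (.vals 1) _ _).andThen
        (does_push_option (.vals 2) _ _)))
    have hrest := ih _ hlt (f ∘ transition d (S.vals 0).head? (S.vals 1).head? (S.vals 2).head?)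
      { S with vals := fun j => advance d (S.vals j) } rfl
    simp only [Function.comp_apply] at hrest
    rw [transition_vec _ _ _ _ (rests_lt _) (rests_lt _) (rests_lt _), ← rests_advance h0.1,
      ← rests_advance (h0.2.1.trans h1.1), ← rests_advance (h0.2.1.trans h1.2.1)] at hrest
    refine Does.congr (Does.iter_next (hpop _ _ 4 _ ?_) hrest) rfl (by omega)
    rw [hl]
    exact hpush.andThen (Does.pure _)

/-! ## Enumeration of the words of a certain length -/

/-- A numbering of the digits. -/
noncomputable def digitEquiv (i : ℕ) : Dig i ≃ Fin (i + 2) :=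
  Fintype.equivFinOfCardEq (by simp [Dig, add_comm])

/-- The digit number `0`. -/
noncomputable def firstDigit (i : ℕ) : Dig i := (digitEquiv i).symm 0

/-- The number of a word, when the digits are read as digits in base `i + 2`. -/
noncomputable def wordNumber (w : List (Dig i)) : ℕ :=
  Nat.ofDigits (i + 2) (w.map fun d => (digitEquiv i d : ℕ))

theorem lt_of_mem_map_digitEquiv {w : List (Dig i)} {m : ℕ}
    (h : m ∈ w.map fun d => (digitEquiv i d : ℕ)) : m < i + 2 := by
  obtain ⟨d, -, rfl⟩ := List.mem_map.1 h
  exact Fin.is_lt _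

theorem wordNumber_lt (w : List (Dig i)) : wordNumber w < (i + 2) ^ w.length := by
  have := Nat.ofDigits_lt_base_pow_length (b := i + 2) (l := w.map fun d => (digitEquiv i d : ℕ))
    (by omega) fun _ => lt_of_mem_map_digitEquiv
  simpa [wordNumber] using this

theorem wordNumber_injective {w w' : List (Dig i)} (hl : w.length = w'.length)
    (h : wordNumber w = wordNumber w') : w = w' := by
  have := Nat.ofDigits_inj_of_len_eq (b := i + 2) (by omega) (by simpa using hl)
    (fun _ => lt_of_mem_map_digitEquiv) (fun _ => lt_of_mem_map_digitEquiv) h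
  exact (Function.Injective.list_map
    (Fin.val_injective.comp (digitEquiv i).injective)) this

/-- The next digit, if there is one. -/
noncomputable def nextDigit (d : Dig i) : Option (Dig i) :=
  if h : (digitEquiv i d : ℕ) + 1 < i + 2 then some ((digitEquiv i).symm ⟨_, h⟩) else none

/-- The next word of the same length, and whether there is an overflow. -/
noncomputable def nextWord : List (Dig i) → Bool × List (Dig i)
  | [] => (true, [])
  | d :: w => match nextDigit d with
    | some d' => (false, d' :: w)
    | none => ((nextWord w).1, firstDigit i :: (nextWord w).2)

theorem length_nextWord (w : List (Dig i)) : (nextWord w).2.length = w.length := by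
  induction w with
  | nil => rfl
  | cons d w ih =>
    rw [nextWord]
    split <;> simp [ih]

/-- This is an odometer with carries. The numbering takes the first digit as the least significant
one, opposite to its role in the ordinal; only the completeness of the enumeration matters. -/
theorem wordNumber_nextWord (w : List (Dig i)) :
    (nextWord w).1 = false ∧ wordNumber (nextWord w).2 = wordNumber w + 1 ∨
      (nextWord w).1 = true ∧ wordNumber w + 1 = (i + 2) ^ w.length := by
  induction w with
  | nil => simp [nextWord, wordNumber]
  | cons d w ih =>
    have hc : ∀ (d : Dig i) w, wordNumber (d :: w) = digitEquiv i d + (i + 2) * wordNumber w :=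
      fun d w => by simp [wordNumber, Nat.ofDigits_cons]
    rw [nextWord, hc, List.length_cons]
    unfold nextDigit
    by_cases h : (digitEquiv i d : ℕ) + 1 < i + 2
    · rw [dif_pos h]
      left
      refine ⟨rfl, ?_⟩
      rw [hc, Equiv.apply_symm_apply]
      dsimp only
      omega
    · rw [dif_neg h]
      have hd := (digitEquiv i d).2
      rcases ih with ⟨h₁, h₂⟩ | ⟨h₁, h₂⟩
      · left
        refine ⟨h₁, ?_⟩
        rw [hc, h₂, firstDigit, Equiv.apply_symm_apply]
        simp only [Fin.val_zero]
        ring_nf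
        ring_nf at h
        omega
      · right
        refine ⟨h₁, ?_⟩
        rw [pow_succ, ← h₂]
        ring_nf
        ring_nf at h
        omega

end OrdinalAddition

/-! ## Handling of quantifiers -/

namespace OrdinalAddition

open StackProgram Prog

variable {i : ℕ}

/-- Whether a symbol is the mark at the end of the name of a variable. -/
def ESym.isHash : ESym i → Bool
  | .hash => true
  | _ => false

/-- A step of `carry`. -/
noncomputable def carryStep : Option (ESym i) → Program i (Unit ⊕ Bool)
  | some (.dig d) => match nextDigit d with
    | some d' => (push Stk.env (.dig d')).andThen (Prog.pure (Sum.inr false))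
    | none => (push Stk.env2 (.dig (firstDigit i))).andThen (Prog.pure (Sum.inl ()))
  | some e => (push Stk.env e).andThen (Prog.pure (Sum.inr true))
  | none => Prog.pure (Sum.inr true)

/-- The main part of `increment`. -/
noncomputable def carry : Program i Bool :=
  iter (fun _ : Unit => (pop .env).next carryStep) ()

/-- Replace the word of the latest entry of the environment by the next one. -/
noncomputable def increment : Program i Bool :=
  (copy .env .env2 .a ESym.isHash some fun _ => none).andThen (carry.next fun r =>
    (move .env2 .env id).andThen (Prog.pure r))

theorem does_carry (w : List (Dig i)) {E : List (ESym i)} {S : Store i}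
    (hS : S.env = w.map ESym.dig ++ ESym.dol :: E) :
    ∃ w₁ w₂ : List (Dig i), (nextWord w).2 = w₁ ++ w₂ ∧
      Does carry S (nextWord w).1 { S with
        env := w₂.map ESym.dig ++ ESym.dol :: E
        env2 := (w₁.map ESym.dig).reverse ++ S.env2 } (3 * w.length + 3) := by
  induction w generalizing S with
  | nil =>
    refine ⟨[], [], rfl, Does.congr (Does.iter_stop ((Does.pop_cons (k := .env) (a := ESym.dol)
      (l := E) hS).next ((Does.push .env ESym.dol).andThen (Does.pure _)))) ?_ le_rfl⟩
    rfl
  | cons d w ih =>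
    have hS' : S.get .env = ESym.dig d :: (w.map ESym.dig ++ ESym.dol :: E) := hS
    cases h : nextDigit d with
    | some d' =>
      refine ⟨[], d' :: w, by rw [nextWord, h]; rfl, ?_⟩
      rw [show (nextWord (d :: w)).1 = false by rw [nextWord, h]]
      refine Does.congr (Does.iter_stop ((Does.pop_cons hS').next (t₂ := 2) ?_))
        (S₁ := { S with env := ESym.dig d' :: (w.map ESym.dig ++ ESym.dol :: E) }) rfl (by omega)
      simp only [carryStep, h]
      exact (Does.push .env (ESym.dig d')).andThen (Does.pure _)
    | none =>
      obtain ⟨w₁, w₂, hw, h'⟩ := ih (S := { S with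
        env := w.map ESym.dig ++ ESym.dol :: E
        env2 := ESym.dig (firstDigit i) :: S.env2 }) rfl
      refine ⟨firstDigit i :: w₁, w₂, by rw [nextWord, h, List.cons_append, ← hw], ?_⟩
      rw [show (nextWord (d :: w)).1 = (nextWord w).1 by rw [nextWord, h]]
      refine Does.congr (Does.iter_next ((Does.pop_cons hS').next (t₂ := 2) ?_) h') ?_ ?_
      · simp only [carryStep, h]
        exact (Does.push .env2 (ESym.dig (firstDigit i))).andThen (Does.pure _)
      · simp
      · simp only [List.length_cons]
        omega

theorem does_increment (x : ℕ) (w : List (Dig i)) {E : List (ESym i)} {S : Store i}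
    (hS : S.env = entryCode (x, w) ++ E) (henv : S.env2 = []) :
    Does increment S (nextWord w).1 { S with env := entryCode (x, (nextWord w).2) ++ E }
      (12 * (entryCode (x, w)).length + 12) := by
  have h₁ : Does (copy .env .env2 .a ESym.isHash some fun _ => none) S () { S with
      env := w.map ESym.dig ++ ESym.dol :: E
      env2 := ESym.hash :: ((Nat.bits x).map ESym.nm).reverse }
      (4 * (Nat.bits x).length + 4) := by
    refine Does.congr (does_copy_stop (k := .env) (k₁ := .env2) (k₂ := .a) (S := S)
      (l := (Nat.bits x).map ESym.nm) (e := ESym.hash) (rest := w.map ESym.dig ++ ESym.dol :: E)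
      (by decide) (by decide) (by decide) ?_ rfl ?_) ?_ ?_
    · simp only [List.mem_map]
      rintro _ ⟨b, -, rfl⟩
      rfl
    · change S.env = _
      rw [hS, entryCode]
      simp
    · change ({ S with
        env := w.map ESym.dig ++ ESym.dol :: E
        env2 := (((Nat.bits x).map ESym.nm ++ [ESym.hash]).filterMap some).reverse ++ S.env2
        a := (((Nat.bits x).map ESym.nm ++ [ESym.hash]).filterMap fun _ => none).reverse ++ S.a } :
          Store i) = _
      rw [henv]
      simp
    · simp
  obtain ⟨w₁, w₂, hw, h₂⟩ := does_carry w (E := E) (S := { S with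
      env := w.map ESym.dig ++ ESym.dol :: E
      env2 := ESym.hash :: ((Nat.bits x).map ESym.nm).reverse }) rfl
  have hlen := congrArg List.length hw
  rw [length_nextWord, List.length_append] at hlen
  refine Does.congr (h₁.andThen (h₂.next ((does_move (k := .env2) (k' := .env) (by decide) id
    _).andThen (Does.pure _)))) ?_ ?_
  · change ({ S with
      env2 := []
      env := (((w₁.map ESym.dig).reverse ++
        ESym.hash :: ((Nat.bits x).map ESym.nm).reverse).map id).reverse ++
          (w₂.map ESym.dig ++ ESym.dol :: E) } : Store i) = _
    rw [entryCode, hw, henv]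
    simp
  · change 4 * (Nat.bits x).length + 4 + (3 * w.length + 3 +
      (3 * ((w₁.map ESym.dig).reverse ++
        ESym.hash :: ((Nat.bits x).map ESym.nm).reverse).length + 2 + 1)) ≤ _
    rw [length_entryCode]
    simp
    omega

/-- Add an entry to the environment: its name is on the stack `name`, the length of the word is on
the stack `a`. -/
noncomputable def newEntry : Program i Unit :=
  (push .env .dol).andThen ((drain .a fun _ => push .env (.dig (firstDigit i))).andThen
    ((push .env .hash).andThen (move .name .env ESym.nm)))

theorem does_new_entry (x n : ℕ) {S : Store i} (hname : S.name = (Nat.bits x).reverse)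
    (ha : S.a = List.replicate n ()) :
    Does newEntry S () { S with
      env := entryCode (x, List.replicate n (firstDigit i)) ++ S.env
      name := []
      a := [] } (3 * n + 3 * (Nat.bits x).length + 6) := by
  have aux : ∀ (n : ℕ) (S : Store i), S.a = List.replicate n () →
      Does (drain .a fun _ => push .env (.dig (firstDigit i))) S ()
        { S with a := [], env := List.replicate n (.dig (firstDigit i)) ++ S.env } (3 * n + 2) := by
    intro n
    induction n with
    | zero =>
      intro S ha
      refine Does.congr (Does.drain_nil ha) ?_ (by omega)
      rw [← show S.a = [] from ha]
      rfl
    | succ n ih =>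
      intro S ha
      refine Does.congr (Does.drain_cons (a := ()) (l := List.replicate n ()) ha
        (Does.push .env (.dig (firstDigit i))) (ih _ rfl)) ?_ (by omega)
      change ({ S with
        a := []
        env := List.replicate n (.dig (firstDigit i)) ++ .dig (firstDigit i) :: S.env } :
          Store i) = _
      rw [List.replicate_succ', List.append_assoc]
      rfl
  refine Does.congr ((Does.push .env ESym.dol).andThen
    ((aux n (S.set .env (.dol :: S.env)) ha).andThen ((Does.push .env ESym.hash).andThen
      (does_move (k := .name) (k' := .env) (by decide) ESym.nm _)))) ?_ ?_
  · change ({ S with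
      a := []
      name := []
      env := (S.name.map ESym.nm).reverse ++ .hash ::
        (List.replicate n (.dig (firstDigit i)) ++ .dol :: S.env) } : Store i) = _
    rw [hname, entryCode]
    simp
  · change 1 + (3 * n + 2 + (1 + (3 * S.name.length + 2))) ≤ _
    rw [hname, List.length_reverse]
    omega

/-- Write the length of the word of the latest entry to the stack `b`. -/
def measure : Program i Unit :=
  (copy .env .env2 .b ESym.isDol some fun e => (ESym.digit? e).map fun _ => ()).andThen
    (move .env2 .env id)

theorem filterMap_entryCode (x : ℕ) (w : List (Dig i)) :
    (entryCode (x, w)).filterMap (fun e => (ESym.digit? e).map fun _ => ()) =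
      List.replicate w.length () := by
  have h₁ : ∀ (u : List Bool) (l : List (ESym i)), (u.map ESym.nm ++ ESym.hash :: l).filterMap
      (fun e => (ESym.digit? e).map fun _ => ()) =
        l.filterMap fun e => (ESym.digit? e).map fun _ => () := by
    intro u l
    induction u with
    | nil => rfl
    | cons b u ih => exact ih
  rw [entryCode, h₁]
  induction w with
  | nil => rfl
  | cons d w ih => exact congrArg (List.cons ()) ih

theorem does_measure (x : ℕ) (w : List (Dig i)) {E : List (ESym i)} {S : Store i}
    (hS : S.env = entryCode (x, w) ++ E) (henv : S.env2 = []) (hb : S.b = []) :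
    Does measure S () { S with b := List.replicate w.length () }
      (7 * (entryCode (x, w)).length + 7) := by
  have h₁ : Does (copy .env .env2 .b ESym.isDol some
      fun e => (ESym.digit? e).map fun _ => ()) S () { S with
      env := E
      env2 := (entryCode (x, w)).reverse
      b := List.replicate w.length () }
      (4 * (entryCode (x, w)).length + 4) := by
    refine Does.congr (does_copy_stop (k := .env) (k₁ := .env2) (k₂ := .b) (S := S)
      (l := (Nat.bits x).map ESym.nm ++ ESym.hash :: w.map ESym.dig) (e := ESym.dol) (rest := E)
      (by decide) (by decide) (by decide) ?_ rfl ?_) ?_ ?_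
    · simp only [List.mem_append, List.mem_cons, List.mem_map]
      rintro _ (⟨b, -, rfl⟩ | rfl | ⟨d, -, rfl⟩) <;> rfl
    · change S.env = _
      rw [hS, entryCode]
      simp
    · have e : (Nat.bits x).map ESym.nm ++ ESym.hash :: w.map ESym.dig ++ [ESym.dol] =
          entryCode (x, w) := by
        rw [entryCode]
        simp
      rw [e]
      change ({ S with
        env := E
        env2 := ((entryCode (x, w)).filterMap some).reverse ++ S.env2
        b := ((entryCode (x, w)).filterMap
          fun e => (ESym.digit? e).map fun _ => ()).reverse ++ S.b } : Store i) = _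
      rw [henv, hb, filterMap_entryCode]
      simp
    · rw [length_entryCode]
      simp
      omega
  refine Does.congr (h₁.andThen (does_move (k := .env2) (k' := .env) (by decide) id _)) ?_ ?_
  · change ({ S with
      env2 := []
      env := ((entryCode (x, w)).reverse.map id).reverse ++ E
      b := List.replicate w.length () } : Store i) = _
    rw [hS, henv]
    simp
  · change 4 * (entryCode (x, w)).length + 4 +
      (3 * (entryCode (x, w)).reverse.length + 2) ≤ _
    rw [List.length_reverse, length_entryCode]
    simp
    omega

end OrdinalAddition

/-! ## The evaluation of formulas -/

namespace OrdinalAddition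

open StackProgram Prog

variable {i : ℕ}

/-- The stacks of the evaluation between two of its steps. -/
def mainStore (R : List Letter) (C : List CSym) (E : List (ESym i)) : Store i :=
  { text := R, ctrl := C, env := E }

/-- Read a variable from `text`, and add to the environment an entry for it with the first word of
its length. -/
noncomputable def enter : Program i Unit :=
  (pop .text).next fun _ => readName.andThen (measure.andThen ((push .a ()).andThen
    ((multiplyPow (2 * (i + 1))).andThen ((clear .b).andThen newEntry))))

/-- The latest entry `p` carries the current length. Its power `2 * (i + 1)` is the length over
which `Formula.eval` quantifies, and the new entry starts the enumeration with the word number 0. -/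
theorem does_enter (x : ℕ) (p : ℕ × List (Dig i)) {R : List Letter} (hR : NoDigit R)
    (C : List CSym) (E : List (ESym i)) (hp : 0 < p.2.length) :
    Does enter (mainStore (writeVar x ++ R) C (entryCode p ++ E)) ()
      (mainStore R C (entryCode (x, List.replicate (p.2.length ^ (2 * (i + 1))) (firstDigit i)) ++
        (entryCode p ++ E)))
      (6 * (Nat.bits x).length + 10 * (entryCode p).length +
        (40 * (i + 1) + 3) * (p.2.length ^ (2 * (i + 1)) + 1) + 25) := by
  obtain ⟨y, w⟩ := p
  have h₀ : (mainStore (writeVar x ++ R) C (entryCode (y, w) ++ E)).get .text =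
    Letter.var :: ((Nat.bits x).map Letter.digit ++ R) := rfl
  have h₁ : Does readName ((mainStore (writeVar x ++ R) C (entryCode (y, w) ++ E)).set .text
      ((Nat.bits x).map Letter.digit ++ R)) ()
      { mainStore R C (entryCode (y, w) ++ E) with name := (Nat.bits x).reverse }
      (3 * (Nat.bits x).length + 3) :=
    Does.congr (does_read_name (u := Nat.bits x) (R := R) rfl hR)
      (by change ({ text := R, ctrl := C, env := entryCode (y, w) ++ E
                    name := (Nat.bits x).reverse ++ [] } : Store i) = _
          rw [List.append_nil]
          rfl) le_rfl
  have h₂ := does_measure (S := { mainStore R C (entryCode (y, w) ++ E) with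
    name := (Nat.bits x).reverse }) y w (E := E) rfl rfl rfl
  have h₃ := does_multiply_pow (2 * (i + 1)) (m := 1) (n := w.length)
    (S := { mainStore R C (entryCode (y, w) ++ E) with
      name := (Nat.bits x).reverse, b := List.replicate w.length (), a := [()] }) rfl rfl rfl rfl hp
  rw [one_mul] at h₃
  refine Does.congr ((Does.pop_cons h₀).next (h₁.andThen (h₂.andThen ((Does.push .a ()).andThen
    (h₃.andThen ((does_clear .b _).andThen
      (does_new_entry x (w.length ^ (2 * (i + 1))) rfl rfl))))))) rfl ?_
  change 1 + (3 * (Nat.bits x).length + 3 + (7 * (entryCode (y, w)).length + 7 + (1 +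
    (20 * (2 * (i + 1)) * (w.length ^ (2 * (i + 1)) + 1) + 1 +
      ((3 * (List.replicate w.length ()).length + 2) +
        (3 * w.length ^ (2 * (i + 1)) + 3 * (Nat.bits x).length + 6)))))) ≤
    6 * (Nat.bits x).length + 10 * (entryCode (y, w)).length +
        (40 * (i + 1) + 3) * (w.length ^ (2 * (i + 1)) + 1) + 25
  rw [List.length_replicate, length_entryCode]
  dsimp only
  rw [add_mul (40 * (i + 1)) 3, show 20 * (2 * (i + 1)) = 40 * (i + 1) by ring]
  omega

/-- Push the text, which is on the stack `text2` in reverse order, to the stacks `text` and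
`ctrl`. -/
def saveText : Program i Unit :=
  (push .ctrl .base).andThen
    ((copy .text2 .ctrl .text (fun _ => false) (fun l => some (.txt l)) some).andThen
      (push .ctrl .ex))

theorem does_save_text (T : List Letter) (C : List CSym) (E : List (ESym i)) :
    Does saveText ({ text2 := T.reverse, ctrl := C, env := E } : Store i) ()
      (mainStore T (.ex :: (T.map .txt ++ .base :: C)) E) (4 * T.length + 4) := by
  refine Does.congr ((Does.push .ctrl CSym.base).andThen ((does_copy_all (k := .text2)
    (k₁ := .ctrl) (k₂ := .text) (by decide) (by decide) (by decide) _).andThen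
      (Does.push .ctrl CSym.ex))) ?_ ?_
  · change ({
      text := (T.reverse.filterMap some).reverse ++ []
      ctrl := .ex :: ((T.reverse.filterMap fun l => some (.txt l)).reverse ++ .base :: C)
      env := E } : Store i) = _
    have e : (T.reverse.filterMap fun l => some (CSym.txt l)) = T.reverse.map .txt :=
      congrFun (List.filterMap_eq_map (f := CSym.txt)) _
    rw [e]
    simp [mainStore]
  · change 1 + (4 * T.reverse.length + 2 + 1) ≤ _
    rw [List.length_reverse]
    omega

/-- Save the text on the stack `ctrl`. -/
def beginScope : Program i Unit := (move .text .text2 id).andThen saveText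

theorem does_begin_scope (T : List Letter) (C : List CSym) (E : List (ESym i)) :
    Does beginScope (mainStore T C E) () (mainStore T (.ex :: (T.map .txt ++ .base :: C)) E)
      (7 * T.length + 6) := by
  have h : Does (move .text .text2 id) (mainStore T C E) ()
      ({ text2 := T.reverse, ctrl := C, env := E } : Store i) (3 * T.length + 2) := by
    refine Does.congr (does_move (k := .text) (k' := .text2) (by decide) id _) ?_ le_rfl
    change ({ text2 := (T.map id).reverse ++ [], ctrl := C, env := E } : Store i) = _
    simp
  exact (h.andThen (does_save_text T C E)).mono (by omega)

/-- Whether a symbol is the mark at the end of a frame. -/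
def CSym.isBase : CSym → Bool
  | .base => true
  | _ => false

/-- The letter in a frame. -/
def CSym.letter? : CSym → Option Letter
  | .txt l => some l
  | _ => none

/-- Replace the text by the one that was saved. -/
def repeatScope : Program i Unit :=
  (clear .text).andThen ((copy .ctrl .text2 .a CSym.isBase CSym.letter? fun _ => none).andThen
    saveText)

/-- Reading the saved text destroys it, so it is collected on `text2` and saved again while it is
restored. -/
theorem does_repeat_scope (R T : List Letter) (C : List CSym) (E : List (ESym i)) :
    Does repeatScope (mainStore R (T.map .txt ++ .base :: C) E) ()
      (mainStore T (.ex :: (T.map .txt ++ .base :: C)) E) (3 * R.length + 8 * T.length + 10) := by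
  have h : Does (copy .ctrl .text2 .a CSym.isBase CSym.letter? fun _ => none)
      (mainStore [] (T.map .txt ++ .base :: C) E) ()
      ({ text2 := T.reverse, ctrl := C, env := E } : Store i) (4 * T.length + 4) := by
    refine Does.congr (does_copy_stop (k := .ctrl) (k₁ := .text2) (k₂ := .a) (l := T.map .txt)
      (e := CSym.base) (rest := C) (by decide) (by decide) (by decide) ?_ rfl rfl) ?_ (by simp)
    · simp only [List.mem_map]
      rintro _ ⟨l, -, rfl⟩
      rfl
    · change ({
        text2 := ((T.map CSym.txt ++ [CSym.base]).filterMap CSym.letter?).reverse ++ []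
        a := ((T.map CSym.txt ++ [CSym.base]).filterMap fun _ => none).reverse ++ []
        ctrl := C
        env := E } : Store i) = _
      have e : (T.map CSym.txt ++ [CSym.base]).filterMap CSym.letter? = T := by
        rw [List.filterMap_append, List.filterMap_map]
        change T.filterMap some ++ [] = T
        simp
      rw [e]
      simp
  refine Does.mono ((does_clear .text _).andThen (h.andThen (does_save_text T C E))) ?_
  change 3 * R.length + 2 + _ ≤ _
  omega

theorem does_skip {k : Stk} {ends : Alph i k → Bool} {S : Store i} {l rest : List (Alph i k)}
    {e : Alph i k} (hl : ∀ e ∈ l, ends e = false) (he : ends e = true)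
    (hS : S.get k = l ++ e :: rest) :
    Does (scan k ends fun _ => Prog.pure ()) S () (S.set k rest) (3 * l.length + 3) := by
  induction l generalizing S with
  | nil => exact Does.scan_stop hS he (Does.pure ())
  | cons d l ih =>
    refine Does.congr (Does.scan_cons hS (hl d List.mem_cons_self) (Does.pure ())
      (ih (fun e he => hl e (List.mem_cons_of_mem _ he)) (S.get_set_self k _))) ?_ ?_
    · rw [Store.set_set]
    · simp only [List.length_cons]
      omega

/-- Remove the saved text and the latest entry of the environment. -/
def leave : Program i Unit :=
  (scan .ctrl CSym.isBase fun _ => Prog.pure ()).andThen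
    (scan .env ESym.isDol fun _ => Prog.pure ())

theorem does_leave (R T : List Letter) (C : List CSym) (p : ℕ × List (Dig i)) (E : List (ESym i)) :
    Does leave (mainStore R (T.map .txt ++ .base :: C) (entryCode p ++ E)) () (mainStore R C E)
      (3 * T.length + 3 * (entryCode p).length + 6) := by
  have e : entryCode p ++ E =
      ((Nat.bits p.1).map ESym.nm ++ ESym.hash :: p.2.map ESym.dig) ++ ESym.dol :: E := by
    rw [entryCode]
    simp
  rw [e]
  refine Does.congr ((does_skip (k := .ctrl) (l := T.map .txt) (e := CSym.base) (rest := C)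
    ?_ rfl rfl).andThen (does_skip (k := .env)
      (l := (Nat.bits p.1).map ESym.nm ++ ESym.hash :: p.2.map ESym.dig) (e := ESym.dol)
      (rest := E) ?_ rfl rfl)) rfl ?_
  · simp only [List.mem_map]
    rintro _ ⟨l, -, rfl⟩
    rfl
  · simp only [List.mem_append, List.mem_cons, List.mem_map]
    rintro _ (⟨b, -, rfl⟩ | rfl | ⟨d, -, rfl⟩) <;> rfl
  · rw [length_entryCode]
    simp
    omega

/-- The modes of the evaluation: either the text is to be evaluated, or a value was found. -/
inductive Mode : Type
  | eval
  | ret (b : Bool)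

instance : Finite Mode := by
  refine Finite.of_surjective (fun o : Option Bool => match o with
    | none => Mode.eval
    | some b => Mode.ret b) fun m => ?_
  cases m with
  | eval => exact ⟨none, rfl⟩
  | ret b => exact ⟨some b, rfl⟩

/-- Read a letter. -/
noncomputable def evalStep : Option Letter → Program i (Mode ⊕ Bool)
  | some .plus => (lookup 0).andThen ((lookup 1).andThen ((lookup 2).andThen
      ((merge id).next fun b => Prog.pure (Sum.inl (.ret b)))))
  | some .neg => (push Stk.ctrl (.snd not)).andThen (Prog.pure (Sum.inl .eval))
  | some .conj => (push Stk.ctrl (.fst and)).andThen (Prog.pure (Sum.inl .eval))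
  | some .disj => (push Stk.ctrl (.fst or)).andThen (Prog.pure (Sum.inl .eval))
  | some .imp => (push Stk.ctrl (.fst fun a b => !a || b)).andThen (Prog.pure (Sum.inl .eval))
  | some .iff => (push Stk.ctrl (.fst fun a b => a == b)).andThen (Prog.pure (Sum.inl .eval))
  | some .ex => enter.andThen (beginScope.andThen (Prog.pure (Sum.inl .eval)))
  | _ => Prog.pure (Sum.inr false)

/-- Use a value. -/
noncomputable def retStep (b : Bool) : Option CSym → Program i (Mode ⊕ Bool)
  | none => Prog.pure (Sum.inr b)
  | some (.fst g) => (push Stk.ctrl (.snd (g b))).andThen (Prog.pure (Sum.inl .eval))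
  | some (.snd h) => Prog.pure (Sum.inl (.ret (h b)))
  | some .ex => if b then leave.andThen (Prog.pure (Sum.inl (.ret true))) else
      increment.next fun o => if o then leave.andThen (Prog.pure (Sum.inl (.ret false)))
        else repeatScope.andThen (Prog.pure (Sum.inl .eval))
  | _ => Prog.pure (Sum.inr false)

/-- Evaluate the text. -/
noncomputable def evaluate : Mode → Program i Bool :=
  iter fun m => match m with
    | .eval => (pop Stk.text).next evalStep
    | .ret b => (pop Stk.ctrl).next (retStep b)

end OrdinalAddition

/-! ### Correctness and cost of the evaluation. -/

namespace OrdinalAddition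

open StackProgram Prog

variable {i : ℕ}

theorem evaluate_eval {S₁ S' : Store i} {l : Letter} {T : List Letter} {C : List CSym}
    {E : List (ESym i)} {m : Mode} {b : Bool} {t₁ t₂ : ℕ}
    (h₁ : Does (evalStep (some l)) (mainStore T C E) (Sum.inl m) S₁ t₁)
    (h₂ : Does (evaluate m) S₁ b S' t₂) :
    Does (evaluate .eval) (mainStore (l :: T) C E) b S' (1 + t₁ + t₂) :=
  Does.iter_next ((Does.pop_cons (k := .text) rfl).next h₁) h₂

theorem evaluate_ret {S₁ S' : Store i} {c : CSym} {T : List Letter} {C : List CSym}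
    {E : List (ESym i)} {m : Mode} {r b : Bool} {t₁ t₂ : ℕ}
    (h₁ : Does (retStep r (some c)) (mainStore T C E) (Sum.inl m) S₁ t₁)
    (h₂ : Does (evaluate m) S₁ b S' t₂) :
    Does (evaluate (.ret r)) (mainStore T (c :: C) E) b S' (1 + t₁ + t₂) :=
  Does.iter_next ((Does.pop_cons (k := .ctrl) rfl).next h₁) h₂

theorem does_ret_ex_true (R T : List Letter) (C : List CSym) (p : ℕ × List (Dig i)) (ρ : Env i) :
    Does (retStep true (some .ex)) (mainStore R (T.map .txt ++ .base :: C) (Env.code (p :: ρ)))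
      (Sum.inl (.ret true)) (mainStore R C (Env.code ρ))
      (3 * T.length + 3 * (entryCode p).length + 7) :=
  (does_leave R T C p (Env.code ρ)).andThen (Does.pure _)

theorem does_increment_mainStore (R : List Letter) (C : List CSym) (x : ℕ) (w : List (Dig i))
    (ρ : Env i) : Does increment (mainStore R C (Env.code ((x, w) :: ρ))) (nextWord w).1
      (mainStore R C (Env.code ((x, (nextWord w).2) :: ρ)))
      (12 * (entryCode (x, w)).length + 12) :=
  does_increment x w rfl rfl

theorem does_ret_ex_overflow (R T : List Letter) (C : List CSym) (x : ℕ) {w : List (Dig i)}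
    (ρ : Env i) (hw : (nextWord w).1 = true) :
    Does (retStep false (some .ex)) (mainStore R (T.map .txt ++ .base :: C)
      (Env.code ((x, w) :: ρ))) (Sum.inl (.ret false)) (mainStore R C (Env.code ρ))
      (3 * T.length + 15 * (entryCode (x, w)).length + 19) := by
  have hi := does_increment_mainStore R (T.map .txt ++ .base :: C) x w ρ
  rw [hw] at hi
  refine Does.mono (hi.next ((does_leave R T C (x, (nextWord w).2) (Env.code ρ)).andThen
    (Does.pure _))) ?_
  rw [length_entryCode, length_entryCode, length_nextWord]
  dsimp only
  omega

theorem does_ret_ex_next (R T : List Letter) (C : List CSym) (x : ℕ) {w : List (Dig i)}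
    (ρ : Env i) (hw : (nextWord w).1 = false) :
    Does (retStep false (some .ex)) (mainStore R (T.map .txt ++ .base :: C)
      (Env.code ((x, w) :: ρ))) (Sum.inl .eval)
      (mainStore T (.ex :: (T.map .txt ++ .base :: C)) (Env.code ((x, (nextWord w).2) :: ρ)))
      (3 * R.length + 8 * T.length + 12 * (entryCode (x, w)).length + 23) := by
  have hi := does_increment_mainStore R (T.map .txt ++ .base :: C) x w ρ
  rw [hw] at hi
  exact Does.mono (hi.next ((does_repeat_scope R T C _).andThen (Does.pure _))) (by omega)

theorem does_plus (x y z : ℕ) (ρ : Env i) {R : List Letter} (hR : NoDigit R) (C : List CSym) :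
    Does (evalStep (some .plus)) (mainStore (writeVar x ++ (writeVar y ++ (writeVar z ++ R))) C
      (Env.code ρ)) (Sum.inl (.ret ((Formula.plus x y z).eval ρ))) (mainStore R C (Env.code ρ))
      (90 * (Env.code ρ).length +
        9 * ((Nat.bits x).length + (Nat.bits y).length + (Nat.bits z).length) + 95) := by
  have h₀ := does_lookup 0 x ρ (S := mainStore (writeVar x ++ (writeVar y ++ (writeVar z ++ R))) C
      (Env.code ρ)) rfl (noDigit_writeVar y _) rfl rfl rfl rfl rfl
  obtain ⟨v₀, hv₀⟩ : ∃ v : Fin 3 → List (Dig i),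
    v = Function.update (fun _ => []) 0 (ρ.word x).reverse := ⟨_, rfl⟩
  obtain ⟨v₁, hv₁⟩ : ∃ v, v = Function.update v₀ 1 (ρ.word y).reverse := ⟨_, rfl⟩
  obtain ⟨v₂, hv₂⟩ : ∃ v, v = Function.update v₁ 2 (ρ.word z).reverse := ⟨_, rfl⟩
  have h₁ := does_lookup 1 y ρ (S := ({ mainStore (writeVar y ++ (writeVar z ++ R)) C
    (Env.code ρ) with vals := v₀ } : Store i)) rfl (noDigit_writeVar z _) rfl rfl rfl rfl
    (by rw [hv₀]; rfl)
  have h₂ := does_lookup 2 z ρ (S := ({ mainStore (writeVar z ++ R) C (Env.code ρ) with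
    vals := v₁ } : Store i)) rfl hR rfl rfl rfl rfl (by rw [hv₁, hv₀]; rfl)
  have h₃ := does_merge id ({ mainStore R C (Env.code ρ) with vals := v₂ } : Store i)
  subst hv₂ hv₁ hv₀
  change Does _ _ (accepts (vec (rests (ρ.word x).reverse) (rests (ρ.word y).reverse)
    (rests (ρ.word z).reverse))) (mainStore R C (Env.code ρ)) (7 * ((ρ.word x).reverse.length +
      (ρ.word y).reverse.length + (ρ.word z).reverse.length) + 4) at h₃
  rw [accepts_vec] at h₃
  refine Does.mono (h₀.andThen (h₁.andThen (h₂.andThen (h₃.next (Does.pure _))))) ?_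
  have e₁ := ρ.length_word_le x
  have e₂ := ρ.length_word_le y
  have e₃ := ρ.length_word_le z
  simp only [List.length_reverse]
  omega

/-- A bound for the number of steps of the evaluation. -/
def Formula.cost (i : ℕ) : Formula → ℕ → ℕ
  | plus _ _ _, s => 300 * s
  | neg φ, s => φ.cost i s + 10
  | conj φ ψ, s => φ.cost i s + ψ.cost i s + 10
  | disj φ ψ, s => φ.cost i s + ψ.cost i s + 10
  | imp φ ψ, s => φ.cost i s + ψ.cost i s + 10
  | iff φ ψ, s => φ.cost i s + ψ.cost i s + 10
  | ex _ φ, s => (i + 2) ^ s ^ (2 * i + 3) * (φ.cost i (s ^ (2 * i + 3)) + 50 * s ^ (2 * i + 3)) +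
      (40 * i + 200) * s ^ (2 * i + 3)

theorem noDigit_write (φ : Formula) (R : List Letter) : NoDigit (φ.write ++ R) := by
  intro b R' h
  cases φ <;> simp [Formula.write] at h

/-- The frame saves the whole remaining text, not only the scope, so the end of the scope need not
be located: once the scope has a value, the text that is left is `R`, where the evaluation continues
after the loop. The invariant is that the words from `w` on remain to be tried, of which there are
at most `k`. `K` is the cost of the scope and `50 * D` covers the handling of the entry and the
texts. -/
theorem does_loop (φ : Formula) (x n : ℕ) (ρ : Env i) (R : List Letter) (C : List CSym) {D K : ℕ}
    (hD : (Nat.bits x).length + n + 2 + (φ.write ++ R).length ≤ D)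
    {b : Bool} {S' : Store i} {t : ℕ}
    (hφ : ∀ w : List (Dig i), w.length = n → ∀ (C : List CSym) (t : ℕ),
      Does (evaluate (.ret (φ.eval ((x, w) :: ρ)))) (mainStore R C (Env.code ((x, w) :: ρ))) b S'
        t →
      Does (evaluate .eval) (mainStore (φ.write ++ R) C (Env.code ((x, w) :: ρ))) b S' (K + t))
    (k : ℕ) (w : List (Dig i)) (hw : w.length = n)
    (hk : (i + 2) ^ n ≤ wordNumber w + k) (h : Does (evaluate (.ret (open Classical in decide
      (∃ w' : List (Dig i), w'.length = n ∧ wordNumber w ≤ wordNumber w' ∧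
        φ.eval ((x, w') :: ρ) = true)))) (mainStore R C (Env.code ρ)) b S' t) :
    Does (evaluate .eval) (mainStore (φ.write ++ R) (.ex :: ((φ.write ++ R).map .txt ++ .base :: C))
      (Env.code ((x, w) :: ρ))) b S' (k * (K + 50 * D) + t) := by
  classical
  have hD' : (φ.write ++ R).length = φ.write.length + R.length := List.length_append
  induction k generalizing w with
  | zero =>
    -- With no words left, the number of `w` would be at least `(i + 2) ^ n`.
    have := wordNumber_lt w
    rw [hw] at this
    omega
  | succ k ih =>
    have hl : (entryCode (x, w)).length = (Nat.bits x).length + n + 2 := by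
      rw [length_entryCode, hw]
    have hkK : (k + 1) * (K + 50 * D) = k * (K + 50 * D) + (K + 50 * D) := by ring
    refine Does.mono (hφ w hw _ (k * (K + 50 * D) + 50 * D + t) ?_) (by omega)
    cases hv : φ.eval ((x, w) :: ρ) with
    | true =>
      rw [decide_eq_true ⟨w, hw, le_rfl, hv⟩] at h
      exact Does.mono (evaluate_ret (does_ret_ex_true R (φ.write ++ R) C (x, w) ρ) h) (by omega)
    | false =>
      rcases wordNumber_nextWord w with ⟨h₁, h₂⟩ | ⟨h₁, h₂⟩
      · refine Does.mono (evaluate_ret (does_ret_ex_next R (φ.write ++ R) C x ρ h₁)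
          (ih (nextWord w).2 ((length_nextWord w).trans hw) (by omega) ?_)) (by omega)
        convert h using 3
        simp only [decide_eq_decide]
        refine exists_congr fun w' => and_congr_right fun hl' => ?_
        -- The word `w` itself has just failed, and no other word of this length has its number, so
        -- nothing is lost by passing to larger numbers.
        refine ⟨fun ⟨hle, he⟩ => ⟨by omega, he⟩, fun ⟨hle, he⟩ => ⟨?_, he⟩⟩
        rw [h₂]
        refine Nat.lt_of_le_of_ne hle fun heq => ?_
        rw [← wordNumber_injective (hw.trans hl'.symm) heq, hv] at he
        cases he
      · have : ¬ ∃ w' : List (Dig i), w'.length = n ∧ wordNumber w ≤ wordNumber w' ∧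
            φ.eval ((x, w') :: ρ) = true := by
          rintro ⟨w', hl', hle, he⟩
          have hlt := wordNumber_lt w'
          rw [hl', ← hw] at hlt
          rw [wordNumber_injective (hl'.trans hw.symm) (by omega), hv] at he
          cases he
        rw [decide_eq_false this] at h
        exact Does.mono (evaluate_ret (does_ret_ex_overflow R (φ.write ++ R) C x ρ h₁) h) (by omega)

end OrdinalAddition

namespace OrdinalAddition

open StackProgram Prog

variable {i : ℕ}

theorem wordNumber_replicate (n : ℕ) :
    wordNumber (List.replicate n (firstDigit i)) = 0 := by
  induction n with
  | zero => rfl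
  | succ n ih =>
    rw [wordNumber] at ih ⊢
    rw [List.replicate_succ, List.map_cons, Nat.ofDigits_cons, ih, firstDigit,
      Equiv.apply_symm_apply]
    simp

/-- The frame `fst g` awaits the first value `b` and is then replaced by `snd (g b)`, which awaits
the second. The hypotheses are needed for every control stack because these frames lie on top of
`C`. -/
theorem does_binary {φ ψ : Formula} {l : Letter} {g : Bool → Bool → Bool} {ρ : Env i}
    {R : List Letter} {C : List CSym} {S' : Store i} {b : Bool} {t K₁ K₂ : ℕ}
    (hl : evalStep (i := i) (some l) =
      (push Stk.ctrl (.fst g)).andThen (Prog.pure (Sum.inl .eval)))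
    (h₁ : ∀ (C : List CSym) (t : ℕ),
      Does (evaluate (.ret (φ.eval ρ))) (mainStore (ψ.write ++ R) C (Env.code ρ)) b S' t →
      Does (evaluate .eval) (mainStore (φ.write ++ (ψ.write ++ R)) C (Env.code ρ)) b S' (K₁ + t))
    (h₂ : ∀ (C : List CSym) (t : ℕ),
      Does (evaluate (.ret (ψ.eval ρ))) (mainStore R C (Env.code ρ)) b S' t →
      Does (evaluate .eval) (mainStore (ψ.write ++ R) C (Env.code ρ)) b S' (K₂ + t))
    (h : Does (evaluate (.ret (g (φ.eval ρ) (ψ.eval ρ)))) (mainStore R C (Env.code ρ)) b S' t) :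
    Does (evaluate .eval) (mainStore (l :: (φ.write ++ ψ.write) ++ R) C (Env.code ρ)) b S'
      (K₁ + K₂ + 10 + t) := by
  rw [List.cons_append, List.append_assoc]
  have e₁ : Does (evalStep (some l)) (mainStore (φ.write ++ (ψ.write ++ R)) C (Env.code ρ))
      (Sum.inl .eval) (mainStore (φ.write ++ (ψ.write ++ R)) (.fst g :: C) (Env.code ρ)) 2 := by
    rw [hl]
    exact (Does.push .ctrl (CSym.fst g)).andThen (Does.pure _)
  have e₂ : Does (retStep (φ.eval ρ) (some (.fst g))) (mainStore (ψ.write ++ R) C (Env.code ρ))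
      (Sum.inl .eval) (mainStore (ψ.write ++ R) (.snd (g (φ.eval ρ)) :: C) (Env.code ρ)) 2 :=
    (Does.push .ctrl (CSym.snd (g (φ.eval ρ)))).andThen (Does.pure _)
  have e₃ : Does (retStep (ψ.eval ρ) (some (.snd (g (φ.eval ρ))))) (mainStore R C (Env.code ρ))
      (Sum.inl (.ret (g (φ.eval ρ) (ψ.eval ρ)))) (mainStore R C (Env.code ρ)) 1 := Does.pure _
  exact (evaluate_eval e₁ (h₁ _ _ (evaluate_ret e₂ (h₂ _ _ (evaluate_ret e₃ h))))).mono (by omega)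

/-- The statement is in continuation form: whatever the machine does with the value of `φ`, the
evaluation of `φ` only adds `φ.cost i s` steps. The parameter `s` bounds environment and text
together. -/
theorem does_eval (φ : Formula) (ρ : Env i) (R : List Letter) (C : List CSym) {s : ℕ}
    (hs : (Env.code ρ).length + (φ.write ++ R).length ≤ s) (h40 : 40 ≤ s) (hρ : 0 < ρ.size)
    (hR : NoDigit R) {b : Bool} {S' : Store i} {t : ℕ}
    (h : Does (evaluate (.ret (φ.eval ρ))) (mainStore R C (Env.code ρ)) b S' t) :
    Does (evaluate .eval) (mainStore (φ.write ++ R) C (Env.code ρ)) b S' (φ.cost i s + t) := by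
  induction φ generalizing ρ R C s t with
  | plus x y z =>
    have e : (Formula.plus x y z).write ++ R =
        .plus :: (writeVar x ++ (writeVar y ++ (writeVar z ++ R))) := by
      simp [Formula.write]
    rw [e] at hs ⊢
    refine Does.mono (evaluate_eval (does_plus x y z ρ hR C) h) ?_
    simp only [writeVar, List.length_cons, List.length_append, List.length_map] at hs
    rw [Formula.cost]
    omega
  | neg φ ih =>
    have e₁ : Does (evalStep (some .neg)) (mainStore (φ.write ++ R) C (Env.code ρ))
        (Sum.inl .eval) (mainStore (φ.write ++ R) (.snd not :: C) (Env.code ρ)) 2 :=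
      (Does.push .ctrl (CSym.snd not)).andThen (Does.pure _)
    have e₂ : Does (retStep (φ.eval ρ) (some (.snd not))) (mainStore R C (Env.code ρ))
        (Sum.inl (.ret (!φ.eval ρ))) (mainStore R C (Env.code ρ)) 1 := Does.pure _
    have hs' : (Env.code ρ).length + (φ.write ++ R).length ≤ s := by
      simp only [Formula.write, List.cons_append, List.length_cons] at hs
      omega
    refine Does.mono (evaluate_eval e₁ (ih ρ R _ hs' h40 hρ hR (evaluate_ret e₂ h))) ?_
    rw [Formula.cost]
    omega
  | conj φ ψ ih₁ ih₂ =>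
    simp only [Formula.write, List.cons_append, List.length_cons, List.length_append] at hs
    exact does_binary rfl
      (fun C t => ih₁ ρ _ C (by simp only [List.length_append]; omega) h40 hρ (noDigit_write ψ R))
      (fun C t => ih₂ ρ R C (by simp only [List.length_append]; omega) h40 hρ hR) h
  | disj φ ψ ih₁ ih₂ =>
    simp only [Formula.write, List.cons_append, List.length_cons, List.length_append] at hs
    exact does_binary rfl
      (fun C t => ih₁ ρ _ C (by simp only [List.length_append]; omega) h40 hρ (noDigit_write ψ R))
      (fun C t => ih₂ ρ R C (by simp only [List.length_append]; omega) h40 hρ hR) h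
  | imp φ ψ ih₁ ih₂ =>
    simp only [Formula.write, List.cons_append, List.length_cons, List.length_append] at hs
    exact does_binary rfl
      (fun C t => ih₁ ρ _ C (by simp only [List.length_append]; omega) h40 hρ (noDigit_write ψ R))
      (fun C t => ih₂ ρ R C (by simp only [List.length_append]; omega) h40 hρ hR) h
  | iff φ ψ ih₁ ih₂ =>
    simp only [Formula.write, List.cons_append, List.length_cons, List.length_append] at hs
    exact does_binary rfl
      (fun C t => ih₁ ρ _ C (by simp only [List.length_append]; omega) h40 hρ (noDigit_write ψ R))
      (fun C t => ih₂ ρ R C (by simp only [List.length_append]; omega) h40 hρ hR) h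
  | ex x φ ih =>
    cases ρ with
    | nil => exact absurd hρ (lt_irrefl 0)
    | cons p ρ =>
    have e : (Formula.ex x φ).write ++ R = .ex :: (writeVar x ++ (φ.write ++ R)) := by
      simp [Formula.write]
    rw [e] at hs ⊢
    obtain ⟨L, hL⟩ : ∃ L, L = p.2.length ^ (2 * (i + 1)) := ⟨_, rfl⟩
    obtain ⟨s', hs'⟩ : ∃ s', s' = s ^ (2 * i + 3) := ⟨_, rfl⟩
    have hp : 0 < p.2.length := hρ
    simp only [writeVar, List.length_cons, List.length_append, List.length_map, Env.code_cons]
      at hs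
    have hpl := length_entryCode p
    have hLs : L ≤ s ^ (2 * (i + 1)) := hL ▸ Nat.pow_le_pow_left (by omega) _
    have hss : s ≤ s ^ (2 * (i + 1)) := Nat.le_self_pow (by omega) s
    -- The spare factor `s` makes room for the new word, its name and the old stacks within the new
    -- bound `s'`.
    have hs4 : 4 * s ^ (2 * (i + 1)) ≤ s' := by
      rw [hs', show 2 * i + 3 = 2 * (i + 1) + 1 by ring, pow_succ, mul_comm]
      exact Nat.mul_le_mul_left _ (by omega)
    have h₁ := does_enter x p (noDigit_write φ R) C (Env.code ρ) hp
    have h₂ := does_begin_scope (i := i) (φ.write ++ R) C (Env.code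
      ((x, List.replicate L (firstDigit i)) :: p :: ρ))
    have h₃ : Does (evalStep (some .ex)) (mainStore (writeVar x ++ (φ.write ++ R)) C
        (Env.code (p :: ρ))) (Sum.inl .eval) _ _ :=
      h₁.andThen (Does.andThen (S₁ := mainStore (φ.write ++ R)
        (.ex :: ((φ.write ++ R).map .txt ++ .base :: C))
        (Env.code ((x, List.replicate L (firstDigit i)) :: p :: ρ)))
        (by rw [hL] at h₂ ⊢; exact h₂) (Does.pure _))
    have hcode : ∀ w : List (Dig i), w.length = L →
        (Env.code ((x, w) :: p :: ρ)).length = (Nat.bits x).length + L + 2 +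
          ((entryCode p).length + (Env.code ρ).length) := by
      intro w hw
      rw [Env.code_cons, Env.code_cons, List.length_append, List.length_append, length_entryCode,
        hw]
    have h₄ := does_loop φ x L (p :: ρ) R C (D := s') (K := φ.cost i s')
      (by rw [List.length_append]; omega)
      (fun w hw C t h => ih ((x, w) :: p :: ρ) R C (s := s')
        (by rw [hcode w hw, List.length_append]; omega) (by omega)
        (by change 0 < w.length; rw [hw, hL]; exact pow_pos hp _) hR h)
      -- There are `i + 2` digits. Starting with the word number 0, the condition on `wordNumber` is
      -- empty and the loop decides the full quantifier.
      ((i + 2) ^ L) (List.replicate L (firstDigit i)) (List.length_replicate ..) (by omega)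
      (b := b) (S' := S') (t := t) (by
        rw [Formula.eval] at h
        convert h using 3
        simp only [decide_eq_decide, wordNumber_replicate, Nat.zero_le, true_and]
        exact exists_congr fun w => and_congr_left' (by rw [hL]; rfl))
    refine Does.mono (evaluate_eval h₃ h₄) ?_
    rw [Formula.cost, ← hs']
    have h₅ : (i + 2) ^ L * (φ.cost i s' + 50 * s') ≤ (i + 2) ^ s' * (φ.cost i s' + 50 * s') :=
      Nat.mul_le_mul_right _ (Nat.pow_le_pow_right (by omega) (by omega))
    have h₆ : (40 * (i + 1) + 3) * (p.2.length ^ (2 * (i + 1)) + 1) ≤ (40 * (i + 1) + 3) * s' :=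
      Nat.mul_le_mul_left _ (by omega)
    have h₇ : (40 * i + 200) * s' = (40 * (i + 1) + 3) * s' + 157 * s' := by ring
    rw [List.length_append]
    omega

end OrdinalAddition

/-! ## The decision procedure -/

namespace OrdinalAddition

open StackProgram Prog

variable {i : ℕ}

/-! ### Towers, numbers of quantifiers and numbers of states. -/

theorem le_tower (k m : ℕ) : m ≤ tower k m := by
  induction k with
  | zero => exact le_rfl
  | succ k ih => exact ih.trans Nat.lt_two_pow_self.le

theorem tower_add (k l m : ℕ) : tower (k + l) m = tower k (tower l m) := by
  induction k with
  | zero => rw [Nat.zero_add]; rfl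
  | succ k ih => rw [Nat.succ_add, tower, tower, ih]

theorem tower_mono {k l m n : ℕ} (hk : k ≤ l) (hm : m ≤ n) : tower k m ≤ tower l n := by
  have h : ∀ k, tower k m ≤ tower k n := by
    intro k
    induction k with
    | zero => exact hm
    | succ k ih => exact Nat.pow_le_pow_right (by omega) ih
  obtain ⟨d, rfl⟩ := Nat.exists_eq_add_of_le hk
  refine (h k).trans ?_
  rw [add_comm, tower_add]
  exact le_tower d _

/-- For `a` and `b` at least 2 the sum is at most the product, so `2 ^ a * 2 ^ b ≤ 2 ^ (a * b)`.
Thus multiplying numbers of states affects only the top of the tower. -/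
theorem tower_mul_tower_le (k : ℕ) {m n : ℕ} (hm : 2 ≤ m) (hn : 2 ≤ n) :
    tower k m * tower k n ≤ tower k (m * n) := by
  induction k with
  | zero => exact le_rfl
  | succ k ih =>
    have h₁ := hm.trans (le_tower k m)
    have h₂ := hn.trans (le_tower k n)
    rw [tower, tower, tower, ← pow_add]
    refine Nat.pow_le_pow_right (by omega) (le_trans ?_ ih)
    nlinarith

/-- Whether a letter is a quantifier. -/
def Letter.isEx : Letter → Bool
  | .ex => true
  | _ => false

/-- The number of quantifiers in a text. -/
def quantifiers (T : List Letter) : ℕ := T.countP Letter.isEx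

theorem quantifiers_writeVar (x : ℕ) : quantifiers (writeVar x) = 0 := by
  refine List.countP_eq_zero.2 fun l hl => ?_
  simp only [writeVar, List.mem_cons, List.mem_map] at hl
  rcases hl with rfl | ⟨b, -, rfl⟩ <;> simp [Letter.isEx]

theorem quantifiers_append (T T' : List Letter) :
    quantifiers (T ++ T') = quantifiers T + quantifiers T' := List.countP_append

theorem quantifiers_cons (l : Letter) (T : List Letter) :
    quantifiers (l :: T) = quantifiers T + if l.isEx then 1 else 0 := List.countP_cons ..

/-- A quantifier takes at least two letters, itself and the letter of its variable, and the atomic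
formulas take at least four. The height of the tower is thereby only about half the length. -/
theorem two_mul_quantifiers_le (φ : Formula) : 2 * quantifiers φ.write + 4 ≤ φ.write.length := by
  induction φ <;> simp only [Formula.write, quantifiers_cons, quantifiers_append,
    quantifiers_writeVar, Letter.isEx, List.length_cons, List.length_append] <;>
    simp [writeVar] <;> omega

/-- Atomic formulas contribute factors `2 ^ 7`, which fit into `2 ^ (7 * length)` on top.
Connectives multiply, which the top absorbs, and only quantifiers raise the height. -/
theorem states_le_tower (φ : Formula) :
    φ.states ≤ tower (quantifiers φ.write) (2 ^ (7 * φ.write.length)) := by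
  have hbin : ∀ {φ ψ : Formula} {n : ℕ},
      φ.states ≤ tower (quantifiers φ.write) (2 ^ (7 * φ.write.length)) →
      ψ.states ≤ tower (quantifiers ψ.write) (2 ^ (7 * ψ.write.length)) →
      φ.write.length + ψ.write.length ≤ n → φ.states * ψ.states ≤
        tower (quantifiers φ.write + quantifiers ψ.write) (2 ^ (7 * n)) := by
    intro φ ψ n h₁ h₂ hn
    have hl := two_mul_quantifiers_le φ
    have hl' := two_mul_quantifiers_le ψ
    have two : ∀ {n : ℕ}, 4 ≤ n → 2 ≤ 2 ^ (7 * n) := fun h =>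
      Nat.le_self_pow (by omega) 2
    calc φ.states * ψ.states
        ≤ tower (quantifiers φ.write + quantifiers ψ.write) (2 ^ (7 * φ.write.length)) *
          tower (quantifiers φ.write + quantifiers ψ.write) (2 ^ (7 * ψ.write.length)) :=
          Nat.mul_le_mul (h₁.trans (tower_mono (by omega) le_rfl))
            (h₂.trans (tower_mono (by omega) le_rfl))
      _ ≤ _ := tower_mul_tower_le _ (two (by omega)) (two (by omega))
      _ ≤ _ := tower_mono le_rfl (by
          rw [← pow_add]
          exact Nat.pow_le_pow_right (by omega) (by omega))
  induction φ with
  | plus x y z =>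
    refine le_trans ?_ (le_tower _ _)
    rw [Formula.states, show 128 = 2 ^ 7 by norm_num]
    exact Nat.pow_le_pow_right (by omega) (by simp [Formula.write])
  | neg φ ih =>
    refine ih.trans (tower_mono ?_ (Nat.pow_le_pow_right (by omega) ?_)) <;>
      simp [Formula.write, quantifiers_cons, Letter.isEx]
  | conj φ ψ ih₁ ih₂ | disj φ ψ ih₁ ih₂ | imp φ ψ ih₁ ih₂ | iff φ ψ ih₁ ih₂ =>
    refine (hbin ih₁ ih₂ (Nat.le_succ _)).trans (tower_mono ?_ ?_) <;>
      simp [Formula.write, quantifiers_cons, quantifiers_append, Letter.isEx]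
  | ex x φ ih =>
    simp only [Formula.states, Formula.write, quantifiers_cons, quantifiers_append,
      quantifiers_writeVar, Letter.isEx, if_true, Nat.zero_add]
    exact Nat.pow_le_pow_right (by omega) (ih.trans (tower_mono le_rfl
      (Nat.pow_le_pow_right (by omega) (by simp; omega))))

theorem holds_congr {α : Ordinal.{0}} (φ : Formula) {v v' : ℕ → Set.Iio α}
    (h : ∀ x ∈ φ.freeVars, v x = v' x) : φ.Holds α v ↔ φ.Holds α v' := by
  induction φ generalizing v v' with
  | plus x y z =>
    simp only [Formula.freeVars, Finset.mem_insert, Finset.mem_singleton] at h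
    simp only [Formula.Holds, h x (Or.inl rfl), h y (Or.inr (Or.inl rfl)),
      h z (Or.inr (Or.inr rfl))]
  | neg φ ih => exact not_congr (ih h)
  | conj φ ψ ih₁ ih₂ =>
    exact and_congr (ih₁ fun x hx => h x (Finset.mem_union_left _ hx))
      (ih₂ fun x hx => h x (Finset.mem_union_right _ hx))
  | disj φ ψ ih₁ ih₂ =>
    exact or_congr (ih₁ fun x hx => h x (Finset.mem_union_left _ hx))
      (ih₂ fun x hx => h x (Finset.mem_union_right _ hx))
  | imp φ ψ ih₁ ih₂ =>
    exact imp_congr (ih₁ fun x hx => h x (Finset.mem_union_left _ hx))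
      (ih₂ fun x hx => h x (Finset.mem_union_right _ hx))
  | iff φ ψ ih₁ ih₂ =>
    exact iff_congr (ih₁ fun x hx => h x (Finset.mem_union_left _ hx))
      (ih₂ fun x hx => h x (Finset.mem_union_right _ hx))
  | ex y φ ih =>
    refine exists_congr fun a => ih fun x hx => ?_
    by_cases hxy : x = y
    · subst hxy
      simp
    · rw [Function.update_of_ne hxy, Function.update_of_ne hxy]
      exact h x (Finset.mem_erase.2 ⟨hxy, hx⟩)

/-! ### The start of the evaluation and the complete program. -/

/-- The length of the first word. -/
def startLength (T : List Letter) : ℕ := tower (quantifiers T + 1) (7 * T.length)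

/-- The first environment. -/
noncomputable def startEnv (i : ℕ) (T : List Letter) : Env i :=
  [(0, List.replicate (startLength T) (firstDigit i))]

/-- The entry for the variable `x_0` is a dummy, as a sentence does not depend on the valuation. It
serves to provide an initial length that is at least the number of states. -/
theorem eval_startEnv (φ : Sentence) :
    φ.1.eval (startEnv i φ.1.write) = true ↔ φ ∈ theory (base (i + 1)) := by
  have hsize : Env.size (startEnv i φ.1.write) = startLength φ.1.write := by
    simp [startEnv, Env.size]
  have hM : startLength φ.1.write =
      tower (quantifiers φ.1.write) (2 ^ (7 * φ.1.write.length)) := tower_add _ 1 _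
  have hst : φ.1.states ≤ startLength φ.1.write := hM ▸ states_le_tower φ.1
  have h4 : 4 ≤ startLength φ.1.write := by
    have := two_mul_quantifiers_le φ.1
    refine le_trans ?_ (le_tower _ _)
    omega
  rw [φ.1.eval_iff _ (by rw [hsize]; exact h4) (by rw [hsize]; exact hst)
    (by simp [startEnv, Env.size])]
  refine ⟨fun h v => (holds_congr φ.1 ?_).1 h, fun h => h _⟩
  rw [φ.2]
  simp

/-- Push seven marks to the stack `a`. -/
def pushSeven : Program i Unit :=
  (push .a ()).andThen ((push .a ()).andThen ((push .a ()).andThen ((push .a ()).andThen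
    ((push .a ()).andThen ((push .a ()).andThen (push .a ()))))))

/-- Move the input to the stack `text`, and make the first environment. -/
noncomputable def setup : Program i Unit :=
  (drain .inp fun l => (push .text2 l).andThen pushSeven).andThen (expo.andThen
    ((drain .text2 fun l => (push .text l).andThen (if l.isEx then expo else Prog.pure ())).andThen
      newEntry))

theorem does_read_input (T : List Letter) {S : Store i} (hS : S.inp = T) :
    Does (drain .inp fun l => (push .text2 l).andThen pushSeven) S () { S with
      inp := []
      text2 := T.reverse ++ S.text2
      a := List.replicate (7 * T.length) () ++ S.a } (10 * T.length + 2) := by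
  induction T generalizing S with
  | nil =>
    refine Does.congr (Does.drain_nil hS) ?_ (by simp)
    change S = ({ S with inp := [] } : Store i)
    rw [← show S.inp = [] from hS]
  | cons l T ih =>
    have h : Does ((push .text2 l).andThen pushSeven) (S.set .inp T) () { S with
        inp := T
        text2 := l :: S.text2
        a := List.replicate 7 () ++ S.a } 8 :=
      (Does.push .text2 l).andThen ((Does.push .a ()).andThen ((Does.push .a ()).andThen
        ((Does.push .a ()).andThen ((Does.push .a ()).andThen ((Does.push .a ()).andThen
          ((Does.push .a ()).andThen (Does.push .a ())))))))
    refine Does.congr (Does.drain_cons hS h (ih rfl)) ?_ ?_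
    · dsimp only
      rw [← List.append_assoc, List.replicate_append_replicate, List.reverse_cons,
        List.append_assoc]
      rfl
    · simp only [List.length_cons]
      omega

/-- One exponentiation for each quantifier letter, performed while the text is moved back, produces
the tower without any parsing. The bottom of the tower is charged to its final value. -/
theorem does_make_tower (T : List Letter) (m : ℕ) {S : Store i} (hS : S.text2 = T)
    (ha : S.a = List.replicate m ()) (hb : S.b = []) (ht : S.t = []) :
    Does (drain .text2 fun l => (push .text l).andThen (if l.isEx then expo else Prog.pure ())) S ()
      { S with
        text := T.reverse ++ S.text
        text2 := []
        a := List.replicate (tower (quantifiers T) m) () }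
      (T.length * (25 * tower (quantifiers T) m + 4) + 2) := by
  induction T generalizing S m with
  | nil =>
    refine Does.congr (Does.drain_nil hS) ?_ (by simp)
    change S = ({ S with text2 := [], a := List.replicate m () } : Store i)
    rw [← ha, ← show S.text2 = [] from hS]
  | cons l T ih =>
    cases hl : l.isEx with
    | false =>
      have e : quantifiers (l :: T) = quantifiers T := by
        rw [quantifiers_cons, hl]
        rfl
      rw [e]
      refine Does.congr (Does.drain_cons hS ((Does.push .text l).andThen (t₂ := 1) ?_)
        (ih m (S := { S with text := l :: S.text, text2 := T }) rfl ha hb ht)) ?_ ?_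
      · rw [hl]
        exact Does.pure ()
      · simp
      · rw [List.length_cons, add_one_mul]
        omega
    | true =>
      have e : tower (quantifiers (l :: T)) m = tower (quantifiers T) (2 ^ m) := by
        rw [quantifiers_cons, hl]
        exact tower_add _ 1 _
      rw [e]
      refine Does.congr (Does.drain_cons hS ((Does.push .text l).andThen (t₂ := 25 * 2 ^ m) ?_)
        (ih (2 ^ m) (S := { S with
          text := l :: S.text, text2 := T, a := List.replicate (2 ^ m) () })
          rfl rfl hb ht)) ?_ ?_
      · rw [hl]
        exact does_expo (S := { S with text := l :: S.text, text2 := T }) ha hb ht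
      · simp
      · have := le_tower (quantifiers T) (2 ^ m)
        rw [List.length_cons, add_one_mul]
        omega

theorem does_setup (T : List Letter) :
    Does setup ({ inp := T } : Store i) () (mainStore T [] (startEnv i T).code)
      (100 * ((T.length + 1) * startLength T)) := by
  have hrev : quantifiers T.reverse = quantifiers T := List.countP_reverse
  have e : tower (quantifiers T.reverse) (2 ^ (7 * T.length)) = startLength T := by
    rw [hrev]
    exact (tower_add _ 1 _).symm
  have h₁ : Does (drain .inp fun l => (push .text2 l).andThen pushSeven) ({ inp := T } : Store i) ()
      ({ text2 := T.reverse, a := List.replicate (7 * T.length) () } : Store i)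
      (10 * T.length + 2) :=
    Does.congr (does_read_input T rfl) (by simp) le_rfl
  have h₂ := does_expo (S := ({ text2 := T.reverse, a := List.replicate (7 * T.length) () } :
    Store i)) rfl rfl rfl
  have h₃ := does_make_tower T.reverse (2 ^ (7 * T.length)) (S := ({
    text2 := T.reverse, a := List.replicate (2 ^ (7 * T.length)) () } : Store i)) rfl rfl rfl rfl
  rw [e, List.length_reverse] at h₃
  have h₄ := does_new_entry 0 (startLength T) (S := ({
    text := T.reverse.reverse ++ [], a := List.replicate (startLength T) () } : Store i)) rfl rfl
  refine Does.congr (h₁.andThen (h₂.andThen (h₃.andThen h₄))) ?_ ?_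
  · simp [mainStore, startEnv, Env.code]
  · have h₅ : 2 ^ (7 * T.length) ≤ startLength T := by
      rw [← e]
      exact le_tower _ _
    have h₆ : 1 ≤ startLength T := Nat.one_le_two_pow.trans h₅
    have h₇ : T.length ≤ T.length * startLength T := Nat.le_mul_of_pos_right _ h₆
    have h₈ : T.length * (25 * startLength T + 4) = 25 * (T.length * startLength T) +
      4 * T.length := by ring
    have h₉ : (T.length + 1) * startLength T = T.length * startLength T + startLength T := by ring
    simp only [Nat.zero_bits, List.length_nil]
    omega

/-- The decision procedure. -/
noncomputable def decisionProgram (i : ℕ) : Program i Unit :=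
  setup.andThen ((evaluate .eval).next fun b => (clear .env).andThen (push .out b))

theorem does_decide (φ : Formula) {s : ℕ} (hs : startLength φ.write + φ.write.length + 42 ≤ s) :
    Does (decisionProgram i) { inp := φ.write } ()
      -- The constant 42 in `hs` consists of the two marks in the code of the first entry, whose
      -- name is empty, and the lower bound 40 needed by `does_eval`.
      { out := [φ.eval (startEnv i φ.write)] }
      (100 * ((φ.write.length + 1) * startLength φ.write) +
        φ.cost i s + 3 * startLength φ.write + 20) := by
  have hlen : (Env.code (startEnv i φ.write)).length = startLength φ.write + 2 := by
    simp [startEnv, Env.code, entryCode]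
  have hpos : 0 < startLength φ.write := Nat.two_pow_pos _
  have h₀ : Does ((pop Stk.ctrl).next (retStep (φ.eval (startEnv i φ.write))))
      (mainStore [] [] (startEnv i φ.write).code) (Sum.inr (φ.eval (startEnv i φ.write)))
      (mainStore [] [] (startEnv i φ.write).code) (1 + 1) :=
    (Does.pop_nil (k := .ctrl) rfl).next (Does.pure _)
  have h₁ : Does (evaluate (.ret (φ.eval (startEnv i φ.write))))
      (mainStore [] [] (startEnv i φ.write).code) (φ.eval (startEnv i φ.write))
      (mainStore [] [] (startEnv i φ.write).code) 2 := Does.iter_stop h₀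
  have h₂ := does_eval φ (startEnv i φ.write) [] [] (s := s)
    (by rw [hlen, List.append_nil]; omega) (by omega) (by simpa [startEnv, Env.size] using hpos)
    (fun b R' h => by cases h) h₁
  rw [List.append_nil] at h₂
  refine Does.congr ((does_setup φ.write).andThen (h₂.next
    ((does_clear .env _).andThen (Does.push .out _)))) rfl ?_
  change _ + (_ + (3 * (startEnv i φ.write).code.length + 2 + 1)) ≤ _
  rw [hlen]
  omega

end OrdinalAddition

/-! ## The time of the decision procedure -/

namespace OrdinalAddition

open StackProgram Prog

/-- Nested quantifiers iterate `s ↦ s ^ (2 * i + 3)`, which multiplies exponents. The base `2 * i +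
5` leaves two units per quantifier for the number of words and the other factors. The bound has only
a fixed number of exponentials, however deep the formula is. -/
theorem cost_le (i : ℕ) (φ : Formula) {s : ℕ} (hs : 40 * i + 300 ≤ s) :
    φ.cost i s ≤ 2 ^ s ^ (2 * i + 5) ^ φ.write.length := by
  have hone : ∀ m, 1 ≤ (2 * i + 5) ^ m := fun m => Nat.one_le_pow _ _ (by omega)
  have hgrow : ∀ {m n}, m < n → (2 * i + 5) ^ m + 1 ≤ (2 * i + 5) ^ n := fun h =>
    Nat.pow_lt_pow_right (by omega) h
  have hself : ∀ {s a : ℕ}, 40 * i + 300 ≤ s → 1 ≤ a → s ≤ s ^ a := fun _ h =>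
    Nat.le_self_pow (by omega) _
  have hstep : ∀ {s a b : ℕ}, 40 * i + 300 ≤ s → 1 ≤ a → a + 1 ≤ b →
      2 ^ (2 * s ^ a + 2) ≤ 2 ^ s ^ b := by
    intro s a b hs ha hb
    refine Nat.pow_le_pow_right (by omega) ?_
    have h₁ := hself hs ha
    calc 2 * s ^ a + 2 ≤ s ^ a * s := by nlinarith
      _ = s ^ (a + 1) := (pow_succ _ _).symm
      _ ≤ s ^ b := Nat.pow_le_pow_right (by omega) hb
  have hbin : ∀ {s m n k K L : ℕ}, 40 * i + 300 ≤ s → 1 ≤ m → 1 ≤ n → m + n < k →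
      K ≤ 2 ^ s ^ (2 * i + 5) ^ m → L ≤ 2 ^ s ^ (2 * i + 5) ^ n →
      K + L + 10 ≤ 2 ^ s ^ (2 * i + 5) ^ k := by
    intro s m n k K L hs hm hn hk hK hL
    have e : ∀ {l}, l ≤ m + n → s ^ (2 * i + 5) ^ l ≤ s ^ (2 * i + 5) ^ (m + n) := fun h =>
      Nat.pow_le_pow_right (by omega) (Nat.pow_le_pow_right (by omega) h)
    have hK' := hK.trans (Nat.pow_le_pow_right (by omega) (e (Nat.le_add_right m n)))
    have hL' := hL.trans (Nat.pow_le_pow_right (by omega) (e (Nat.le_add_left n m)))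
    refine le_trans ?_ (hstep hs (hone (m + n)) (hgrow hk))
    have h₁ := hself hs (hone (m + n))
    have h₂ : s ^ (2 * i + 5) ^ (m + n) < 2 ^ s ^ (2 * i + 5) ^ (m + n) := Nat.lt_two_pow_self
    have h₃ : 2 ^ (s ^ (2 * i + 5) ^ (m + n) + 2) ≤ 2 ^ (2 * s ^ (2 * i + 5) ^ (m + n) + 2) :=
      Nat.pow_le_pow_right (by omega) (by omega)
    rw [pow_add] at h₃
    omega
  have hlen : ∀ φ : Formula, 1 ≤ φ.write.length := fun φ => by
    have := two_mul_quantifiers_le φ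
    omega
  induction φ generalizing s with
  | plus x y z =>
    have h₁ : 2 ≤ (2 * i + 5) ^ (Formula.plus x y z).write.length := by
      have := hgrow (hlen (Formula.plus x y z))
      rw [pow_zero] at this
      exact this
    calc Formula.cost i (.plus x y z) s = 300 * s := rfl
      _ ≤ s ^ 2 := by nlinarith
      _ ≤ s ^ (2 * i + 5) ^ (Formula.plus x y z).write.length :=
        Nat.pow_le_pow_right (by omega) h₁
      _ ≤ _ := Nat.lt_two_pow_self.le
  | neg φ ih =>
    have := hself hs (hone φ.write.length)
    have h₂ : s ^ (2 * i + 5) ^ φ.write.length < 2 ^ s ^ (2 * i + 5) ^ φ.write.length :=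
      Nat.lt_two_pow_self
    have h₃ : 2 ^ (s ^ (2 * i + 5) ^ φ.write.length + 2) ≤
        2 ^ (2 * s ^ (2 * i + 5) ^ φ.write.length + 2) :=
      Nat.pow_le_pow_right (by omega) (by omega)
    rw [pow_add] at h₃
    refine le_trans ?_ (hstep hs (hone φ.write.length) (hgrow (by simp [Formula.write])))
    rw [Formula.cost]
    have := ih hs
    omega
  | conj φ ψ ih₁ ih₂ | disj φ ψ ih₁ ih₂ | imp φ ψ ih₁ ih₂ | iff φ ψ ih₁ ih₂ =>
    exact hbin hs (hlen φ) (hlen ψ) (by simp [Formula.write]) (ih₁ hs) (ih₂ hs)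
  | ex x φ ih =>
    obtain ⟨a, ha⟩ : ∃ a, a = (2 * i + 5) ^ φ.write.length := ⟨_, rfl⟩
    obtain ⟨g, hg⟩ : ∃ g, g = 2 * i + 3 := ⟨_, rfl⟩
    have ha1 : 1 ≤ a := ha ▸ hone _
    have hsg : s ≤ s ^ g := hself hs (by omega)
    have hga : g ≤ g * a := Nat.le_mul_of_pos_right _ ha1
    have h₁ : φ.cost i (s ^ g) ≤ 2 ^ s ^ (g * a) := by
      rw [pow_mul, ha]
      exact ih (hs.trans hsg)
    have hX : ∀ {c}, c ≤ g * a + 1 → 2 ^ s ^ c ≤ 2 ^ s ^ (g * a + 1) := fun h =>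
      Nat.pow_le_pow_right (by omega) (Nat.pow_le_pow_right (by omega) h)
    have h₂ : (i + 2) ^ s ^ g ≤ 2 ^ s ^ (g * a + 1) := by
      refine le_trans ?_ (hX (c := g + 1) (by omega))
      rw [pow_succ s g, mul_comm, pow_mul]
      exact Nat.pow_le_pow_left ((by omega : i + 2 ≤ s).trans Nat.lt_two_pow_self.le) _
    have h₃ : ∀ {c}, c ≤ s → c * s ^ g ≤ 2 ^ s ^ (g * a + 1) := by
      intro c hc
      refine le_trans ?_ (hX (c := g + 1) (by omega))
      refine le_trans ?_ Nat.lt_two_pow_self.le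
      rw [pow_succ, mul_comm]
      exact Nat.mul_le_mul_left _ hc
    have h₄ : g * a + 2 ≤ (2 * i + 5) ^ (Formula.ex x φ).write.length := by
      calc g * a + 2 ≤ (2 * i + 5) * a := by rw [hg]; nlinarith
        _ = (2 * i + 5) ^ (φ.write.length + 1) := by rw [ha, pow_succ, mul_comm]
        _ ≤ _ := Nat.pow_le_pow_right (by omega) (by simp [Formula.write, writeVar]; omega)
    -- With `X = 2 ^ s ^ (g * a + 1)` the cost is at most `X * (X + X) + X`, hence at most `4 * X ^
    -- 2 = 2 ^ (2 * s ^ (g * a + 1) + 2)`, which is the form that `hstep` absorbs.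
    refine le_trans ?_ (hstep hs (Nat.le_add_left 1 (g * a)) h₄)
    obtain ⟨X, hX'⟩ : ∃ X, X = 2 ^ s ^ (g * a + 1) := ⟨_, rfl⟩
    have h₅ := h₁.trans (hX (Nat.le_succ (g * a)))
    have h₆ := h₃ (c := 50) (by omega)
    have h₇ := h₃ (c := 40 * i + 200) (by omega)
    have hX1 : 1 ≤ X := hX' ▸ Nat.one_le_two_pow
    rw [Formula.cost, ← hg]
    rw [← hX'] at h₂ h₅ h₆ h₇
    calc _ ≤ X * (X + X) + X := Nat.add_le_add (Nat.mul_le_mul h₂ (Nat.add_le_add h₅ h₆)) h₇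
      _ ≤ X ^ 2 * 4 := by nlinarith
      _ = _ := by
        rw [hX', pow_add 2 _ 2, mul_comm 2, pow_mul 2 _ 2]
        norm_num

/-! ### The total time is below the tower. -/

/-- A bound for the length of the first word in terms of the length of the text. -/
def wordBound (n : ℕ) : ℕ := tower (n / 2 - 1) (7 * n)

/-- A bound for the number of steps of the decision procedure. -/
def timeBound (i n : ℕ) : ℕ :=
  100 * ((n + 1) * wordBound n) + 2 ^ (wordBound n + n + 40 * i + 300) ^ (2 * i + 5) ^ n +
    3 * wordBound n + 21

theorem startLength_le (φ : Formula) : startLength φ.write ≤ wordBound φ.write.length := by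
  have := two_mul_quantifiers_le φ
  exact tower_mono (by omega) le_rfl

theorem does_decide_timeBound (i : ℕ) (φ : Formula) :
    ∃ t, t + 1 ≤ timeBound i φ.write.length ∧
      Does (decisionProgram i) { inp := φ.write } ()
        { out := [φ.eval (startEnv i φ.write)] } t := by
  have h := startLength_le φ
  have h₁ := cost_le i φ (s := wordBound φ.write.length + φ.write.length + 40 * i + 300) (by omega)
  refine ⟨_, ?_, does_decide φ (s := wordBound φ.write.length + φ.write.length + 40 * i + 300)
    (by omega)⟩
  have h₂ := Nat.mul_le_mul_left (φ.write.length + 1) h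
  rw [timeBound]
  omega

theorem le_tower_one {n : ℕ} (hn : 8 ≤ n) : 14 * n + 100 ≤ tower n 1 := by
  have h₁ : ∀ n, n + 1 ≤ tower n 1 := by
    intro n
    induction n with
    | zero => exact le_rfl
    | succ n ih => exact ih.trans_lt Nat.lt_two_pow_self
  obtain ⟨m, rfl⟩ : ∃ m, n = m + 1 := ⟨n - 1, by omega⟩
  refine le_trans ?_ (Nat.pow_le_pow_right (by omega) (h₁ m))
  obtain ⟨k, rfl⟩ := Nat.exists_eq_add_of_le (by omega : 7 ≤ m)
  clear hn
  induction k with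
  | zero => norm_num
  | succ k ih =>
    rw [show 7 + (k + 1) + 1 = (7 + k + 1) + 1 by ring, pow_succ]
    omega

/-- The first word has length at most `T`, a tower of height `n / 2 - 1` over `7 * n`, and the whole
computation costs five more exponentials. Since `n ≥ 40 * i + 300`, all terms in `i` are below `T`.
-/
theorem timeBound_le (i : ℕ) {n : ℕ} (hn : 40 * i + 300 ≤ n) : timeBound i n ≤ tower n 1 := by
  obtain ⟨T, hT⟩ : ∃ T, T = wordBound n := ⟨_, rfl⟩
  have hTn : 2 ^ (7 * n) ≤ T := by
    rw [hT]
    exact tower_mono (k := 1) (by omega) le_rfl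
  have hnT : 7 * n < T := Nat.lt_two_pow_self.trans_le hTn
  have hTT : T < 2 ^ T := Nat.lt_two_pow_self
  have hT2 : 2 * T ≤ 2 ^ T := by
    obtain ⟨U, rfl⟩ : ∃ U, T = U + 1 := ⟨T - 1, by omega⟩
    have : U < 2 ^ U := Nat.lt_two_pow_self
    rw [pow_succ]
    omega
  have h₁ : (2 * i + 5) ^ n ≤ 2 ^ T := by
    calc (2 * i + 5) ^ n ≤ (2 ^ n) ^ n := Nat.pow_le_pow_left
          ((by omega : 2 * i + 5 ≤ n).trans Nat.lt_two_pow_self.le) n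
      _ = 2 ^ (n * n) := (pow_mul _ _ _).symm
      _ ≤ 2 ^ T := by
        refine Nat.pow_le_pow_right (by omega) (le_trans ?_ hTn)
        calc n * n ≤ 2 ^ n * 2 ^ n := Nat.mul_le_mul Nat.lt_two_pow_self.le Nat.lt_two_pow_self.le
          _ = 2 ^ (n + n) := (pow_add _ _ _).symm
          _ ≤ _ := Nat.pow_le_pow_right (by omega) (by omega)
  have h₂ : (T + n + 40 * i + 300) ^ (2 * i + 5) ^ n ≤ 2 ^ 2 ^ 2 ^ T := by
    calc (T + n + 40 * i + 300) ^ (2 * i + 5) ^ n ≤ (2 ^ (2 * T)) ^ 2 ^ T := by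
          refine (Nat.pow_le_pow_left ?_ _).trans (Nat.pow_le_pow_right (by positivity) h₁)
          rw [two_mul, pow_add]
          nlinarith
      _ = 2 ^ (2 * T * 2 ^ T) := (pow_mul _ _ _).symm
      _ ≤ 2 ^ 2 ^ 2 ^ T := by
        refine Nat.pow_le_pow_right (by omega) ?_
        calc 2 * T * 2 ^ T ≤ 2 ^ T * 2 ^ T := Nat.mul_le_mul_right _ hT2
          _ = 2 ^ (2 * T) := by rw [← pow_add, two_mul]
          _ ≤ _ := Nat.pow_le_pow_right (by omega) hT2
  obtain ⟨Z, hZ⟩ : ∃ Z, Z = 2 ^ 2 ^ 2 ^ T := ⟨_, rfl⟩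
  have hZT : 2 ^ T * 2 ^ T ≤ Z := by
    rw [hZ, ← pow_add]
    refine Nat.pow_le_pow_right (by omega) ?_
    have : 2 ^ T < 2 ^ 2 ^ T := Nat.lt_two_pow_self
    omega
  have hZ3 : 3 ≤ Z := by nlinarith
  have h₃ : timeBound i n ≤ 2 ^ 2 ^ Z := by
    rw [timeBound, ← hT]
    have h₄ : 2 ^ (T + n + 40 * i + 300) ^ (2 * i + 5) ^ n ≤ 2 ^ Z :=
      Nat.pow_le_pow_right (by omega) (hZ ▸ h₂)
    have h₅ : 100 * ((n + 1) * T) + 3 * T + 21 ≤ 100 * Z := by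
      nlinarith
    have h₆ : 100 * Z ≤ 100 * 2 ^ Z := Nat.mul_le_mul_left _ Nat.lt_two_pow_self.le
    have h₈ : 2 ^ (Z + 7) ≤ 2 ^ 2 ^ Z := by
      refine Nat.pow_le_pow_right (by omega) ?_
      obtain ⟨U, hU⟩ : ∃ U, Z = U + 3 := ⟨Z - 3, by omega⟩
      have : U < 2 ^ U := Nat.lt_two_pow_self
      rw [hU, pow_add]
      omega
    rw [pow_add] at h₈
    omega
  refine h₃.trans ?_
  -- The `e` unused levels, about `n / 2 - 4` of them, generate the argument: `7 * n ≤ 14 * e + 100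
  -- ≤ tower e 1`.
  obtain ⟨e, he⟩ : ∃ e, n = (5 + (n / 2 - 1)) + e := ⟨n - (5 + (n / 2 - 1)), by omega⟩
  have h₉ : tower (5 + (n / 2 - 1)) (7 * n) = 2 ^ 2 ^ Z := by
    rw [tower_add, hZ, hT]
    rfl
  rw [← h₉]
  calc tower (5 + (n / 2 - 1)) (7 * n) ≤ tower (5 + (n / 2 - 1)) (tower e 1) :=
        tower_mono le_rfl (le_trans (by omega) (le_tower_one (by omega)))
    _ = tower n 1 := by rw [← tower_add, ← he]

open Classical in
theorem decidableInTimeO_theory_base (i : ℕ) :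
    DecidableInTimeO (theory (base (i + 1))) (fun n => tower n 1) := by
  have hin : ∀ w : List Letter, (({ inp := w } : Store i)).get =
      Function.update (β := fun k => List (Alph i k)) (fun _ => []) Stk.inp w := by
    intro w
    rw [← show (({} : Store i)).get = fun _ => [] by funext k; cases k <;> rfl]
    exact Store.get_set {} .inp w
  have hout : ∀ w : List Bool, (({ out := w } : Store i)).get =
      Function.update (β := fun k => List (Alph i k)) (fun _ => []) Stk.out w := by
    intro w
    rw [← show (({} : Store i)).get = fun _ => [] by funext k; cases k <;> rfl]
    exact Store.get_set {} .out w
  have hrun : ∀ φ : Sentence, ∃ t ≤ timeBound i φ.1.write.length,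
      (flip Option.bind (machine Stk.inp Stk.out (decisionProgram i)).step)^[t]
        (some (Turing.initList (machine Stk.inp Stk.out (decisionProgram i)) φ.1.write)) =
      some (Turing.haltList (machine Stk.inp Stk.out (decisionProgram i))
        [decide (φ ∈ theory (base (i + 1)))]) := by
    intro φ
    obtain ⟨t, ht, t', ht', h⟩ := does_decide_timeBound i φ.1
    rw [hin, hout] at h
    have e : φ.1.eval (startEnv i φ.1.write) = decide (φ ∈ theory (base (i + 1))) := by
      rw [Bool.eq_iff_iff, eval_startEnv, decide_eq_true_iff]
    rw [e] at h
    exact ⟨t' + 1, by omega, machine_evals Stk.inp Stk.out _ h⟩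
  refine ⟨{
    tm := machine Stk.inp Stk.out (decisionProgram i)
    inputAlphabet := Equiv.refl Letter
    outputAlphabet := Equiv.refl Bool
    time := timeBound i
    outputsFun := fun φ => Classical.choice ?_ }, ?_, ?_⟩
  · obtain ⟨t, ht, h⟩ := hrun φ
    refine ⟨⟨⟨t, ?_⟩, ht⟩⟩
    have e : φ.1.write.map (Equiv.refl Letter).invFun = φ.1.write := List.map_id _
    exact (congrArg (fun l : List Letter =>
      (flip Option.bind (machine Stk.inp Stk.out (decisionProgram i)).step)^[t]
        (some (Turing.initList (machine Stk.inp Stk.out (decisionProgram i)) l))) e).trans h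
  · exact fun k : Stk => (inferInstance : Finite (Alph i k))
  -- The index `i` enters only through the threshold beyond which the bound holds.
  · refine Asymptotics.IsBigO.of_bound 1 (Filter.eventually_atTop.2 ⟨40 * i + 300, fun n hn => ?_⟩)
    rw [one_mul, Real.norm_natCast, Real.norm_natCast]
    exact_mod_cast timeBound_le i hn

end OrdinalAddition

theorem theorem2 (i : ℕ) :
    ∃ c : ℕ, OrdinalAddition.DecidableInTimeO
      (OrdinalAddition.theory (Ordinal.omega0 ^ (Ordinal.omega0 ^ (i : Ordinal.{0}))))
      (fun n => OrdinalAddition.tower n c) :=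
  ⟨1, OrdinalAddition.base_succ i ▸ OrdinalAddition.decidableInTimeO_theory_base i⟩
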